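/- **Theorem (optimal error estimates for the OESV scheme).** *Equation.* Let $\Omega=[a,b]$, $\beta>0$, $T>0$, and let $U$ be the exact solution of $u_t+\beta u_x=0$ on $\Omega\times(0,T]$ with periodic boundary conditions (extended $(b-a)$-periodically in $x$). *Meshes and spaces.* A mesh consists of cells $I_i=[x_{i-1/2},x_{i+1/2}]$ of length $h_i$ partitioning $\Omega$, with $h=\max_i h_i$ and indices understood periodically. Fix $k\ge1$ and $\mathbb V^k=\{v: v|_{I_i}\in\mathbb P^k(I_i)\ \forall i\}$. Fix reference points $0=s_0<s_1<\dots<s_{k+1}=1$ and put $x_{i,j}=x_{i-1/2}+s_jh_i$; the control volumes are $I_{i,j}=[x_{i,j},x_{i,j+1}]$, $0\le j\le k$. Assume that there are weights $w_0,\dots,w_{k+1}$ such that $Q(v)=\sum_j w_jv(s_j)$ is exact on $[0,1]$ for polynomials of degree at most $2k-1$ and $\frac1{2k-1}-Q(L_{k+1}L_{k-1})>0$, where $L_\ell$ is the Legendre polynomial of degree $\ell$ shifted to $[0,1]$ and normalized by $\int_0^1L_\ell^2=\frac1{2\ell+1}$. Fix such weights. For $\omega\in\mathbb V^k$ let $M^*\omega$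 be the function equal on $I_{i,j}$ to the constant $\omega(x_{i-1/2}^+)+\sum_{l=0}^{j}h_iw_l\,\omega_x(x_{i,l})$ (with $\omega_x$ taken from inside $I_i$), and let $\|v\|_*^2=\int_\Omega v\,M^*v\,dx$ for $v\in\mathbb V^k$. $\|\cdot\|$ denotes the $L^2(\Omega)$ norm. *RKSV scheme.* Fix an explicit $s$-stage Runge–Kutta method of order $r\ge2$ with coefficients $c_{\ell\kappa},d_{\ell\kappa}$, $\sum_{\kappa\le\ell}c_{\ell\kappa}=1$. (Order $r$ is only needed for linear autonomous equations: one step with step size $z$ for $y'=y$, $y(0)=1$, gives $e^z+O(z^{r+1})$.) One step $u_h^n\mapsto u_h^{n+1}$ of the RKSV scheme for $u_t+\beta u_x=g$ is: $u^{n,0}_h=u_h^n$; for $0\le\ell<s$, $u_h^{n,\ell+1}\in\mathbb V^k$ satisfies, for all $i,j$, $$\int_{I_{i,j}}u_h^{n,\ell+1}=\sum_{\kappa\le\ell}\Big(c_{\ell\kappa}\int_{I_{i,j}}u_h^{n,\kappa}+\tau d_{\ell\kappa}\Big(\hat f_{i,j}(u_h^{n,\kappa})-\hat f_{i,j+1}(u_h^{n,\kappa})+\int_{I_{i,j}}g^{n,\kappa}\Big)\Big),$$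 with the upwind flux $\hat f_{i,j}(v)=\beta v(x_{i,j}^-)$; and $u_h^{n+1}=u_h^{n,s}$. *OESV scheme* (for $g\equiv0$). Each stage value, now denoted $\tilde u_h^{n,\ell+1}$ and computed from $u_h^{n,0},\dots,u_h^{n,\ell}$ by the formula above, is replaced by $u_h^{n,\ell+1}=\mathcal F_\tau\tilde u_h^{n,\ell+1}$. Here $\mathcal F_\tau v=y(\tau)$, where $y:[0,\tau]\to\mathbb V^k$ solves $y(0)=v$ and $$\frac{d}{d\hat t}\int_{I_i}y\varphi\,dx+\sum_{m=0}^k\delta_i^m(v)\int_{I_i}(y-P^{m-1}y)\varphi\,dx=0\qquad\forall i,\ \forall\varphi\in\mathbb P^k(I_i),$$ $P^m$ being the cellwise $L^2$ projection onto piecewise polynomials of degree at most $m$ and $P^{-1}=P^0$. The damping coefficients are $$\delta_i^m(v)=\sum_{e\in\partial I_i}\frac{\beta}{h_i}\cdot\frac{(2m+1)h_i^m}{2(2k-1)\,m!}\cdot\frac{\big|[\![\partial_x^mv]\!]_e\big|}{\|v-\mathrm{avg}_\Omega v\|_{L^\infty(\Omega)}},$$ with $\delta_i^m(v)=0$ if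 $v\equiv\mathrm{avg}_\Omega v$. *Statement.* There is an order of smoothness $q$, depending only on $k$ and the Runge–Kutta method, such that the following holds whenever $U$ is of class $C^q$ on $\mathbb R\times[0,T]$. Consider a family of meshes that is quasi-uniform ($h\le\rho h_i$ for all $i$, with $\rho$ common to the family), and suppose that the RKSV scheme is stable: there are $\gamma\ge1$, $C_{\rm CFL}>0$, $C_s,\hat C_s\ge0$ such that on every mesh of the family, for every $0<\tau\le T$ with $\tau/h^\gamma\le C_{\rm CFL}$, all $u_h^n\in\mathbb V^k$ and all sources $g^{n,\ell}\in L^2(\Omega)$, one step of the RKSV scheme satisfies $$\|u_h^{n+1}\|_*^2\le(1+C_s\tau)\|u_h^n\|_*^2+\hat C_s\,\tau\sum_{0\le\ell<s}\|g^{n,\ell}\|^2 .$$ Then for every $C_0$ there are constants $C,h_{**}>0$, independent of the mesh in the family, of $\tau$ and of the numerical solution, such that on every mesh of the family with $h\le h_{**}$, for every $\tau=T/n_{**}$ with $n_{**}\in\mathbb N$ and $\tau/h^\gamma\le C_{\rm CFL}$, every solution $(u_h^n)$ of the OESV scheme with $\|u_h^0-U(\cdot,0)\|\le C_0h^{k+1}$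 (and with $u_h^0=U(\cdot,0)$ in case $U(\cdot,0)$ is constant) satisfies $$\max_{0\le n\le n_{**}}\|u_h^n-U(\cdot,n\tau)\|\le C\,(h^{k+1}+\tau^r).$$ -/

import Mathlib

open scoped Polynomial

noncomputable section

namespace OESV

/-- A partition of `[a, b]` into the cells `I_i = [node i, node (i + 1)]`, `i = 0, …, N - 1`. -/
structure Mesh (a b : ℝ) where
  N : ℕ
  node : Fin (N + 1) → ℝ
  strictMono : StrictMono node
  first : node 0 = a
  last : node (Fin.last N) = b

namespace Mesh

variable {a b : ℝ} (M : Mesh a b)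

/-- Left endpoint of the cell `I_i`. -/
def left (i : Fin M.N) : ℝ := M.node i.castSucc

/-- Right endpoint of the cell `I_i`. -/
def right (i : Fin M.N) : ℝ := M.node i.succ

/-- Cell size `h_i`. -/
def size (i : Fin M.N) : ℝ := M.right i - M.left i

/-- Mesh size `h = max_i h_i`. -/
def h : ℝ := ⨆ i, M.size i

/-- Right neighbour of a cell; the last cell is followed by the first one (periodicity). -/
def next (i : Fin M.N) : Fin M.N := finRotate M.N i

/-- Left neighbour of a cell; the first cell is preceded by the last one (periodicity). -/
def prev (i : Fin M.N) : Fin M.N := (finRotate M.N).symm i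

/-- Quasi-uniformity with constant `ρ`. -/
def QuasiUniform (ρ : ℝ) : Prop := ∀ i, M.h ≤ ρ * M.size i

/-- The discontinuous finite element space `V^k`: an element is the family of its restrictions to
the cells, each one a polynomial of degree at most `k` (in the global variable `x`). -/
abbrev V (k : ℕ) : Type := Fin M.N → Polynomial.degreeLE ℝ (k : WithBot ℕ)

variable {M} {k : ℕ}

/-- The value at `x` of the restriction of `v` to the cell `I_i` (at an endpoint of `I_i` this is
the one-sided trace from inside the cell). -/
def V.val (v : M.V k) (i : Fin M.N) (x : ℝ) : ℝ := (v i : ℝ[X]).eval x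

/-- The value at `x` of the `m`-th derivative of the restriction of `v` to the cell `I_i`. -/
def V.dval (m : ℕ) (v : M.V k) (i : Fin M.N) (x : ℝ) : ℝ :=
  (Polynomial.derivative^[m] (v i : ℝ[X])).eval x

/-- The `L²(Ω)`-distance between `v ∈ V^k` and a function `f` on `Ω = [a, b]`. -/
def V.l2dist (v : M.V k) (f : ℝ → ℝ) : ℝ :=
  √(∑ i, ∫ x in (M.left i)..(M.right i), (v.val i x - f x) ^ 2)

/-- The average of `v` over the whole domain. -/
def V.avg (v : M.V k) : ℝ := (∑ i, ∫ x in (M.left i)..(M.right i), v.val i x) / (b - a)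

/-- `‖v - avg v‖` in `L^∞(Ω)`. -/
def V.supDev (v : M.V k) : ℝ :=
  ⨆ i, ⨆ x : Set.Icc (M.left i) (M.right i), |v.val i x - v.avg|

/-- The jump of the `m`-th derivative of `v` across the right endpoint of the cell `I_i`. -/
def V.jump (m : ℕ) (v : M.V k) (i : Fin M.N) : ℝ :=
  v.dval m (M.next i) (M.left (M.next i)) - v.dval m i (M.right i)

end Mesh

/-- Reference subdivision points `0 = s_0 < s_1 < ⋯ < s_{k+1} = 1`. -/
structure Subdivision (k : ℕ) where
  point : Fin (k + 2) → ℝ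
  strictMono : StrictMono point
  first : point 0 = 0
  last : point (Fin.last (k + 1)) = 1

/-- The Legendre polynomial of degree `n` shifted to `[0, 1]`; the squared `L²(0, 1)`-norm is
`1 / (2 n + 1)`. Mathlib's sign makes the value at `0` equal to `1`. -/
def legendre (n : ℕ) : ℝ[X] := (Polynomial.shiftedLegendre n).map (Int.castRingHom ℝ)

/-- The quadrature rule on `[0, 1]` with nodes `s_j` and weights `w_j` is exact up to degree
`2 k - 1`, and `1 / (2 k - 1) - Q (L_{k+1} L_{k-1}) > 0`. -/
def Subdivision.Admissible {k : ℕ} (S : Subdivision k) (w : Fin (k + 2) → ℝ) : Prop :=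
  (∀ p : ℝ[X], p.natDegree ≤ 2 * k - 1 →
    ∑ j, w j * p.eval (S.point j) = ∫ x in (0 : ℝ)..1, p.eval x) ∧
  0 < 1 / (2 * (k : ℝ) - 1) -
    ∑ j, w j * (legendre (k + 1) * legendre (k - 1)).eval (S.point j)

/-- An explicit Runge–Kutta method with `s` stages in the form
`u_{l+1} = ∑_{κ ≤ l} (c_{lκ} u_κ + τ d_{lκ} L (u_κ))`, `l = 0, …, s - 1`. -/
structure RKMethod where
  s : ℕ
  c : ℕ → ℕ → ℝ
  d : ℕ → ℕ → ℝ
  sum_c : ∀ l < s, ∑ κ ∈ Finset.range (l + 1), c l κ = 1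

/-- Stage values of one step of the method for `y' = y` with step size `z` and `y(0) = 1`. -/
def RKMethod.stage (R : RKMethod) (z : ℝ) : ℕ → ℝ
  | 0 => 1
  | l + 1 => ∑ κ : Fin (l + 1), (R.c l κ + z * R.d l κ) * R.stage z κ
decreasing_by exact κ.2

/-- The method is of order `r` (for linear autonomous equations): its local error
is `O(z^(r+1))`. -/
def RKMethod.HasOrder (R : RKMethod) (r : ℕ) : Prop :=
  (fun z : ℝ => R.stage z R.s - Real.exp z) =O[nhds 0] fun z : ℝ => z ^ (r + 1)

section Scheme

variable {a b : ℝ} {k : ℕ} {M : Mesh a b}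

/-- The subdivision point `x_{i,j}`. -/
def cvPoint (M : Mesh a b) (S : Subdivision k) (i : Fin M.N) (j : Fin (k + 2)) : ℝ :=
  M.left i + S.point j * M.size i

/-- The integral of `f` over the control volume `I_{i,j} = [x_{i,j}, x_{i,j+1}]`. -/
def cvInt (M : Mesh a b) (S : Subdivision k) (i : Fin M.N) (j : Fin (k + 1)) (f : ℝ → ℝ) : ℝ :=
  ∫ x in (cvPoint M S i j.castSucc)..(cvPoint M S i j.succ), f x

/-- The upwind flux (`β > 0`) at `x_{i,j}`: `β` times the value of `v` from the left. -/
def flux (S : Subdivision k) (β : ℝ) (v : M.V k) (i : Fin M.N) (j : Fin (k + 2)) : ℝ :=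
  if j = 0 then β * v.val (M.prev i) (M.right (M.prev i)) else β * v.val i (cvPoint M S i j)

/-- The constant value of `M^* v` on the control volume `I_{i,j}`, that is
`v(x_{i-1/2}^+) + ∑_{l ≤ j} A_{i,l} v_x(x_{i,l})` with the weights `A_{i,l} = h_i w_l`. -/
def Mstar (S : Subdivision k) (w : Fin (k + 2) → ℝ) (v : M.V k) (i : Fin M.N)
    (j : Fin (k + 1)) : ℝ :=
  v.val i (M.left i) +
    ∑ l ∈ Finset.Iic j.castSucc, M.size i * w l * v.dval 1 i (cvPoint M S i l)

/-- `⟨v, ω⟩_* = ⟨v, M^* ω⟩`. -/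
def starInner (S : Subdivision k) (w : Fin (k + 2) → ℝ) (v ω : M.V k) : ℝ :=
  ∑ i, ∑ j, cvInt M S i j (v.val i) * Mstar S w ω i j

/-- The energy norm `‖v‖_*`. -/
def starNorm (S : Subdivision k) (w : Fin (k + 2) → ℝ) (v : M.V k) : ℝ := √(starInner S w v v)

/-- `z ∈ V^k` is the spectral volume Runge–Kutta stage number `l + 1` for `u_t + β u_x = g`
computed from the stages `u 0, …, u l`; `g κ` is the source at stage `κ`. -/
def IsRKStage (S : Subdivision k) (R : RKMethod) (β τ : ℝ) (g : ℕ → ℝ → ℝ) (u : ℕ → M.V k)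
    (l : ℕ) (z : M.V k) : Prop :=
  ∀ i j, cvInt M S i j (z.val i) =
    ∑ κ ∈ Finset.range (l + 1), (R.c l κ * cvInt M S i j ((u κ).val i) +
      τ * R.d l κ * (flux S β (u κ) i j.castSucc - flux S β (u κ) i j.succ + cvInt M S i j (g κ)))

/-- One time step `v ↦ z` of the RKSV scheme for `u_t + β u_x = g`. -/
def IsRKSVStep (S : Subdivision k) (R : RKMethod) (β τ : ℝ) (g : ℕ → ℝ → ℝ)
    (v z : M.V k) : Prop :=
  ∃ u : ℕ → M.V k, u 0 = v ∧ (∀ l < R.s, IsRKStage S R β τ g u l (u (l + 1))) ∧ u R.s = z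

/-- Stability of the RKSV scheme on the mesh `M` in the energy norm, for all time steps
`0 < τ ≤ T` with `τ / h^γ ≤ CCFL`, with constants `Cs` and `Cs'`. -/
def RKSVStable (M : Mesh a b) (S : Subdivision k) (w : Fin (k + 2) → ℝ) (R : RKMethod)
    (β T γ CCFL Cs Cs' : ℝ) : Prop :=
  ∀ τ : ℝ, 0 < τ → τ ≤ T → τ / M.h ^ γ ≤ CCFL →
    ∀ g : ℕ → ℝ → ℝ,
      (∀ l < R.s, MeasureTheory.MemLp (g l) 2 (MeasureTheory.volume.restrict (Set.Icc a b))) →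
    ∀ v z : M.V k, IsRKSVStep S R β τ g v z →
      starNorm S w z ^ 2 ≤ (1 + Cs * τ) * starNorm S w v ^ 2 +
        Cs' * τ * ∑ l ∈ Finset.range R.s, ∫ x in a..b, g l x ^ 2

/-- `σ_{e,K}^m(v)` for the cell `K = I_i`, as a function of the jump `J` of the `m`-th derivative
of `v` across the endpoint `e` of `K`; here `h_{e,K} = h_i`. -/
def sigma (m : ℕ) (v : M.V k) (i : Fin M.N) (J : ℝ) : ℝ :=
  open Classical in
  if ∀ i', ∀ x ∈ Set.Icc (M.left i') (M.right i'), v.val i' x = v.avg then 0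
  else (2 * (m : ℝ) + 1) * M.size i ^ m / (2 * (2 * (k : ℝ) - 1) * (m.factorial : ℝ)) *
    (|J| / v.supDev)

/-- The damping coefficient `δ_K^m(v)` for the cell `K = I_i`, the sum over its two endpoints. -/
def delta (β : ℝ) (m : ℕ) (v : M.V k) (i : Fin M.N) : ℝ :=
  |β| * sigma m v i (v.jump m (M.prev i)) / M.size i + |β| * sigma m v i (v.jump m i) / M.size i

/-- `q` is the `L²(I_i)`-projection of the polynomial `p` onto the polynomials of degree at
most `m`. -/
def IsL2Proj (M : Mesh a b) (i : Fin M.N) (m : ℕ) (p q : ℝ[X]) : Prop :=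
  q.degree ≤ m ∧ ∀ φ : ℝ[X], φ.degree ≤ m →
    ∫ x in (M.left i)..(M.right i), (p.eval x - q.eval x) * φ.eval x = 0

/-- `z = F_τ v` is the result of the oscillation-eliminating procedure: the value at pseudo-time
`τ` of the solution `y` of the damping equations that starts from `v`. Here `q m t` is the
projection `P^{m-1} (y t)`, where `P^{-1} = P^0`. -/
def IsOEFilter (β τ : ℝ) (v z : M.V k) : Prop :=
  ∃ (y : ℝ → M.V k) (q : ℕ → ℝ → Fin M.N → ℝ[X]),
    y 0 = v ∧ y τ = z ∧
    (∀ m ≤ k, ∀ t ∈ Set.Icc 0 τ, ∀ i, IsL2Proj M i (m - 1) (y t i : ℝ[X]) (q m t i)) ∧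
    ∀ t ∈ Set.Icc 0 τ, ∀ i, ∀ φ : ℝ[X], φ.degree ≤ k →
      HasDerivWithinAt (fun t' => ∫ x in (M.left i)..(M.right i), (y t').val i x * φ.eval x)
        (-∑ m ∈ Finset.range (k + 1), delta β m v i *
          ∫ x in (M.left i)..(M.right i), ((y t).val i x - (q m t i).eval x) * φ.eval x)
        (Set.Icc 0 τ) t

/-- One time step `v ↦ z` of the OESV scheme for `u_t + β u_x = 0`: each Runge–Kutta stage is
followed by the oscillation-eliminating procedure. -/
def IsOESVStep (S : Subdivision k) (R : RKMethod) (β τ : ℝ) (v z : M.V k) : Prop :=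
  ∃ u u' : ℕ → M.V k, u 0 = v ∧
    (∀ l < R.s, IsRKStage S R β τ (fun _ _ => 0) u l (u' (l + 1)) ∧
      IsOEFilter β τ (u' (l + 1)) (u (l + 1))) ∧
    u R.s = z

end Scheme

/-- `U` is a `(b - a)`-periodic classical solution of `u_t + β u_x = 0` for `0 < t ≤ T`, of class
`C^q` up to `t = 0` and `t = T`. -/
structure IsExactSolution (a b β T : ℝ) (q : ℕ) (U : ℝ → ℝ → ℝ) : Prop where
  smooth : ContDiffOn ℝ q (Function.uncurry U) (Set.univ ×ˢ Set.Icc 0 T)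
  periodic : ∀ x, ∀ t ∈ Set.Icc 0 T, U (x + (b - a)) t = U x t
  equation : ∀ x, ∀ t ∈ Set.Ioc 0 T, ∃ ux : ℝ, HasDerivAt (fun y => U y t) ux x ∧
    HasDerivWithinAt (fun t' => U x t') (-(β * ux)) (Set.Icc 0 T) t

end OESV

end

noncomputable section

namespace OESV

open Polynomial Finset Mesh

/-! ### Quadratic forms on polynomials of bounded degree -/

/-! Without the filter this is a linear Runge–Kutta scheme with a stable step, so consistency of
order `h^(k+1)` in space and `τ^r` in time would suffice. The filter is nonlinear; the point is that
near a smooth non-constant solution it is a perturbation of size `τ` times the error already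
present.

Space. A polynomial of degree `k` is determined by its control-volume integrals, so the scheme reads
`u' = svOp u`, where `svOp v` is `-β` times the derivative of the degree `k + 1` interpolant of the
upwind values (`isRKStage_iff`). Smooth functions are compared with their interpolants at `x_{i,1},
…, x_{i,k+1}`. These nodes include the right end of the cell, so every upwind value of the
interpolant is exact (`upVal_interp`) and no order is lost (`energy_consistency`).

Time. The exact solution is a translation, `U(x,t) = f(x - βt)`. The reference stages are `W_l =
P_l(-βτ ∂_x) f`, with `P_l` the stage polynomials of the method. They satisfy the Runge–Kutta
recursion exactly, and the last one agrees with the translate of `f` up to `O(τ^(r+1))`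
(`exists_reference`).

Filter. The damping equations are diagonal in the Legendre basis of a cell and preserve its mean, so
`F_τ v - v` is bounded on the cell by `τ δ` times the distance of `v` to any constant
(`filter_energy_le`). A smooth periodic function has no jumps, so `h δ` is controlled by `h^(k+1)`
plus the error, provided that the denominator of `δ` stays away from zero. It does, because `v` is
close to a function of positive variance (`supDev_ge`). If the squared error is at most `h^3`, then
`v` is within `O(h)` of a constant on each cell in mean square, which absorbs the factor `1/h` of
`δ` (`filter_normSq_le`, `star_filter_le`).

Conclusion. Stability of the unfiltered step, with zero source, together with boundedness of `τ
svOp` under the CFL condition, gives a one-step error inequality that is valid while the error is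
below a multiple of `h^(3/2)` (`RKMethod.perturbed_step`, `oesv_step_le`). As `k ≥ 1`, `r ≥ 2` and
`τ = O(h)`, the predicted error is `O(h^2)`, so for small `h` the Gronwall induction keeps this
condition (`discrete_gronwall`). For constant data the variance vanishes, but the scheme preserves
constants exactly.

The energy norm is equivalent to the `L²` norm because the admissibility condition makes its form
positive definite on the reference cell (`refStar_pos`); compactness and scaling make all such
constants independent of the mesh. -/

theorem exists_coeff_sq_le (n : ℕ) (B : ℝ[X] →ₗ[ℝ] ℝ[X] →ₗ[ℝ] ℝ)
    (hB : ∀ p : ℝ[X], p.natDegree ≤ n → p ≠ 0 → 0 < B p p) :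
    ∃ C : ℝ, 0 ≤ C ∧ ∀ p : ℝ[X], p.natDegree ≤ n →
      ∑ j ∈ range (n + 1), p.coeff j ^ 2 ≤ C * B p p := by
  let P : EuclideanSpace ℝ (Fin (n + 1)) → ℝ[X] := fun x => ∑ j, x j • (X : ℝ[X]) ^ (j : ℕ)
  have hPc : ∀ x (j : Fin (n + 1)), (P x).coeff j = x j := by
    intro x j
    simp only [P, finsetSum_coeff, coeff_smul, coeff_X_pow, smul_eq_mul, Fin.val_inj]
    simp
  have hPd : ∀ x, (P x).natDegree ≤ n := by
    intro x
    refine natDegree_sum_le_of_forall_le _ _ fun j _ => ?_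
    exact (natDegree_smul_le _ _).trans ((natDegree_X_pow_le _).trans (Nat.lt_succ_iff.1 j.2))
  have hPs : ∀ (c : ℝ) x, P (c • x) = c • P x := by
    intro c x
    simp only [P, PiLp.smul_apply, smul_eq_mul, smul_sum, smul_smul]
  have hcont : Continuous fun x => B (P x) (P x) := by
    have : (fun x => B (P x) (P x)) = fun x => ∑ i : Fin (n + 1), ∑ j : Fin (n + 1),
        x i * (x j * B (X ^ (i : ℕ)) (X ^ (j : ℕ))) := by
      funext x
      simp only [P, map_sum, LinearMap.sum_apply, map_smul, LinearMap.smul_apply, smul_eq_mul,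
        mul_sum]
      rw [sum_comm]
      exact sum_congr rfl fun i _ => sum_congr rfl fun j _ => by ring
    rw [this]
    fun_prop
  have hpos : ∀ x ∈ Metric.sphere (0 : EuclideanSpace ℝ (Fin (n + 1))) 1, 0 < B (P x) (P x) := by
    intro x hx
    refine hB _ (hPd x) fun h0 => ?_
    have : x = 0 := by
      ext j
      rw [← hPc, h0]; simp
    simp [this] at hx
  -- The minimum of the form over the unit sphere of coefficient vectors is positive by compactness;
  -- its inverse is the constant, and homogeneity extends the bound to all `p`.
  obtain ⟨x₀, hx₀, hmin⟩ := (isCompact_sphere (0 : EuclideanSpace ℝ (Fin (n + 1))) 1).exists_isMinOn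
    (NormedSpace.sphere_nonempty.2 zero_le_one) hcont.continuousOn
  set m := B (P x₀) (P x₀) with hm
  have hm0 : 0 < m := hpos x₀ hx₀
  refine ⟨m⁻¹, by positivity, fun p hp => ?_⟩
  let x : EuclideanSpace ℝ (Fin (n + 1)) := WithLp.toLp 2 fun j => p.coeff j
  have hPx : P x = p := by
    ext j
    by_cases hj : j < n + 1
    · exact hPc x ⟨j, hj⟩
    · rw [coeff_eq_zero_of_natDegree_lt ((hPd x).trans_lt (by lia)),
        coeff_eq_zero_of_natDegree_lt (hp.trans_lt (by lia))]
  have hsum : ∑ j ∈ range (n + 1), p.coeff j ^ 2 = ‖x‖ ^ 2 := by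
    rw [EuclideanSpace.norm_sq_eq, Finset.sum_range]
    simp [x]
  rw [hsum]
  by_cases hx0 : x = 0
  · have : p = 0 := by rw [← hPx, hx0]; simp [P]
    simp [hx0, this]
  have hn : 0 < ‖x‖ := norm_pos_iff.2 hx0
  have h1 : m ≤ B (P (‖x‖⁻¹ • x)) (P (‖x‖⁻¹ • x)) := by
    apply hmin
    simp [norm_smul, hn.ne']
  rw [hPs, hPx] at h1
  simp only [map_smul, LinearMap.smul_apply, smul_eq_mul] at h1
  rw [inv_mul_eq_div, le_div_iff₀ hm0]
  calc ‖x‖ ^ 2 * m ≤ ‖x‖ ^ 2 * (‖x‖⁻¹ * (‖x‖⁻¹ * B p p)) := by gcongr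
    _ = B p p := by field_simp

theorem functional_sq_le (n : ℕ) (f : ℝ[X] →ₗ[ℝ] ℝ) :
    ∃ C : ℝ, 0 ≤ C ∧ ∀ p : ℝ[X], p.natDegree ≤ n →
      f p ^ 2 ≤ C * ∑ j ∈ range (n + 1), p.coeff j ^ 2 := by
  refine ⟨∑ j ∈ range (n + 1), f (X ^ j) ^ 2, by positivity, fun p hp => ?_⟩
  have : f p = ∑ j ∈ range (n + 1), f (X ^ j) * p.coeff j := by
    conv_lhs => rw [p.as_sum_range' (n + 1) (by lia)]
    rw [map_sum]
    refine sum_congr rfl fun j _ => ?_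
    rw [← C_mul_X_pow_eq_monomial, ← smul_eq_C_mul, map_smul, smul_eq_mul, mul_comm]
  rw [this]
  exact sum_mul_sq_le_sq_mul_sq _ _ _

theorem bilin_le (n : ℕ) (B : ℝ[X] →ₗ[ℝ] ℝ[X] →ₗ[ℝ] ℝ) :
    ∃ C : ℝ, 0 ≤ C ∧ ∀ p : ℝ[X], p.natDegree ≤ n →
      B p p ≤ C * ∑ j ∈ range (n + 1), p.coeff j ^ 2 := by
  choose D hD0 hD using fun j : ℕ => functional_sq_le n (B.flip (X ^ j))
  refine ⟨1 + ∑ j ∈ range (n + 1), D j, by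
    have := sum_nonneg fun j (_ : j ∈ range (n + 1)) => hD0 j
    linarith, fun p hp => ?_⟩
  have : B p p = ∑ j ∈ range (n + 1), p.coeff j * B.flip (X ^ j) p := by
    conv_lhs => rw [p.as_sum_range' (n + 1) (by lia)]
    rw [map_sum]
    refine sum_congr rfl fun j _ => ?_
    rw [← C_mul_X_pow_eq_monomial, ← smul_eq_C_mul, map_smul, smul_eq_mul, LinearMap.flip_apply,
      ← p.as_sum_range' (n + 1) (by lia)]
  rw [this, add_mul, one_mul, sum_mul, ← sum_add_distrib]
  refine sum_le_sum fun j _ => ?_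
  have := hD j p hp
  nlinarith [sq_nonneg (p.coeff j - B.flip (X ^ j) p), sq_nonneg (p.coeff j),
    sq_nonneg (B.flip (X ^ j) p)]

/-- The bilinear form `(p, q) ↦ f p * f q` attached to a functional. -/
def sqForm (f : ℝ[X] →ₗ[ℝ] ℝ) : ℝ[X] →ₗ[ℝ] ℝ[X] →ₗ[ℝ] ℝ := (LinearMap.mul ℝ ℝ).compl₁₂ f f

@[simp] theorem sqForm_apply (f : ℝ[X] →ₗ[ℝ] ℝ) (p q : ℝ[X]) : sqForm f p q = f p * f q := rfl

/-! ### Integration of polynomials -/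

theorem polyIntegrable (p : ℝ[X]) (x y : ℝ) :
    IntervalIntegrable (fun t => p.eval t) MeasureTheory.volume x y :=
  p.continuous.intervalIntegrable x y

/-- The integral of a polynomial from `x` to `y`. -/
def polyInt (x y : ℝ) : ℝ[X] →ₗ[ℝ] ℝ where
  toFun p := ∫ t in x..y, p.eval t
  map_add' p q := by
    simp only [eval_add]
    exact intervalIntegral.integral_add (polyIntegrable p x y) (polyIntegrable q x y)
  map_smul' c p := by simp

theorem polyInt_apply (x y : ℝ) (p : ℝ[X]) : polyInt x y p = ∫ t in x..y, p.eval t := rfl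

theorem polyInt_derivative (x y : ℝ) (p : ℝ[X]) :
    polyInt x y (derivative p) = p.eval y - p.eval x :=
  intervalIntegral.integral_eq_sub_of_hasDerivAt (fun t _ => p.hasDerivAt t)
    (polyIntegrable _ x y)

theorem exists_primitive (p : ℝ[X]) (n : ℕ) (hp : p.natDegree ≤ n) :
    ∃ P : ℝ[X], derivative P = p ∧ P.natDegree ≤ n + 1 ∧ P.eval 0 = 0 ∧
      P.coeff (n + 1) = p.coeff n / (n + 1) := by
  refine ⟨∑ j ∈ range (n + 1), monomial (j + 1) (p.coeff j / (j + 1)), ?_, ?_, ?_, ?_⟩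
  · conv_rhs => rw [p.as_sum_range' (n + 1) (by lia)]
    rw [derivative_sum]
    refine sum_congr rfl fun j _ => ?_
    rw [derivative_monomial]
    congr 1
    push_cast
    field_simp
  · refine natDegree_sum_le_of_forall_le _ _ fun j hj => ?_
    exact (natDegree_monomial_le _).trans (by simp at hj; lia)
  · simp [eval_finsetSum]
  · simp [finsetSum_coeff, coeff_monomial]

theorem polyInt_by_parts (p q : ℝ[X]) :
    polyInt 0 1 (derivative p * q) =
      p.eval 1 * q.eval 1 - p.eval 0 * q.eval 0 - polyInt 0 1 (p * derivative q) := by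
  have := polyInt_derivative 0 1 (p * q)
  rw [derivative_mul, map_add, eval_mul, eval_mul] at this
  linarith

theorem polyInt_sq_pos {x y : ℝ} (hxy : x < y) {p : ℝ[X]} (hp : p ≠ 0) :
    0 < polyInt x y (p * p) := by
  rw [polyInt_apply]
  obtain ⟨c, hc, hc0⟩ : ∃ c ∈ Set.Icc x y, p.eval c ≠ 0 := by
    by_contra! h
    refine hp (p.eq_zero_of_infinite_isRoot ((Set.Icc_infinite hxy).mono fun c hc => ?_))
    exact h c hc
  refine intervalIntegral.integral_pos hxy (p * p).continuous.continuousOn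
    (fun t _ => by rw [eval_mul]; exact mul_self_nonneg _) ⟨c, hc, ?_⟩
  rw [eval_mul]
  exact mul_self_pos.2 hc0

/-- The `L²(0, 1)` inner product of polynomials. -/
def l2Form : ℝ[X] →ₗ[ℝ] ℝ[X] →ₗ[ℝ] ℝ := (LinearMap.mul ℝ ℝ[X]).compr₂ (polyInt 0 1)

theorem l2Form_apply (p q : ℝ[X]) : l2Form p q = polyInt 0 1 (p * q) := rfl

/-! ### Legendre polynomials -/

theorem coeff_legendre (n j : ℕ) :
    (legendre n).coeff j = (-1) ^ j * n.choose j * (n + j).choose n := by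
  simp [legendre, coeff_shiftedLegendre]

theorem natDegree_legendre (n : ℕ) : (legendre n).natDegree = n := by
  rw [legendre, natDegree_map_eq_of_injective (RingHom.injective_int _), natDegree_shiftedLegendre]

theorem coeff_legendre_ne_zero (n : ℕ) : (legendre n).coeff n ≠ 0 := by
  rw [coeff_legendre]
  have h1 := Nat.choose_pos (le_refl n)
  have h2 := Nat.choose_pos (Nat.le_add_right n n)
  positivity

theorem legendre_eval_zero (n : ℕ) : (legendre n).eval 0 = 1 := by
  rw [← coeff_zero_eq_eval_zero, coeff_legendre]; simp

theorem legendre_eval_one (n : ℕ) : (legendre n).eval 1 = (-1) ^ n := by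
  have h := shiftedLegendre_eval_symm n (1 : ℝ)
  have h2 : ∀ x : ℝ, aeval x (shiftedLegendre n) = (legendre n).eval x := by
    intro x; rw [legendre, eval_map, aeval_def]; rfl
  rw [h2, h2, sub_self, legendre_eval_zero, mul_one] at h
  exact h

theorem rodrigues (n : ℕ) :
    (n.factorial : ℝ) • legendre n = derivative^[n] ((X : ℝ[X]) ^ n * (1 - X) ^ n) := by
  have h := congrArg (Polynomial.map (Int.castRingHom ℝ)) (factorial_mul_shiftedLegendre_eq n)
  rw [← iterate_derivative_map] at h
  simpa [legendre, smul_eq_C_mul] using h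

/-- Derivatives of `X^n (1 - X)^n` of order below `n` vanish at both endpoints, so no boundary terms
appear. -/
theorem rodrigues_by_parts (n m : ℕ) (hm : m ≤ n) (φ : ℝ[X]) :
    polyInt 0 1 (derivative^[m] ((X : ℝ[X]) ^ n * (1 - X) ^ n) * φ) =
      (-1) ^ m * polyInt 0 1 ((X : ℝ[X]) ^ n * (1 - X) ^ n * derivative^[m] φ) := by
  induction m generalizing φ with
  | zero => simp
  | succ m ih =>
    rw [Function.iterate_succ_apply', polyInt_by_parts]
    have h0 : (derivative^[m] ((X : ℝ[X]) ^ n * (1 - X) ^ n)).eval 0 = 0 := by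
      have : (X : ℝ[X]) ^ (n - m) ∣ derivative^[m] ((X : ℝ[X]) ^ n * (1 - X) ^ n) :=
        pow_sub_dvd_iterate_derivative_of_pow_dvd _ (dvd_mul_right _ _)
      obtain ⟨r, hr⟩ := this
      rw [hr]; simp; left; lia
    have h1 : (derivative^[m] ((X : ℝ[X]) ^ n * (1 - X) ^ n)).eval 1 = 0 := by
      have : (1 - X : ℝ[X]) ^ (n - m) ∣ derivative^[m] ((X : ℝ[X]) ^ n * (1 - X) ^ n) :=
        pow_sub_dvd_iterate_derivative_of_pow_dvd _ (dvd_mul_left _ _)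
      obtain ⟨r, hr⟩ := this
      rw [hr]; simp; left; lia
    rw [h0, h1, ih (by lia), Function.iterate_succ_apply]
    ring

theorem legendre_orthogonal {n : ℕ} {φ : ℝ[X]} (hφ : φ.natDegree < n) :
    polyInt 0 1 (legendre n * φ) = 0 := by
  have h := rodrigues_by_parts n n le_rfl φ
  rw [← rodrigues, iterate_derivative_eq_zero hφ, smul_mul_assoc, map_smul] at h
  have : (n.factorial : ℝ) ≠ 0 := by positivity
  simpa [this] using h

/-- Subtracting the multiple of `legendre n` that removes the coefficient of degree `n` leaves a
polynomial orthogonal to `legendre n`. -/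
theorem legendre_mul_eq {n : ℕ} {p : ℝ[X]} (hp : p.natDegree ≤ n) :
    polyInt 0 1 (legendre n * p) =
      p.coeff n / (legendre n).coeff n * polyInt 0 1 (legendre n * legendre n) := by
  set c := p.coeff n / (legendre n).coeff n
  have h : polyInt 0 1 (legendre n * (p - c • legendre n)) = 0 := by
    by_cases h0 : p - c • legendre n = 0
    · simp [h0]
    rcases Nat.eq_zero_or_pos n with hn | hn
    · exfalso
      apply h0
      have hd : (p - c • legendre n).natDegree ≤ n := 
        (natDegree_sub_le_of_le hp ((natDegree_smul_le _ _).trans (natDegree_legendre n).le)).trans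
          (max_self n).le
      have hc : (p - c • legendre n).coeff n = 0 := by
        simp [c, coeff_legendre_ne_zero]
      subst hn
      rw [eq_C_of_natDegree_le_zero hd, hc, C_0]
    · apply legendre_orthogonal
      have hd : (p - c • legendre n).natDegree ≤ n := 
        (natDegree_sub_le_of_le hp ((natDegree_smul_le _ _).trans (natDegree_legendre n).le)).trans
          (max_self n).le
      have hc : (p - c • legendre n).coeff n = 0 := by
        simp [c, coeff_legendre_ne_zero]
      refine lt_of_le_of_ne hd fun h => ?_
      refine h0 (leadingCoeff_eq_zero.1 ?_)
      rw [leadingCoeff, h]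
      exact hc
  rw [mul_sub, mul_smul_comm, map_sub, map_smul, sub_eq_zero, smul_eq_mul] at h
  exact h

/-- Integrate `1 · L²` by parts with primitive `X - 1/2`. The boundary terms give `1` since `L = ±1`
at the ends, and `(2X - 1) L'` has leading coefficient `2n` times that of `L`. Hence the norm `N`
satisfies `N = 1 - 2 n N`. -/
theorem legendre_norm_sq (n : ℕ) : polyInt 0 1 (legendre n * legendre n) = 1 / (2 * n + 1) := by
  set L := legendre n with hL
  have h := polyInt_by_parts (X - C (1 / 2)) (L * L)
  have hd : derivative (X - C (1 / 2 : ℝ)) = 1 := by simp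
  rw [hd, one_mul, derivative_mul] at h
  have hsq : (((-1 : ℝ)) ^ n * (-1) ^ n) = 1 := by rw [← mul_pow]; simp
  have h2 : (X - C (1 / 2)) * (derivative L * L + L * derivative L) =
      L * ((2 : ℝ) • (X * derivative L) - derivative L) := by
    rw [smul_eq_C_mul]
    have : (C (1 / 2 : ℝ) : ℝ[X]) * C 2 = 1 := by rw [← C_mul]; norm_num
    have h3 : (C 2 : ℝ[X]) = 2 := rfl
    rw [h3] at this ⊢
    linear_combination (-(L * derivative L)) * this
  have hdeg : ((2 : ℝ) • (X * derivative L) - derivative L).natDegree ≤ n := by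
    have h4 : (derivative L).natDegree ≤ n - 1 :=
      (natDegree_derivative_le _).trans (by rw [natDegree_legendre])
    rcases Nat.eq_zero_or_pos n with hn | hn
    · have : derivative L = 0 := by
        apply derivative_of_natDegree_zero
        rw [natDegree_legendre, hn]
      simp [this]
    · refine (natDegree_sub_le_of_le ?_ (h4.trans (Nat.sub_le n 1))).trans (max_self n).le
      refine (natDegree_smul_le _ _).trans (natDegree_mul_le.trans ?_)
      rw [natDegree_X]; lia
  have hcoef : ((2 : ℝ) • (X * derivative L) - derivative L).coeff n = 2 * n * L.coeff n := by
    rw [coeff_sub, coeff_smul, coeff_derivative,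
      coeff_eq_zero_of_natDegree_lt (show L.natDegree < n + 1 by rw [natDegree_legendre]; lia)]
    cases n with
    | zero => simp
    | succ n => rw [coeff_X_mul, coeff_derivative]; simp; ring
  rw [h2, legendre_mul_eq hdeg, hcoef, eval_mul, eval_mul, legendre_eval_zero,
    legendre_eval_one, hsq, ← hL] at h
  have h5 := coeff_legendre_ne_zero n
  rw [← hL] at h5
  simp only [eval_sub, eval_X, eval_C] at h
  field_simp at h ⊢
  linarith

/-- The leading coefficients are central binomials up to sign. This relation converts the
admissibility condition, stated for `L_{k+1} L_{k-1}`, into one about `L_k²`. -/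
theorem coeff_legendre_ratio {k : ℕ} (hk : 1 ≤ k) :
    (legendre (k + 1)).coeff (k + 1) * (legendre (k - 1)).coeff (k - 1) *
      (((k : ℝ) + 1) * (2 * k - 1)) = (legendre k).coeff k ^ 2 * ((2 * k + 1) * k) := by
  obtain ⟨m, rfl⟩ : ∃ m, k = m + 1 := ⟨k - 1, by lia⟩
  simp only [coeff_legendre, Nat.add_sub_cancel, Nat.choose_self]
  have e : ∀ n : ℕ, (((n + n).choose n : ℕ) : ℝ) = (Nat.centralBinom n : ℝ) := by
    intro n; rw [Nat.centralBinom_eq_two_mul_choose, two_mul]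
  rw [e, e, e]
  have h1 := Nat.succ_mul_centralBinom_succ m
  have h2 := Nat.succ_mul_centralBinom_succ (m + 1)
  have h1' : ((m : ℝ) + 1) * (m + 1).centralBinom = 2 * (2 * m + 1) * m.centralBinom := by
    exact_mod_cast h1
  have h2' : ((m : ℝ) + 1 + 1) * (m + 1 + 1).centralBinom =
      2 * (2 * (m + 1) + 1) * (m + 1).centralBinom := by
    exact_mod_cast h2
  have hs : ((-1 : ℝ) ^ (m + 1)) ^ 2 = 1 := by rw [← pow_mul, mul_comm, pow_mul]; simp
  have hs2 : ((-1 : ℝ) ^ (m + 1 + 1)) * (-1) ^ m = 1 := by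
    rw [pow_succ, pow_succ]
    have : ((-1 : ℝ) ^ m) * (-1) ^ m = 1 := by rw [← mul_pow]; simp
    linear_combination this
  push_cast
  simp only [mul_one]
  generalize ((m + 1 + 1).centralBinom : ℝ) = a at *
  generalize ((m + 1).centralBinom : ℝ) = b at *
  generalize (m.centralBinom : ℝ) = c at *
  have h3 : ((m : ℝ) + 1) * ((m + 1 + 1) * a * c * (2 * (m + 1) - 1)) =
      ((m : ℝ) + 1) * (b ^ 2 * ((2 * (m + 1) + 1) * (m + 1))) := by
    linear_combination (m + 1) * c * (2 * m + 1) * h2' - (2 * (m + 1) + 1) * (m + 1) * b * h1'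
  have h4 := mul_left_cancel₀ (by positivity : (m : ℝ) + 1 ≠ 0) h3
  calc _ = ((-1 : ℝ) ^ (m + 1 + 1)) * (-1) ^ m * ((m + 1 + 1) * a * c * (2 * (m + 1) - 1)) := by
        ring
    _ = _ := by rw [hs2, h4, mul_pow, hs]; ring

theorem eq_zero_of_legendre_moments {k : ℕ} {p : ℝ[X]} (hp : p.natDegree ≤ k)
    (h : ∀ n ≤ k, polyInt 0 1 (legendre n * p) = 0) : p = 0 := by
  by_contra h0
  have h1 := h p.natDegree hp
  rw [legendre_mul_eq le_rfl, legendre_norm_sq] at h1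
  have h2 : p.coeff p.natDegree ≠ 0 := by simpa using h0
  have h3 := coeff_legendre_ne_zero p.natDegree
  have h4 : (2 * (p.natDegree : ℝ) + 1) ≠ 0 := by positivity
  simp_all

/-! ### The energy form on the reference cell -/

variable {k : ℕ}

/-- The form `⟨p, M^* q⟩` on the reference cell. -/
def refStar (S : Subdivision k) (w : Fin (k + 2) → ℝ) (p q : ℝ[X]) : ℝ :=
  ∑ j : Fin (k + 1), polyInt (S.point j.castSucc) (S.point j.succ) p *
    (q.eval 0 + ∑ l ∈ Finset.Iic j.castSucc, w l * (derivative q).eval (S.point l))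

/-- Abel summation. With `V` a primitive of `p` at the subdivision points, it turns the sum over
control volumes into the quadrature rule applied to `V p'`. -/
theorem sum_by_parts (k : ℕ) (V : Fin (k + 2) → ℝ) (c : ℝ) (g : Fin (k + 2) → ℝ) :
    ∑ j : Fin (k + 1), (V j.succ - V j.castSucc) * (c + ∑ l ∈ Finset.Iic j.castSucc, g l) =
      V (Fin.last (k + 1)) * (c + ∑ l, g l) - V 0 * c - ∑ l, V l * g l := by
  let V' : ℕ → ℝ := fun n => if h : n < k + 2 then V ⟨n, h⟩ else 0
  let g' : ℕ → ℝ := fun n => if h : n < k + 2 then g ⟨n, h⟩ else 0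
  have hI : ∀ j : Fin (k + 1), ∑ l ∈ Finset.Iic j.castSucc, g l = ∑ l ∈ range (j + 1), g' l := by
    intro j
    symm
    refine Finset.sum_bij' (fun a _ => if h : a < k + 2 then ⟨a, h⟩ else 0) (fun a _ => a.val)
      ?_ ?_ ?_ ?_ ?_
    · intro a ha
      have h1 := Finset.mem_range.1 ha
      have : a < k + 2 := by have := j.2; lia
      simp only [this, dif_pos, Finset.mem_Iic, Fin.le_def, Fin.val_castSucc]; lia
    · intro a ha
      simp only [Finset.mem_Iic, Fin.le_def, Fin.val_castSucc] at ha
      simp; lia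
    · intro a ha
      have h1 := Finset.mem_range.1 ha
      have : a < k + 2 := by have := j.2; lia
      simp [this]
    · intro a ha; simp
    · intro a ha
      have h1 := Finset.mem_range.1 ha
      have : a < k + 2 := by have := j.2; lia
      simp [g', this]
  have key : ∀ n : ℕ, ∑ j ∈ range n, (V' (j + 1) - V' j) * (c + ∑ l ∈ range (j + 1), g' l) =
      V' n * (c + ∑ l ∈ range (n + 1), g' l) - V' 0 * c - ∑ l ∈ range (n + 1), V' l * g' l := by
    intro n
    induction n with
    | zero => simp; ring
    | succ n ih =>
      rw [sum_range_succ, ih, sum_range_succ _ (n + 1), sum_range_succ _ (n + 1)]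
      ring
  have h := key (k + 1)
  rw [Finset.sum_range] at h
  have e1 : ∑ l, g l = ∑ l ∈ range (k + 1 + 1), g' l := by
    rw [Finset.sum_range]; refine sum_congr rfl fun l _ => ?_; simp [g']
  have e2 : ∑ l, V l * g l = ∑ l ∈ range (k + 1 + 1), V' l * g' l := by
    rw [Finset.sum_range]; refine sum_congr rfl fun l _ => ?_; simp [g', V']
  rw [e1, e2]
  have e3 : V (Fin.last (k + 1)) = V' (k + 1) := by simp [V']; rfl
  have e4 : V 0 = V' 0 := by simp [V']
  rw [e3, e4, ← h]
  refine sum_congr rfl fun j _ => ?_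
  have hj := j.2
  rw [hI]
  congr 2
  · have : (j : ℕ) + 1 < k + 2 := by lia
    simp only [V', this, dif_pos]; rfl
  · have : (j : ℕ) < k + 2 := by lia
    simp only [V', this, dif_pos]; rfl

/-- Let `P` be the primitive of `p` with `P(0) = 0` and `E` the quadrature error. Summation by parts
gives `⟨p, M^* p⟩ = ∫ p² + E(P p')`. Since `P p'` has degree at most `2k`, `E` sees only its leading
coefficient, a multiple of `p_k²`. Bessel's inequality bounds `∫ p²` below by the `L_k` component of
`p`, and the resulting multiple of `p_k²` is positive exactly by admissibility. -/
theorem refStar_pos (hk : 1 ≤ k) {S : Subdivision k} {w : Fin (k + 2) → ℝ}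
    (hS : S.Admissible w) {p : ℝ[X]} (hp : p.natDegree ≤ k) (hp0 : p ≠ 0) :
    0 < refStar S w p p := by
  obtain ⟨hQ, hL⟩ := hS
  let Q : ℝ[X] →ₗ[ℝ] ℝ := ∑ j, w j • Polynomial.leval (S.point j)
  have hQa : ∀ q : ℝ[X], Q q = ∑ j, w j * q.eval (S.point j) := by
    intro q; simp [Q, LinearMap.sum_apply, Polynomial.leval]
  let E : ℝ[X] →ₗ[ℝ] ℝ := polyInt 0 1 - Q
  have hE0 : ∀ q : ℝ[X], q.natDegree ≤ 2 * k - 1 → E q = 0 := by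
    intro q hq
    simp only [E, LinearMap.sub_apply, hQa, polyInt_apply, hQ q hq, sub_self]
  have hE : ∀ q : ℝ[X], q.natDegree ≤ 2 * k → E q = q.coeff (2 * k) * E (X ^ (2 * k)) := by
    intro q hq
    have : E (q - q.coeff (2 * k) • X ^ (2 * k)) = 0 := by
      apply hE0
      refine (natDegree_le_iff_coeff_eq_zero).2 fun N hN => ?_
      simp only [coeff_sub, coeff_smul, coeff_X_pow, smul_eq_mul]
      by_cases hN2 : N = 2 * k
      · simp [hN2]
      · rw [coeff_eq_zero_of_natDegree_lt (show q.natDegree < N by lia)]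
        simp [hN2]
    rw [map_sub, map_smul, smul_eq_mul] at this
    linarith
  obtain ⟨P, hP, hPd, hP0, hPc⟩ := exists_primitive p k hp
  have hint : ∀ x y, polyInt x y p = P.eval y - P.eval x := by
    intro x y; rw [← hP, polyInt_derivative]
  have hstar : refStar S w p p = polyInt 0 1 (p * p) + E (P * derivative p) := by
    unfold refStar
    simp only [hint]
    rw [sum_by_parts k (fun l => P.eval (S.point l)) (p.eval 0)
      (fun l => w l * (derivative p).eval (S.point l))]
    rw [S.first, S.last, hP0]
    -- Exactness for `p'` makes the total weight at the right end equal to `p(1)`.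
    have h1 := hQ (derivative p) ((natDegree_derivative_le _).trans (by lia))
    rw [h1, ← polyInt_apply, polyInt_derivative]
    have h2 := polyInt_by_parts P p
    rw [hP] at h2
    simp only [E, LinearMap.sub_apply, hQa, eval_mul]
    rw [h2, hP0]
    have h3 : ∀ l, P.eval (S.point l) * (w l * (derivative p).eval (S.point l)) =
      w l * (P.eval (S.point l) * (derivative p).eval (S.point l)) := fun l => by ring
    simp only [h3]
    ring
  have hdp : (derivative p).natDegree ≤ k - 1 := (natDegree_derivative_le _).trans (by lia)
  have hEp : E (P * derivative p) = p.coeff k ^ 2 * (k / (k + 1)) * E (X ^ (2 * k)) := by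
    rw [hE _ (natDegree_mul_le.trans (by lia))]
    congr 1
    have : 2 * k = (k + 1) + (k - 1) := by lia
    rw [this, coeff_mul_add_eq_of_natDegree_le hPd hdp, hPc, coeff_derivative]
    have e : k - 1 + 1 = k := by lia
    rw [e, ← Nat.cast_add_one, ← Nat.cast_add_one, e]
    field_simp
  -- Admissibility in terms of `E(X^(2k))`: as `L_{k+1}` is orthogonal to `L_{k-1}`, the error of
  -- their product is minus its quadrature sum.
  have hEL : (1 : ℝ) / (2 * k - 1) + (legendre (k + 1)).coeff (k + 1) *
      (legendre (k - 1)).coeff (k - 1) * E (X ^ (2 * k)) > 0 := by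
    have h1 := hE (legendre (k + 1) * legendre (k - 1))
      (natDegree_mul_le.trans (by rw [natDegree_legendre, natDegree_legendre]; lia))
    have : 2 * k = (k + 1) + (k - 1) := by lia
    nth_rw 1 [this] at h1
    rw [coeff_mul_add_eq_of_natDegree_le (natDegree_legendre _).le (natDegree_legendre _).le] at h1
    rw [← h1]
    have h2 : E (legendre (k + 1) * legendre (k - 1)) =
        - ∑ j, w j * (legendre (k + 1) * legendre (k - 1)).eval (S.point j) := by
      simp only [E, LinearMap.sub_apply, hQa]
      rw [legendre_orthogonal (by rw [natDegree_legendre]; lia)]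
      ring
    rw [h2]
    linarith
  have hpos := polyInt_sq_pos zero_lt_one hp0
  rw [hstar, hEp]
  by_cases hc : p.coeff k = 0
  · simp [hc]; exact hpos
  -- Bessel's inequality
  set ℓ := (legendre k).coeff k
  have hl : ℓ ≠ 0 := coeff_legendre_ne_zero k
  set c := p.coeff k / ℓ
  have hB : c ^ 2 * (1 / (2 * k + 1)) ≤ polyInt 0 1 (p * p) := by
    have h0 : 0 ≤ polyInt 0 1 ((p - c • legendre k) * (p - c • legendre k)) := by
      rw [polyInt_apply]
      refine intervalIntegral.integral_nonneg zero_le_one fun t _ => ?_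
      rw [eval_mul]; exact mul_self_nonneg _
    have h1 : (p - c • legendre k) * (p - c • legendre k) = p * p - (2 * c) • (legendre k * p) +
        (c ^ 2) • (legendre k * legendre k) := by
      simp only [smul_eq_C_mul, C_mul, C_pow]
      have : (C 2 : ℝ[X]) = 2 := rfl
      rw [this]; ring
    rw [h1, map_add, map_sub, map_smul, map_smul, legendre_mul_eq hp, legendre_norm_sq] at h0
    simp only [smul_eq_mul] at h0
    have : p.coeff k / (legendre k).coeff k = c := rfl
    rw [this] at h0
    linarith
  refine lt_of_lt_of_le ?_ (add_le_add_left hB _)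
  have hr := coeff_legendre_ratio hk
  have hk' : (1 : ℝ) ≤ k := by exact_mod_cast hk
  set e := E (X ^ (2 * k))
  set A := (legendre (k + 1)).coeff (k + 1) * (legendre (k - 1)).coeff (k - 1)
  have hkk : 0 < 2 * (k : ℝ) - 1 := by linarith
  have hA : A = ℓ ^ 2 * ((2 * k + 1) * k) / (((k : ℝ) + 1) * (2 * k - 1)) := by
    field_simp; linarith
  have h6 : c ^ 2 * (1 / (2 * k + 1)) + p.coeff k ^ 2 * (k / (k + 1)) * e =
      c ^ 2 * (2 * k - 1) / (2 * k + 1) * (1 / (2 * k - 1) + A * e) := by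
    have : p.coeff k = c * ℓ := by simp only [c]; field_simp
    rw [hA, this]
    field_simp
  rw [h6]
  have hcpos : 0 < c ^ 2 := by
    have : c ≠ 0 := div_ne_zero hc hl
    positivity
  positivity

/-! ### Comparison of quadratic forms -/

theorem form_le_form (n : ℕ) (B₁ B₂ : ℝ[X] →ₗ[ℝ] ℝ[X] →ₗ[ℝ] ℝ)
    (h : ∀ p : ℝ[X], p.natDegree ≤ n → p ≠ 0 → 0 < B₁ p p) :
    ∃ C : ℝ, 0 ≤ C ∧ ∀ p : ℝ[X], p.natDegree ≤ n → B₂ p p ≤ C * B₁ p p := by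
  obtain ⟨C₁, h₁, H₁⟩ := exists_coeff_sq_le n B₁ h
  obtain ⟨C₂, h₂, H₂⟩ := bilin_le n B₂
  refine ⟨C₂ * C₁, by positivity, fun p hp => (H₂ p hp).trans ?_⟩
  rw [mul_assoc]
  exact mul_le_mul_of_nonneg_left (H₁ p hp) h₂

theorem l2Form_pos {p : ℝ[X]} (hp : p ≠ 0) : 0 < l2Form p p := polyInt_sq_pos zero_lt_one hp

theorem l2Form_nonneg (p : ℝ[X]) : 0 ≤ l2Form p p := by
  by_cases hp : p = 0
  · simp [hp]
  · exact (l2Form_pos hp).le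

theorem functional_sq_le_l2 (n : ℕ) (f : ℝ[X] →ₗ[ℝ] ℝ) :
    ∃ C : ℝ, 0 ≤ C ∧ ∀ p : ℝ[X], p.natDegree ≤ n → f p ^ 2 ≤ C * l2Form p p := by
  obtain ⟨C, hC, H⟩ := form_le_form n l2Form (sqForm f) fun p _ hp => l2Form_pos hp
  exact ⟨C, hC, fun p hp => by simpa [pow_two] using H p hp⟩

theorem form_le_sum_sq (n m : ℕ) (B : ℝ[X] →ₗ[ℝ] ℝ[X] →ₗ[ℝ] ℝ) (f : Fin m → ℝ[X] →ₗ[ℝ] ℝ)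
    (hf : ∀ p : ℝ[X], p.natDegree ≤ n → (∀ j, f j p = 0) → p = 0) :
    ∃ C : ℝ, 0 ≤ C ∧ ∀ p : ℝ[X], p.natDegree ≤ n → B p p ≤ C * ∑ j, f j p ^ 2 := by
  obtain ⟨C, hC, H⟩ := form_le_form n (∑ j, sqForm (f j)) B fun p hp hp0 => by
    simp only [LinearMap.sum_apply, sqForm_apply]
    refine lt_of_le_of_ne (sum_nonneg fun j _ => mul_self_nonneg _) fun h0 => hp0 (hf p hp ?_)
    intro j
    have := (sum_eq_zero_iff_of_nonneg fun j _ => mul_self_nonneg (f j p)).1 h0.symm j (mem_univ _)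
    exact mul_self_eq_zero.1 this
  refine ⟨C, hC, fun p hp => (H p hp).trans (le_of_eq ?_)⟩
  simp [LinearMap.sum_apply, pow_two]

theorem form_le_nodal (n : ℕ) (B : ℝ[X] →ₗ[ℝ] ℝ[X] →ₗ[ℝ] ℝ) (t : Fin (n + 1) → ℝ)
    (ht : Function.Injective t) :
    ∃ C : ℝ, 0 ≤ C ∧ ∀ p : ℝ[X], p.natDegree ≤ n → B p p ≤ C * ∑ j, p.eval (t j) ^ 2 := by
  refine form_le_sum_sq n (n + 1) B (fun j => leval (t j)) fun p hp h => ?_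
  refine eq_zero_of_degree_lt_of_eval_index_eq_zero (s := univ) (v := t) ht.injOn ?_ fun j _ => h j
  rw [card_univ, Fintype.card_fin]
  exact (natDegree_le_iff_degree_le.1 hp).trans_lt (by exact_mod_cast Nat.lt_succ_self n)

theorem l2_le_moments (k : ℕ) :
    ∃ C : ℝ, 0 ≤ C ∧ ∀ p : ℝ[X], p.natDegree ≤ k →
      l2Form p p ≤ C * ∑ n : Fin (k + 1), polyInt 0 1 (legendre n * p) ^ 2 :=
  form_le_sum_sq k (k + 1) l2Form (fun n => (polyInt 0 1).comp (LinearMap.mulLeft ℝ (legendre n)))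
    fun _ hp h => eq_zero_of_legendre_moments hp fun n hn => h ⟨n, Nat.lt_succ_iff.2 hn⟩

/-! ### The energy form and its seminorm -/

variable {a b : ℝ} {k : ℕ}

/-- `refStar` as a bilinear form. -/
def refStarForm (S : Subdivision k) (w : Fin (k + 2) → ℝ) : ℝ[X] →ₗ[ℝ] ℝ[X] →ₗ[ℝ] ℝ :=
  ∑ j : Fin (k + 1), (LinearMap.mul ℝ ℝ).compl₁₂ (polyInt (S.point j.castSucc) (S.point j.succ))
    (leval 0 + ∑ l ∈ Finset.Iic j.castSucc, w l • (leval (S.point l)).comp derivative)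

theorem refStarForm_apply (S : Subdivision k) (w : Fin (k + 2) → ℝ) (p q : ℝ[X]) :
    refStarForm S w p q = refStar S w p q := by
  simp [refStarForm, refStar, LinearMap.sum_apply, leval]

/-- The seminorm `√(B v v)` of a positive semidefinite bilinear form. -/
def formSeminorm {E : Type*} [AddCommGroup E] [Module ℝ E] (B : E →ₗ[ℝ] E →ₗ[ℝ] ℝ)
    (hB : ∀ v, 0 ≤ B v v) : Seminorm ℝ E :=
  Seminorm.of (fun v => √(B v v))
    (fun u v => by
      -- `B` need not be symmetric, but the triangle inequality involves only `B u v + B v u`, so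
      -- Cauchy–Schwarz for the symmetrization is enough.
      have h := LinearMap.BilinForm.apply_mul_apply_le_of_forall_zero_le (B + B.flip)
        (fun x => by simpa using hB x) u v
      simp only [LinearMap.add_apply, LinearMap.flip_apply] at h
      have h1 : B u v + B v u ≤ 2 * (√(B u u) * √(B v v)) := by
        refine le_of_abs_le (abs_le_of_sq_le_sq ?_ (by positivity))
        rw [mul_pow, mul_pow, Real.sq_sqrt (hB u), Real.sq_sqrt (hB v)]
        linarith
      refine Real.sqrt_le_iff.2 ⟨by positivity, ?_⟩
      have e1 := Real.sq_sqrt (hB u)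
      have e2 := Real.sq_sqrt (hB v)
      simp only [map_add, LinearMap.add_apply]
      nlinarith)
    (fun c v => by
      simp only [map_smul, LinearMap.smul_apply, smul_eq_mul, ← mul_assoc, Real.norm_eq_abs]
      rw [Real.sqrt_mul (mul_self_nonneg c), Real.sqrt_mul_self_eq_abs])

/-! ### Mesh geometry -/

namespace Mesh

variable (M : Mesh a b)

theorem size_pos (i : Fin M.N) : 0 < M.size i :=
  sub_pos.2 (M.strictMono i.castSucc_lt_succ)

theorem size_le_h (i : Fin M.N) : M.size i ≤ M.h := le_ciSup (Set.finite_range M.size).bddAbove i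

theorem left_add_size (i : Fin M.N) : M.left i + M.size i = M.right i := by simp [size]

theorem N_pos (hab : a < b) : 0 < M.N := by
  rcases Nat.eq_zero_or_pos M.N with h | h
  · exfalso
    have h1 := M.first
    have h2 := M.last
    have : (0 : Fin (M.N + 1)) = Fin.last M.N := by ext; simp [h]
    rw [this] at h1
    linarith
  · exact h

theorem h_pos (hab : a < b) : 0 < M.h :=
  (M.size_pos ⟨0, M.N_pos hab⟩).trans_le (M.size_le_h _)

theorem one_le_of_quasiUniform (hab : a < b) {ρ : ℝ} (h : M.QuasiUniform ρ) : 1 ≤ ρ := by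
  have h1 := h ⟨0, M.N_pos hab⟩
  have h2 := M.size_le_h ⟨0, M.N_pos hab⟩
  have h3 := M.size_pos ⟨0, M.N_pos hab⟩
  by_contra! h4
  nlinarith

theorem sum_sub_eq (n : ℕ) (f : Fin (n + 1) → ℝ) :
    ∑ i : Fin n, (f i.succ - f i.castSucc) = f (Fin.last n) - f 0 := by
  induction n with
  | zero => simp
  | succ n ih =>
    rw [Fin.sum_univ_castSucc]
    have := ih fun i => f i.castSucc
    simp only [Fin.succ_last, Fin.castSucc_zero] at this ⊢
    simp only [← Fin.succ_castSucc] at this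
    rw [this]; ring

theorem sum_size : ∑ i, M.size i = b - a := by
  have := sum_sub_eq M.N M.node
  rw [M.first, M.last] at this
  exact this

theorem sum_integral {f : ℝ → ℝ} (hf : Continuous f) :
    ∑ i, ∫ x in (M.left i)..(M.right i), f x = ∫ x in a..b, f x := by
  have := sum_sub_eq M.N fun j => ∫ x in a..(M.node j), f x
  rw [M.first, M.last, intervalIntegral.integral_same, sub_zero] at this
  rw [← this]
  refine sum_congr rfl fun i _ => ?_
  rw [intervalIntegral.integral_interval_sub_left (hf.intervalIntegrable _ _)
    (hf.intervalIntegrable _ _)]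
  rfl

theorem sum_next (f : Fin M.N → ℝ) : ∑ i, f (M.next i) = ∑ i, f i :=
  Equiv.sum_comp (finRotate M.N) f

theorem sum_prev (f : Fin M.N → ℝ) : ∑ i, f (M.prev i) = ∑ i, f i :=
  Equiv.sum_comp (finRotate M.N).symm f

theorem next_prev (i : Fin M.N) : M.next (M.prev i) = i := Equiv.apply_symm_apply _ _

/-- The left end of the next cell is the right end of the cell, up to a period. -/
theorem left_next (i : Fin M.N) :
    M.left (M.next i) = M.right i ∨ M.left (M.next i) = M.right i - (b - a) := by
  obtain ⟨N, node, hm, h0, h1⟩ := M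
  cases N with
  | zero => exact i.elim0
  | succ n =>
    simp only [left, right, next]
    by_cases hi : i = Fin.last n
    · right
      subst hi
      rw [finRotate_last, Fin.castSucc_zero, h0, Fin.succ_last, h1]; ring
    · left
      congr 1
      ext
      rw [Fin.val_castSucc, coe_finRotate_of_ne_last hi, Fin.val_succ]

/-! ### The reference cell -/

/-- Pull-back of a polynomial to the reference cell `[0, 1]`. -/
def ref (i : Fin M.N) : ℝ[X] →ₗ[ℝ] ℝ[X] :=
  (aeval (C (M.size i) * X + C (M.left i))).toLinearMap

theorem ref_eq_comp (i : Fin M.N) (p : ℝ[X]) :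
    M.ref i p = p.comp (C (M.size i) * X + C (M.left i)) := rfl

theorem ref_eval (i : Fin M.N) (p : ℝ[X]) (s : ℝ) :
    (M.ref i p).eval s = p.eval (M.left i + s * M.size i) := by
  rw [ref_eq_comp, eval_comp]
  congr 1
  simp; ring

theorem ref_eval_zero (i : Fin M.N) (p : ℝ[X]) : (M.ref i p).eval 0 = p.eval (M.left i) := by
  rw [ref_eval]; simp

theorem ref_mul (i : Fin M.N) (p q : ℝ[X]) : M.ref i (p * q) = M.ref i p * M.ref i q := by
  simp [ref_eq_comp]

theorem ref_natDegree_le (i : Fin M.N) {p : ℝ[X]} {n : ℕ} (hp : p.natDegree ≤ n) :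
    (M.ref i p).natDegree ≤ n := by
  rw [ref_eq_comp]
  refine natDegree_comp_le.trans ?_
  calc _ ≤ p.natDegree * 1 := Nat.mul_le_mul_left _ (by compute_degree)
    _ ≤ n := by lia

theorem derivative_ref (i : Fin M.N) (p : ℝ[X]) :
    derivative (M.ref i p) = M.size i • M.ref i (derivative p) := by
  simp [ref_eq_comp, derivative_comp, smul_eq_C_mul]

theorem iterate_derivative_ref (i : Fin M.N) (m : ℕ) (p : ℝ[X]) :
    derivative^[m] (M.ref i p) = M.size i ^ m • M.ref i (derivative^[m] p) := by
  induction m with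
  | zero => simp
  | succ m ih =>
    rw [Function.iterate_succ_apply', Function.iterate_succ_apply', ih, derivative_smul,
      derivative_ref, smul_smul, pow_succ]

theorem polyInt_ref (i : Fin M.N) (p : ℝ[X]) (s t : ℝ) :
    polyInt (M.left i + s * M.size i) (M.left i + t * M.size i) p =
      M.size i * polyInt s t (M.ref i p) := by
  have h := (M.size_pos i).ne'
  simp only [polyInt_apply, ref_eval]
  have := intervalIntegral.integral_comp_add_mul (a := s) (b := t) (fun x => p.eval x) h (M.left i)
  simp only [mul_comm (M.size i)] at this
  rw [this, smul_eq_mul, mul_inv_cancel_left₀ h]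

theorem polyInt_cell (i : Fin M.N) (p : ℝ[X]) :
    polyInt (M.left i) (M.right i) p = M.size i * polyInt 0 1 (M.ref i p) := by
  have := M.polyInt_ref i p 0 1
  rwa [zero_mul, add_zero, one_mul, left_add_size] at this

/-- The mean square of a polynomial over the cell `I_i`. -/
def energy (i : Fin M.N) (p : ℝ[X]) : ℝ := l2Form (M.ref i p) (M.ref i p)

theorem energy_nonneg (i : Fin M.N) (p : ℝ[X]) : 0 ≤ M.energy i p := l2Form_nonneg _

theorem integral_sq (i : Fin M.N) (p : ℝ[X]) :
    ∫ x in (M.left i)..(M.right i), p.eval x ^ 2 = M.size i * M.energy i p := by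
  have := M.polyInt_cell i (p * p)
  rw [ref_mul] at this
  rw [energy, l2Form_apply, ← this, polyInt_apply]
  simp [pow_two]

theorem energy_add_le (i : Fin M.N) (p q : ℝ[X]) :
    M.energy i (p + q) ≤ 2 * M.energy i p + 2 * M.energy i q := by
  have h := l2Form_nonneg (M.ref i p - M.ref i q)
  simp only [energy, map_add, LinearMap.add_apply, map_sub, LinearMap.sub_apply] at *
  linarith

theorem energy_neg (i : Fin M.N) (p : ℝ[X]) : M.energy i (-p) = M.energy i p := by
  simp [energy]

theorem energy_sub_le (i : Fin M.N) (p q : ℝ[X]) :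
    M.energy i (p - q) ≤ 2 * M.energy i p + 2 * M.energy i q := by
  rw [sub_eq_add_neg, ← M.energy_neg i q]
  exact M.energy_add_le i p (-q)

theorem energy_smul (i : Fin M.N) (c : ℝ) (p : ℝ[X]) :
    M.energy i (c • p) = c ^ 2 * M.energy i p := by
  simp [energy, pow_two, mul_assoc]

variable {M}

theorem V.natDegree_le (v : M.V k) (i : Fin M.N) : (v i : ℝ[X]).natDegree ≤ k :=
  natDegree_le_iff_degree_le.2 (Polynomial.mem_degreeLE.1 (v i).2)

/-- An element of `V^k` from polynomials of degree at most `k`. -/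
def V.mk (p : Fin M.N → ℝ[X]) (hp : ∀ i, (p i).natDegree ≤ k) : M.V k :=
  fun i => ⟨p i, Polynomial.mem_degreeLE.2 (natDegree_le_iff_degree_le.1 (hp i))⟩

@[simp] theorem V.mk_coe (p : Fin M.N → ℝ[X]) (hp : ∀ i, (p i).natDegree ≤ k) (i : Fin M.N) :
    (V.mk p hp i : ℝ[X]) = p i := rfl

/-- The squared `L²(Ω)`-norm. -/
def V.normSq (v : M.V k) : ℝ := ∑ i, M.size i * M.energy i (v i)

theorem V.normSq_nonneg (v : M.V k) : 0 ≤ v.normSq :=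
  sum_nonneg fun i _ => mul_nonneg (M.size_pos i).le (M.energy_nonneg i _)

theorem V.size_mul_energy_le (v : M.V k) (i : Fin M.N) : M.size i * M.energy i (v i) ≤ v.normSq :=
  single_le_sum (f := fun i => M.size i * M.energy i (v i))
    (fun i _ => mul_nonneg (M.size_pos i).le (M.energy_nonneg i _)) (mem_univ i)

end Mesh

open Mesh

variable {M : Mesh a b}

/-- `starInner` as a bilinear form. -/
def starForm (M : Mesh a b) (S : Subdivision k) (w : Fin (k + 2) → ℝ) :
    M.V k →ₗ[ℝ] M.V k →ₗ[ℝ] ℝ :=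
  ∑ i, M.size i • (refStarForm S w).compl₁₂
    ((M.ref i).comp ((Submodule.subtype _).comp (LinearMap.proj i)))
    ((M.ref i).comp ((Submodule.subtype _).comp (LinearMap.proj i)))

theorem starForm_apply (S : Subdivision k) (w : Fin (k + 2) → ℝ) (v ω : M.V k) :
    starForm M S w v ω = ∑ i, M.size i * refStar S w (M.ref i (v i)) (M.ref i (ω i)) := by
  simp [starForm, LinearMap.sum_apply, refStarForm_apply]

theorem cvInt_val (S : Subdivision k) (v : M.V k) (i : Fin M.N) (j : Fin (k + 1)) :
    cvInt M S i j (v.val i) =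
      M.size i * polyInt (S.point j.castSucc) (S.point j.succ) (M.ref i (v i)) := by
  rw [← M.polyInt_ref]; rfl

theorem starInner_eq (S : Subdivision k) (w : Fin (k + 2) → ℝ) (v ω : M.V k) :
    starInner S w v ω = starForm M S w v ω := by
  rw [starForm_apply]
  refine sum_congr rfl fun i _ => ?_
  rw [refStar, mul_sum]
  refine sum_congr rfl fun j _ => ?_
  rw [cvInt_val, Mstar, ← mul_assoc, ref_eval_zero]
  congr 2
  refine sum_congr rfl fun l _ => ?_
  rw [derivative_ref, eval_smul, ref_eval, smul_eq_mul]
  simp only [V.dval, Function.iterate_one, cvPoint]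
  ring

theorem starForm_nonneg (hk : 1 ≤ k) {S : Subdivision k} {w : Fin (k + 2) → ℝ}
    (hS : S.Admissible w) (M : Mesh a b) (v : M.V k) : 0 ≤ starForm M S w v v := by
  rw [starForm_apply]
  refine sum_nonneg fun i _ => mul_nonneg (M.size_pos i).le ?_
  by_cases h : M.ref i (v i) = 0
  · simp [h, refStar]
  · exact (refStar_pos hk hS (M.ref_natDegree_le i (v.natDegree_le i)) h).le

/-- The energy norm as a seminorm. -/
def starSeminorm (hk : 1 ≤ k) {S : Subdivision k} {w : Fin (k + 2) → ℝ}
    (hS : S.Admissible w) (M : Mesh a b) : Seminorm ℝ (M.V k) :=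
  formSeminorm (starForm M S w) (starForm_nonneg hk hS M)

theorem starSeminorm_eq (hk : 1 ≤ k) {S : Subdivision k} {w : Fin (k + 2) → ℝ}
    (hS : S.Admissible w) (v : M.V k) : starSeminorm hk hS M v = starNorm S w v := by
  rw [starNorm, starInner_eq]; rfl

theorem starSeminorm_sq (hk : 1 ≤ k) {S : Subdivision k} {w : Fin (k + 2) → ℝ}
    (hS : S.Admissible w) (v : M.V k) :
    starSeminorm hk hS M v ^ 2 = ∑ i, M.size i * refStar S w (M.ref i (v i)) (M.ref i (v i)) := by
  rw [← starForm_apply]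
  exact Real.sq_sqrt (starForm_nonneg hk hS M v)

theorem normSq_equiv (hk : 1 ≤ k) {S : Subdivision k} {w : Fin (k + 2) → ℝ}
    (hS : S.Admissible w) :
    ∃ C : ℝ, 0 < C ∧ ∀ (M : Mesh a b) (v : M.V k),
      v.normSq ≤ C ^ 2 * starSeminorm hk hS M v ^ 2 ∧
      starSeminorm hk hS M v ^ 2 ≤ C ^ 2 * v.normSq := by
  obtain ⟨C₁, h₁, H₁⟩ := form_le_form k (refStarForm S w) l2Form fun p hp hp0 => by
    rw [refStarForm_apply]; exact refStar_pos hk hS hp hp0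
  obtain ⟨C₂, h₂, H₂⟩ := form_le_form k l2Form (refStarForm S w) fun p hp hp0 => l2Form_pos hp0
  -- The constant is used squared, so that it passes through square roots; `1 + C₁ + C₂` serves both
  -- directions.
  have hC : C₁ ≤ (1 + C₁ + C₂) ^ 2 := by nlinarith
  have hC' : C₂ ≤ (1 + C₁ + C₂) ^ 2 := by nlinarith
  refine ⟨1 + C₁ + C₂, by positivity, fun M v => ⟨?_, ?_⟩⟩
  · rw [starSeminorm_sq, V.normSq, mul_sum]
    refine sum_le_sum fun i _ => ?_
    have hd := M.ref_natDegree_le i (v.natDegree_le i)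
    have h3 := H₁ _ hd
    rw [mul_left_comm]
    refine mul_le_mul_of_nonneg_left (h3.trans ?_) (M.size_pos i).le
    rw [refStarForm_apply]
    refine mul_le_mul_of_nonneg_right hC ?_
    by_cases h : M.ref i (v i) = 0
    · simp [h, refStar]
    · exact (refStar_pos hk hS hd h).le
  · rw [starSeminorm_sq, V.normSq, mul_sum]
    refine sum_le_sum fun i _ => ?_
    have hd := M.ref_natDegree_le i (v.natDegree_le i)
    have h3 := H₂ _ hd
    rw [refStarForm_apply] at h3
    rw [mul_left_comm]
    refine mul_le_mul_of_nonneg_left (h3.trans ?_) (M.size_pos i).le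
    exact mul_le_mul_of_nonneg_right hC' (l2Form_nonneg _)

variable {a b : ℝ} {k : ℕ} {M : Mesh a b}

/-! ### Interpolation on the cells -/

theorem cvPoint_injective (M : Mesh a b) (S : Subdivision k) (i : Fin M.N) :
    Function.Injective (cvPoint M S i) := by
  intro j l h
  have : S.point j * M.size i = S.point l * M.size i := by simpa [cvPoint] using h
  exact S.strictMono.injective (mul_right_cancel₀ (M.size_pos i).ne' this)

theorem cvPoint_zero (M : Mesh a b) (S : Subdivision k) (i : Fin M.N) :
    cvPoint M S i 0 = M.left i := by simp [cvPoint, S.first]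

theorem cvPoint_last (M : Mesh a b) (S : Subdivision k) (i : Fin M.N) :
    cvPoint M S i (Fin.last (k + 1)) = M.right i := by
  rw [cvPoint, S.last, one_mul, left_add_size]

theorem ref_eval_point (M : Mesh a b) (S : Subdivision k) (i : Fin M.N) (j : Fin (k + 2))
    (p : ℝ[X]) : (M.ref i p).eval (S.point j) = p.eval (cvPoint M S i j) := by
  rw [ref_eval]; rfl

/-- The polynomial of degree at most `k + 1` with prescribed values at `x_{i,0}, …, x_{i,k+1}`. -/
def fullInterp (M : Mesh a b) (S : Subdivision k) (i : Fin M.N) :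
    (Fin (k + 2) → ℝ) →ₗ[ℝ] ℝ[X] := Lagrange.interpolate univ (cvPoint M S i)

theorem fullInterp_eval (S : Subdivision k) (i : Fin M.N) (r : Fin (k + 2) → ℝ)
    (j : Fin (k + 2)) : (fullInterp M S i r).eval (cvPoint M S i j) = r j :=
  Lagrange.eval_interpolate_at_node r (cvPoint_injective M S i).injOn (mem_univ j)

theorem fullInterp_natDegree (S : Subdivision k) (i : Fin M.N) (r : Fin (k + 2) → ℝ) :
    (fullInterp M S i r).natDegree ≤ k + 1 := by
  have := Lagrange.degree_interpolate_le r (cvPoint_injective M S i).injOn (s := univ)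
  rw [card_univ, Fintype.card_fin] at this
  exact natDegree_le_iff_degree_le.2 this

/-- The polynomial of degree at most `k` with prescribed values at `x_{i,1}, …, x_{i,k+1}`. -/
def radauInterp (M : Mesh a b) (S : Subdivision k) (i : Fin M.N) :
    (Fin (k + 1) → ℝ) →ₗ[ℝ] ℝ[X] := Lagrange.interpolate univ fun j => cvPoint M S i j.succ

theorem radauInterp_eval (S : Subdivision k) (i : Fin M.N) (r : Fin (k + 1) → ℝ)
    (j : Fin (k + 1)) : (radauInterp M S i r).eval (cvPoint M S i j.succ) = r j :=
  Lagrange.eval_interpolate_at_node r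
    (((cvPoint_injective M S i).comp (Fin.succ_injective _)).injOn) (mem_univ j)

theorem radauInterp_natDegree (S : Subdivision k) (i : Fin M.N) (r : Fin (k + 1) → ℝ) :
    (radauInterp M S i r).natDegree ≤ k := by
  have := Lagrange.degree_interpolate_le r (s := univ)
    (((cvPoint_injective M S i).comp (Fin.succ_injective _)).injOn)
  rw [card_univ, Fintype.card_fin] at this
  exact natDegree_le_iff_degree_le.2 this

/-! ### The spectral volume operator -/

/-- The upwind value of `v` at `x_{i,j}`. -/
def upVal (S : Subdivision k) (i : Fin M.N) : M.V k →ₗ[ℝ] (Fin (k + 2) → ℝ) where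
  toFun v j := if j = 0 then (v (M.prev i) : ℝ[X]).eval (M.right (M.prev i))
    else (v i : ℝ[X]).eval (cvPoint M S i j)
  map_add' u v := by
    funext j
    by_cases h : j = 0 <;> simp [h]
  map_smul' c v := by
    funext j
    by_cases h : j = 0 <;> simp [h]

theorem flux_eq (S : Subdivision k) (β : ℝ) (v : M.V k) (i : Fin M.N) (j : Fin (k + 2)) :
    flux S β v i j = β * upVal S i v j := by
  simp only [flux, upVal, LinearMap.coe_mk, AddHom.coe_mk, mul_ite]
  rfl

/-- The spatial operator of the spectral volume scheme. -/
def svOp (M : Mesh a b) (S : Subdivision k) (β : ℝ) : M.V k →ₗ[ℝ] M.V k where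
  toFun v := V.mk (fun i => -(β • derivative (fullInterp M S i (upVal S i v)))) fun i => by
    rw [natDegree_neg]
    exact (natDegree_smul_le _ _).trans ((natDegree_derivative_le _).trans
      (by have := fullInterp_natDegree S i (upVal S i v); lia))
  map_add' u v := by
    funext i
    apply Subtype.ext
    simp only [V.mk_coe, Pi.add_apply, Submodule.coe_add]
    rw [map_add, map_add, derivative_add, smul_add, neg_add]
  map_smul' c v := by
    funext i
    apply Subtype.ext
    simp only [V.mk_coe, Pi.smul_apply, Submodule.coe_smul, RingHom.id_apply]
    rw [map_smul, map_smul, derivative_smul, smul_neg, smul_comm]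

theorem svOp_coe (S : Subdivision k) (β : ℝ) (v : M.V k) (i : Fin M.N) :
    (svOp M S β v i : ℝ[X]) = -(β • derivative (fullInterp M S i (upVal S i v))) := rfl

theorem cvInt_polyInt (S : Subdivision k) (v : M.V k) (i : Fin M.N) (j : Fin (k + 1)) :
    cvInt M S i j (v.val i) = polyInt (cvPoint M S i j.castSucc) (cvPoint M S i j.succ) (v i) :=
  rfl

/-- The fundamental theorem of calculus: the interpolant takes the upwind values at the ends of
every control volume, so its derivative integrates to the flux difference. -/
theorem cvInt_svOp (S : Subdivision k) (β : ℝ) (v : M.V k) (i : Fin M.N) (j : Fin (k + 1)) :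
    cvInt M S i j ((svOp M S β v).val i) =
      flux S β v i j.castSucc - flux S β v i j.succ := by
  rw [cvInt_polyInt, svOp_coe, map_neg, map_smul, polyInt_derivative, fullInterp_eval,
    fullInterp_eval, flux_eq, flux_eq, smul_eq_mul]
  ring

/-- A primitive of degree at most `n + 1` takes the same value at `n + 2` distinct points, hence is
constant. -/
theorem eq_zero_of_cvInt {n : ℕ} {x : Fin (n + 2) → ℝ} (hx : Function.Injective x) {p : ℝ[X]}
    (hp : p.natDegree ≤ n)
    (h : ∀ j : Fin (n + 1), polyInt (x j.castSucc) (x j.succ) p = 0) : p = 0 := by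
  obtain ⟨P, rfl, hPd, -, -⟩ := exists_primitive p n hp
  have hc : ∀ j, P.eval (x j) = P.eval (x 0) := by
    intro j
    induction j using Fin.induction with
    | zero => rfl
    | succ j ih =>
      have := h j
      rw [polyInt_derivative] at this
      linarith
  have : P - C (P.eval (x 0)) = 0 := by
    refine eq_zero_of_degree_lt_of_eval_index_eq_zero (s := univ) (v := x) hx.injOn ?_ ?_
    · rw [card_univ, Fintype.card_fin]
      have h1 : (P - C (P.eval (x 0))).natDegree ≤ n + 1 := by rwa [natDegree_sub_C]
      exact (natDegree_le_iff_degree_le.1 h1).trans_lt (by exact_mod_cast Nat.lt_succ_self _)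
    · intro j _
      simp [hc j]
  rw [sub_eq_zero.1 this, derivative_C]

/-- Both sides have the same control-volume integrals and these determine an element of `V^k`. The
implicit definition of a stage thereby becomes an explicit linear recursion. -/
theorem isRKStage_iff (S : Subdivision k) (R : RKMethod) (β τ : ℝ) (u : ℕ → M.V k) (l : ℕ)
    (z : M.V k) : IsRKStage S R β τ (fun _ _ => 0) u l z ↔
      z = ∑ κ ∈ range (l + 1), (R.c l κ • u κ + R.d l κ • τ • svOp M S β (u κ)) := by
  set y := ∑ κ ∈ range (l + 1), (R.c l κ • u κ + R.d l κ • τ • svOp M S β (u κ)) with hy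
  have hcv : ∀ i j, cvInt M S i j (y.val i) = ∑ κ ∈ range (l + 1),
      (R.c l κ * cvInt M S i j ((u κ).val i) + τ * R.d l κ *
        (flux S β (u κ) i j.castSucc - flux S β (u κ) i j.succ + cvInt M S i j (fun _ => 0))) := by
    intro i j
    have h0 : cvInt M S i j (fun _ => 0) = 0 := by simp [cvInt]
    simp only [h0, add_zero, ← cvInt_svOp]
    simp only [cvInt_polyInt]
    rw [hy]
    simp only [Finset.sum_apply, Pi.add_apply, Pi.smul_apply, AddSubmonoidClass.coe_finsetSum,
      Submodule.coe_add, Submodule.coe_smul, map_sum, map_add, map_smul, smul_eq_mul]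
    exact sum_congr rfl fun κ _ => by ring
  constructor
  · intro h
    funext i
    apply Subtype.ext
    rw [← sub_eq_zero]
    refine eq_zero_of_cvInt (n := k) (cvPoint_injective M S i)
      ((natDegree_sub_le_of_le (z.natDegree_le i) (y.natDegree_le i)).trans (max_self k).le) ?_
    intro j
    rw [map_sub, ← cvInt_polyInt, ← cvInt_polyInt, h i j, hcv i j, sub_self]
  · rintro rfl i j
    exact hcv i j

/-! ### Bound of the spectral volume operator -/

theorem energy_derivative_le (S : Subdivision k) :
    ∃ C : ℝ, 0 ≤ C ∧ ∀ (M : Mesh a b) (i : Fin M.N) (p : ℝ[X]), p.natDegree ≤ k + 1 →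
      M.size i ^ 2 * M.energy i (derivative p) ≤ C * ∑ j, p.eval (cvPoint M S i j) ^ 2 := by
  obtain ⟨C, hC, H⟩ := form_le_nodal (k + 1) (l2Form.compl₁₂ derivative derivative) S.point
    S.strictMono.injective
  refine ⟨C, hC, fun M i p hp => ?_⟩
  have h := H (M.ref i p) (M.ref_natDegree_le i hp)
  simp only [ref_eval_point, LinearMap.compl₁₂_apply, derivative_ref, map_smul,
    LinearMap.smul_apply, smul_eq_mul] at h
  rw [pow_two, mul_assoc]
  exact h

theorem eval_sq_le_energy (k : ℕ) (s : ℝ) :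
    ∃ C : ℝ, 0 ≤ C ∧ ∀ (M : Mesh a b) (i : Fin M.N) (p : ℝ[X]), p.natDegree ≤ k →
      p.eval (M.left i + s * M.size i) ^ 2 ≤ C * M.energy i p := by
  obtain ⟨C, hC, H⟩ := functional_sq_le_l2 k (leval s)
  refine ⟨C, hC, fun M i p hp => ?_⟩
  have h := H (M.ref i p) (M.ref_natDegree_le i hp)
  rwa [leval_apply, ref_eval] at h

/-- Inverse inequality on the reference cell; the upwind cell enters only through the value at the
left endpoint. -/
theorem energy_svOp_le (S : Subdivision k) (β : ℝ) :
    ∃ C : ℝ, 0 ≤ C ∧ ∀ (M : Mesh a b) (v : M.V k) (i : Fin M.N),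
      M.size i ^ 2 * M.energy i (svOp M S β v i) ≤
        C * (M.energy i (v i) + M.energy (M.prev i) (v (M.prev i))) := by
  obtain ⟨C, hC, H⟩ := energy_derivative_le (a := a) (b := b) S
  choose D hD0 hD using fun s : ℝ => eval_sq_le_energy (a := a) (b := b) k s
  have hsum := sum_nonneg fun j (_ : j ∈ (univ : Finset (Fin (k + 2)))) => hD0 (S.point j)
  refine ⟨β ^ 2 * (C * (∑ j, D (S.point j) + (k + 2) * D 1)), by have := hD0 1; positivity,
    fun M v i => ?_⟩
  have he := M.energy_nonneg i (v i)
  have he' := M.energy_nonneg (M.prev i) (v (M.prev i))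
  have h1 := H M i (fullInterp M S i (upVal S i v)) (fullInterp_natDegree S i _)
  rw [svOp_coe, energy_neg, energy_smul]
  have h2 : ∑ j, (fullInterp M S i (upVal S i v)).eval (cvPoint M S i j) ^ 2 ≤
      (∑ j, D (S.point j) + (k + 2) * D 1) *
        (M.energy i (v i) + M.energy (M.prev i) (v (M.prev i))) := by
    have : ∀ j, (fullInterp M S i (upVal S i v)).eval (cvPoint M S i j) ^ 2 ≤
        (D (S.point j) + D 1) * (M.energy i (v i) + M.energy (M.prev i) (v (M.prev i))) := by
      intro j
      rw [fullInterp_eval]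
      have hj := hD0 (S.point j)
      have h1 := hD0 1
      simp only [upVal, LinearMap.coe_mk, AddHom.coe_mk]
      split_ifs
      · have := hD 1 M (M.prev i) (v (M.prev i)) (v.natDegree_le _)
        rw [one_mul, left_add_size] at this
        nlinarith [mul_nonneg hj he, mul_nonneg hj he', mul_nonneg h1 he]
      · have := hD (S.point j) M i (v i) (v.natDegree_le _)
        unfold cvPoint
        nlinarith [mul_nonneg hj he', mul_nonneg h1 he, mul_nonneg h1 he']
    refine (sum_le_sum fun j _ => this j).trans (le_of_eq ?_)
    rw [← sum_mul, sum_add_distrib]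
    simp
  calc _ = β ^ 2 * (M.size i ^ 2 * M.energy i (derivative (fullInterp M S i (upVal S i v)))) := by
        ring
    _ ≤ β ^ 2 * (C * ((∑ j, D (S.point j) + (k + 2) * D 1) *
        (M.energy i (v i) + M.energy (M.prev i) (v (M.prev i))))) := by
        refine mul_le_mul_of_nonneg_left (h1.trans ?_) (by positivity)
        exact mul_le_mul_of_nonneg_left h2 hC
    _ = _ := by ring

theorem Mesh.size_le_mul {ρ : ℝ} (hM : M.QuasiUniform ρ) (i j : Fin M.N) :
    M.size i ≤ ρ * M.size j := (M.size_le_h i).trans (hM j)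

theorem normSq_svOp_le (hab : a < b) (S : Subdivision k) (β ρ : ℝ) :
    ∃ C : ℝ, 0 ≤ C ∧ ∀ (M : Mesh a b), M.QuasiUniform ρ → ∀ v : M.V k,
      M.h ^ 2 * (svOp M S β v).normSq ≤ C * v.normSq := by
  obtain ⟨C, hC, H⟩ := energy_svOp_le (a := a) (b := b) S β
  refine ⟨ρ ^ 2 * (C * (1 + |ρ|)), by positivity, fun M hM v => ?_⟩
  have hρ := M.one_le_of_quasiUniform hab hM
  have hh := M.h_pos hab
  rw [abs_of_nonneg (by linarith)]
  have h1 : ∀ i, M.h ^ 2 * (M.size i * M.energy i (svOp M S β v i)) ≤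
      ρ ^ 2 * (C * (M.size i * M.energy i (v i) +
        ρ * (M.size (M.prev i) * M.energy (M.prev i) (v (M.prev i))))) := by
    intro i
    have hs := M.size_pos i
    have he := M.energy_nonneg i (v i)
    have he' := M.energy_nonneg (M.prev i) (v (M.prev i))
    calc _ ≤ (ρ * M.size i) ^ 2 * (M.size i * M.energy i (svOp M S β v i)) := by
          refine mul_le_mul_of_nonneg_right ?_ (mul_nonneg hs.le (M.energy_nonneg i _))
          exact pow_le_pow_left₀ hh.le (hM i) 2
      _ = ρ ^ 2 * (M.size i * (M.size i ^ 2 * M.energy i (svOp M S β v i))) := by ring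
      _ ≤ ρ ^ 2 * (M.size i * (C * (M.energy i (v i) + M.energy (M.prev i) (v (M.prev i))))) := by
          have := H M v i
          gcongr
      _ = ρ ^ 2 * (C * (M.size i * M.energy i (v i) +
          M.size i * M.energy (M.prev i) (v (M.prev i)))) := by ring
      _ ≤ _ := by
          have := size_le_mul hM i (M.prev i)
          rw [← mul_assoc ρ]
          gcongr
  rw [V.normSq, mul_sum]
  refine (sum_le_sum fun i _ => h1 i).trans (le_of_eq ?_)
  rw [← mul_sum, ← mul_sum, sum_add_distrib, ← mul_sum,
    M.sum_prev fun i => M.size i * M.energy i (v i), V.normSq]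
  ring

/-! ### Taylor polynomials of functions with bounded derivatives -/

/-- `W` is of class `C^n`, with all derivatives up to order `n` bounded by `K`. -/
structure SmoothBound (n : ℕ) (K : ℝ) (W : ℝ → ℝ) : Prop where
  contDiff : ContDiff ℝ n W
  bound : ∀ j ≤ n, ∀ x, |iteratedDeriv j W x| ≤ K

theorem SmoothBound.mono {n m : ℕ} {K : ℝ} {W : ℝ → ℝ} (h : SmoothBound n K W) (hm : m ≤ n) :
    SmoothBound m K W :=
  ⟨h.contDiff.of_le (by exact_mod_cast hm), fun j hj => h.bound j (hj.trans hm)⟩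

theorem SmoothBound.deriv {n : ℕ} {K : ℝ} {W : ℝ → ℝ} (h : SmoothBound (n + 1) K W) :
    SmoothBound n K (deriv W) := by
  refine ⟨?_, fun j hj x => ?_⟩
  · have := h.contDiff
    push_cast at this
    exact ((contDiff_succ_iff_deriv (n := n)).1 this).2.2
  · rw [← iteratedDeriv_succ']
    exact h.bound (j + 1) (by lia) x

theorem SmoothBound.nonneg {n : ℕ} {K : ℝ} {W : ℝ → ℝ} (h : SmoothBound n K W) : 0 ≤ K :=
  (abs_nonneg _).trans (h.bound 0 (Nat.zero_le _) 0)

theorem SmoothBound.hasDerivAt {n : ℕ} {K : ℝ} {W : ℝ → ℝ} (h : SmoothBound (n + 1) K W) (x : ℝ) :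
    HasDerivAt W (_root_.deriv W x) x :=
  ((h.contDiff.differentiable (by norm_cast)) x).hasDerivAt

/-- The Taylor polynomial of degree `n` at `x₀`. -/
def taylorPoly (W : ℝ → ℝ) (n : ℕ) (x₀ : ℝ) : ℝ[X] :=
  ∑ m ∈ range (n + 1), C (iteratedDeriv m W x₀ / m.factorial) * (X - C x₀) ^ m

theorem taylorPoly_natDegree (W : ℝ → ℝ) (n : ℕ) (x₀ : ℝ) : (taylorPoly W n x₀).natDegree ≤ n := by
  refine natDegree_sum_le_of_forall_le _ _ fun m hm => ?_
  refine (natDegree_C_mul_le _ _).trans ?_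
  rw [natDegree_pow, natDegree_X_sub_C, mul_one]
  exact Nat.lt_succ_iff.1 (mem_range.1 hm)

theorem taylorPoly_eval_self (W : ℝ → ℝ) (n : ℕ) (x₀ : ℝ) : (taylorPoly W n x₀).eval x₀ = W x₀ := by
  simp only [taylorPoly, eval_finsetSum, eval_mul, eval_C, eval_pow, eval_sub, eval_X, sub_self]
  rw [sum_eq_single 0]
  · simp
  · intro m _ hm; simp [hm]
  · simp

theorem derivative_taylorPoly (W : ℝ → ℝ) (n : ℕ) (x₀ : ℝ) :
    derivative (taylorPoly W (n + 1) x₀) = taylorPoly (deriv W) n x₀ := by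
  rw [taylorPoly, derivative_sum, sum_range_succ', taylorPoly]
  simp only [pow_zero, mul_one, derivative_C, add_zero]
  refine sum_congr rfl fun m _ => ?_
  rw [derivative_C_mul, derivative_X_sub_C_pow, iteratedDeriv_succ', Nat.add_sub_cancel,
    ← mul_assoc, ← C_mul]
  congr 2
  rw [Nat.factorial_succ]
  push_cast
  field_simp

theorem abs_le_of_deriv_bound {g g' : ℝ → ℝ} {x₀ x A : ℝ} (hg : ∀ y, HasDerivAt g (g' y) y)
    (h0 : g x₀ = 0) (hA : ∀ y, |y - x₀| ≤ |x - x₀| → |g' y| ≤ A) : |g x| ≤ A * |x - x₀| := by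
  have := (convex_uIcc x₀ x).norm_image_sub_le_of_norm_hasDerivWithin_le
    (fun y _ => (hg y).hasDerivWithinAt) (C := A)
    (fun y hy => hA y (by
      have := Set.abs_sub_left_of_mem_uIcc hy
      exact this))
    Set.left_mem_uIcc Set.right_mem_uIcc
  rwa [h0, sub_zero] at this

/-- Induction on the order: the derivative of the remainder of `W` is the remainder of `W'`. The
factorial is not needed and is given away. -/
theorem taylorPoly_error {n : ℕ} {K : ℝ} {W : ℝ → ℝ} (h : SmoothBound (n + 1) K W) (x₀ x : ℝ) :
    |W x - (taylorPoly W n x₀).eval x| ≤ K * |x - x₀| ^ (n + 1) := by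
  induction n generalizing W x with
  | zero =>
    have h1 : (taylorPoly W 0 x₀).eval x = W x₀ := by simp [taylorPoly]
    rw [h1]
    simpa using abs_le_of_deriv_bound (g := fun y => W y - W x₀) (x₀ := x₀) (x := x) (A := K)
      (fun y => (h.hasDerivAt y).sub_const _) (by simp) (fun y _ => by
        have := h.bound 1 le_rfl y
        rwa [iteratedDeriv_one] at this)
  | succ n ih =>
    have := abs_le_of_deriv_bound (g := fun y => W y - (taylorPoly W (n + 1) x₀).eval y)
      (x₀ := x₀) (x := x) (A := K * |x - x₀| ^ (n + 1))
      (fun y => (h.hasDerivAt y).sub ((taylorPoly W (n + 1) x₀).hasDerivAt y))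
      (by simp [taylorPoly_eval_self]) (fun y hy => by
        rw [derivative_taylorPoly]
        exact (ih h.deriv y).trans
          (mul_le_mul_of_nonneg_left (pow_le_pow_left₀ (abs_nonneg _) hy _) h.nonneg))
    rwa [mul_assoc, ← pow_succ] at this

theorem iterate_derivative_taylorPoly (W : ℝ → ℝ) (n m : ℕ) (x₀ : ℝ) :
    derivative^[m] (taylorPoly W (n + m) x₀) = taylorPoly (iteratedDeriv m W) n x₀ := by
  induction m generalizing W with
  | zero => simp
  | succ m ih =>
    rw [Function.iterate_succ_apply, ← add_assoc, derivative_taylorPoly, ih, ← iteratedDeriv_succ']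

theorem SmoothBound.iteratedDeriv {n m : ℕ} {K : ℝ} {W : ℝ → ℝ} (h : SmoothBound (n + m) K W) :
    SmoothBound n K (iteratedDeriv m W) := by
  induction m generalizing W with
  | zero => simpa using h
  | succ m ih =>
    rw [iteratedDeriv_succ']
    exact ih h.deriv

/-! ### Interpolation of smooth functions -/

variable {a b : ℝ} {k : ℕ} {M : Mesh a b}

/-- The interpolant of a function at the points `x_{i,1}, …, x_{i,k+1}` of every cell. -/
def interp (M : Mesh a b) (S : Subdivision k) : (ℝ → ℝ) →ₗ[ℝ] M.V k where
  toFun W := V.mk (fun i => radauInterp M S i fun j => W (cvPoint M S i j.succ))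
    fun i => radauInterp_natDegree S i _
  map_add' u v := by
    funext i
    apply Subtype.ext
    simp only [V.mk_coe, Pi.add_apply, Submodule.coe_add]
    rw [← map_add]; rfl
  map_smul' c v := by
    funext i
    apply Subtype.ext
    simp only [V.mk_coe, Pi.smul_apply, Submodule.coe_smul, RingHom.id_apply]
    rw [← map_smul]; rfl

theorem interp_coe (S : Subdivision k) (W : ℝ → ℝ) (i : Fin M.N) :
    (interp M S W i : ℝ[X]) = radauInterp M S i fun j => W (cvPoint M S i j.succ) := rfl

theorem interp_eval (S : Subdivision k) (W : ℝ → ℝ) (i : Fin M.N) (j : Fin (k + 1)) :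
    (interp M S W i : ℝ[X]).eval (cvPoint M S i j.succ) = W (cvPoint M S i j.succ) := by
  rw [interp_coe, radauInterp_eval]

theorem point_mem (S : Subdivision k) (j : Fin (k + 2)) : S.point j ∈ Set.Icc (0 : ℝ) 1 := by
  rw [← S.first, ← S.last]
  exact ⟨S.strictMono.monotone (Fin.zero_le j), S.strictMono.monotone (Fin.le_last j)⟩

theorem cvPoint_sub_left (S : Subdivision k) (i : Fin M.N) (j : Fin (k + 2)) :
    |cvPoint M S i j - M.left i| ≤ M.size i := by
  have h := point_mem S j
  have hs := M.size_pos i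
  rw [cvPoint, add_sub_cancel_left, abs_of_nonneg (mul_nonneg h.1 hs.le)]
  nlinarith [h.2]

theorem form_le_radau (S : Subdivision k) (B : ℝ[X] →ₗ[ℝ] ℝ[X] →ₗ[ℝ] ℝ) :
    ∃ C : ℝ, 0 ≤ C ∧ ∀ (M : Mesh a b) (i : Fin M.N) (p : ℝ[X]) (A : ℝ), p.natDegree ≤ k →
      (∀ j : Fin (k + 1), |p.eval (cvPoint M S i j.succ)| ≤ A) →
      B (M.ref i p) (M.ref i p) ≤ C * A ^ 2 := by
  obtain ⟨C, hC, H⟩ := form_le_nodal k B (fun j => S.point j.succ)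
    (S.strictMono.injective.comp (Fin.succ_injective _))
  refine ⟨C * (k + 1), by positivity, fun M i p A hp hA => ?_⟩
  refine (H _ (M.ref_natDegree_le i hp)).trans ?_
  rw [mul_assoc]
  refine mul_le_mul_of_nonneg_left ?_ hC
  simp only [ref_eval_point]
  refine (sum_le_sum fun j _ => sq_le_sq.2 ((hA j).trans (le_abs_self A))).trans (le_of_eq ?_)
  simp

/-- The difference of the interpolant and the Taylor polynomial at the nodes. -/
theorem interp_sub_taylor_nodal (S : Subdivision k) {K : ℝ} {W : ℝ → ℝ}
    (hW : SmoothBound (k + 1) K W) (i : Fin M.N) (j : Fin (k + 1)) :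
    |((interp M S W i : ℝ[X]) - taylorPoly W k (M.left i)).eval (cvPoint M S i j.succ)| ≤
      K * M.size i ^ (k + 1) := by
  rw [eval_sub, interp_eval]
  refine (taylorPoly_error hW _ _).trans (mul_le_mul_of_nonneg_left ?_ hW.nonneg)
  exact pow_le_pow_left₀ (abs_nonneg _) (cvPoint_sub_left S i _) _

theorem interp_sub_taylor_natDegree (S : Subdivision k) (W : ℝ → ℝ) (i : Fin M.N) :
    ((interp M S W i : ℝ[X]) - taylorPoly W k (M.left i)).natDegree ≤ k :=
  (natDegree_sub_le_of_le ((interp M S W).natDegree_le i) (taylorPoly_natDegree W k _)).trans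
    (max_self k).le

theorem energy_interp_sub_taylor (S : Subdivision k) :
    ∃ C : ℝ, 0 ≤ C ∧ ∀ (M : Mesh a b) (i : Fin M.N) (K : ℝ) (W : ℝ → ℝ), SmoothBound (k + 1) K W →
      M.energy i ((interp M S W i : ℝ[X]) - taylorPoly W k (M.left i)) ≤
        C * (K * M.size i ^ (k + 1)) ^ 2 := by
  obtain ⟨C, hC, H⟩ := form_le_radau (a := a) (b := b) S l2Form
  exact ⟨C, hC, fun M i K W hW => H M i _ _ (interp_sub_taylor_natDegree S W i)
    (interp_sub_taylor_nodal S hW i)⟩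

/-- Interpolant minus Taylor polynomial has degree at most `k` and nodal values `O(h^(k+1))`, so on
the reference cell all its derivatives are of that size. The derivative of the Taylor polynomial is
the Taylor polynomial of the derivative. -/
theorem interp_deriv_error (S : Subdivision k) (m : ℕ) (hm : m ≤ k) (s : ℝ)
    (hs : s ∈ Set.Icc (0 : ℝ) 1) :
    ∃ C : ℝ, 0 ≤ C ∧ ∀ (M : Mesh a b) (i : Fin M.N) (K : ℝ) (W : ℝ → ℝ), SmoothBound (k + 1) K W →
      (M.size i ^ m * ((interp M S W).dval m i (M.left i + s * M.size i) -
        iteratedDeriv m W (M.left i + s * M.size i))) ^ 2 ≤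
        C * (K * M.size i ^ (k + 1)) ^ 2 := by
  obtain ⟨C, hC, H⟩ := form_le_radau (a := a) (b := b) S
    (sqForm ((leval s).comp (derivative ^ m)))
  refine ⟨2 * C + 2, by positivity, fun M i K W hW => ?_⟩
  have h := H M i _ _ (interp_sub_taylor_natDegree S W i) (interp_sub_taylor_nodal S hW i)
  simp only [sqForm_apply, LinearMap.comp_apply, Module.End.pow_apply,
    leval_apply] at h
  rw [iterate_derivative_ref, eval_smul, ref_eval, smul_eq_mul, iterate_derivative_sub,
    eval_sub] at h
  have hsz := M.size_pos i
  obtain ⟨n, rfl⟩ : ∃ n, k = n + m := ⟨k - m, by lia⟩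
  rw [iterate_derivative_taylorPoly] at h
  set y := M.left i + s * M.size i with hy
  have hT := taylorPoly_error (n := n) (SmoothBound.iteratedDeriv (m := m)
    (by convert hW using 1; lia)) (M.left i) y
  have hyl : |y - M.left i| ≤ M.size i := by
    rw [hy, add_sub_cancel_left, abs_of_nonneg (mul_nonneg hs.1 hsz.le)]
    nlinarith [hs.2]
  have hT2 : (M.size i ^ m * (iteratedDeriv m W y -
      (taylorPoly (iteratedDeriv m W) n (M.left i)).eval y)) ^ 2 ≤
      (K * M.size i ^ (n + m + 1)) ^ 2 := by
    refine sq_le_sq.2 ?_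
    have hK := hW.nonneg
    rw [abs_mul, abs_of_nonneg (by positivity : 0 ≤ M.size i ^ m),
      abs_of_nonneg (by positivity : 0 ≤ K * M.size i ^ (n + m + 1))]
    calc _ ≤ M.size i ^ m * (K * M.size i ^ (n + 1)) := by
          refine mul_le_mul_of_nonneg_left (hT.trans ?_) (by positivity)
          exact mul_le_mul_of_nonneg_left (pow_le_pow_left₀ (abs_nonneg _) hyl _) hK
      _ = _ := by ring
  simp only [V.dval]
  set A := (derivative^[m] (interp M S W i : ℝ[X])).eval y
  set B := (taylorPoly (iteratedDeriv m W) n (M.left i)).eval y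
  set D := iteratedDeriv m W y
  set z := M.size i ^ m
  nlinarith [sq_nonneg (z * (A - B) + z * (D - B))]

/-- The constant does not depend on the point `s`, unlike the one from `functional_sq_le_l2`; this
yields the uniform bound in `interp_error`. -/
theorem eval_sq_le_coeff {n : ℕ} {p : ℝ[X]} (hp : p.natDegree ≤ n) {s : ℝ}
    (hs : s ∈ Set.Icc (0 : ℝ) 1) :
    p.eval s ^ 2 ≤ (n + 1) * ∑ j ∈ range (n + 1), p.coeff j ^ 2 := by
  rw [eval_eq_sum_range' (show p.natDegree < n + 1 by lia)]
  refine (sum_mul_sq_le_sq_mul_sq (range (n + 1)) _ _).trans ?_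
  rw [mul_comm]
  refine mul_le_mul_of_nonneg_right ?_ (by positivity)
  calc _ ≤ ∑ j ∈ range (n + 1), (1 : ℝ) := by
        refine sum_le_sum fun j _ => ?_
        rw [← pow_mul]
        exact pow_le_one₀ hs.1 hs.2
    _ = _ := by simp

theorem exists_ref_point (i : Fin M.N) {x : ℝ} (hx : x ∈ Set.Icc (M.left i) (M.right i)) :
    ∃ s ∈ Set.Icc (0 : ℝ) 1, x = M.left i + s * M.size i := by
  have hs := M.size_pos i
  refine ⟨(x - M.left i) / M.size i, ⟨div_nonneg (by linarith [hx.1]) hs.le, ?_⟩,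
    by field_simp; ring⟩
  rw [div_le_one hs]
  have := M.left_add_size i
  linarith [hx.2]

theorem interp_error (S : Subdivision k) :
    ∃ C : ℝ, 0 ≤ C ∧ ∀ (M : Mesh a b) (i : Fin M.N) (K : ℝ) (W : ℝ → ℝ), SmoothBound (k + 1) K W →
      ∀ x ∈ Set.Icc (M.left i) (M.right i),
        ((interp M S W).val i x - W x) ^ 2 ≤ C * (K * M.size i ^ (k + 1)) ^ 2 := by
  obtain ⟨C, hC, H⟩ := energy_interp_sub_taylor (a := a) (b := b) S
  obtain ⟨D, hD, HD⟩ := exists_coeff_sq_le k l2Form fun p _ hp => l2Form_pos hp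
  refine ⟨2 * ((k + 1) * (D * C)) + 2, by positivity, fun M i K W hW x hx => ?_⟩
  have hK := hW.nonneg
  have hsz := M.size_pos i
  obtain ⟨s, hs, rfl⟩ := exists_ref_point i hx
  set y := M.left i + s * M.size i with hy
  have hyl : |y - M.left i| ≤ M.size i := by
    rw [hy, add_sub_cancel_left, abs_of_nonneg (mul_nonneg hs.1 hsz.le)]
    nlinarith [hs.2]
  have hd := interp_sub_taylor_natDegree (M := M) S W i
  have h1 := eval_sq_le_coeff (M.ref_natDegree_le i hd) hs
  rw [ref_eval, eval_sub] at h1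
  have h2 := (HD _ (M.ref_natDegree_le i hd)).trans (mul_le_mul_of_nonneg_left (H M i K W hW) hD)
  have h3 : ((taylorPoly W k (M.left i)).eval y - W y) ^ 2 ≤ (K * M.size i ^ (k + 1)) ^ 2 := by
    refine sq_le_sq.2 ?_
    rw [abs_sub_comm, abs_of_nonneg (by positivity : 0 ≤ K * M.size i ^ (k + 1))]
    exact (taylorPoly_error hW _ _).trans
      (mul_le_mul_of_nonneg_left (pow_le_pow_left₀ (abs_nonneg _) hyl _) hK)
  have h4 := h1.trans (mul_le_mul_of_nonneg_left h2 (by positivity))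
  simp only [V.val]
  rw [← hy] at h4
  set A := (interp M S W i : ℝ[X]).eval y
  set B := (taylorPoly W k (M.left i)).eval y
  nlinarith [sq_nonneg ((A - B) - (B - W y))]

theorem energy_interp_le (S : Subdivision k) :
    ∃ C : ℝ, 0 ≤ C ∧ ∀ (M : Mesh a b) (i : Fin M.N) (A : ℝ) (W : ℝ → ℝ), (∀ x, |W x| ≤ A) →
      M.energy i (interp M S W i) ≤ C * A ^ 2 := by
  obtain ⟨C, hC, H⟩ := form_le_radau (a := a) (b := b) S l2Form
  refine ⟨C, hC, fun M i A W hW => H M i _ _ ((interp M S W).natDegree_le i) fun j => ?_⟩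
  rw [interp_eval]
  exact hW _

/-! ### Consistency of the spectral volume operator -/

/-- The right endpoint is an interpolation node, so the upwind trace at the left end of a cell is
exact as well, across the periodic boundary too. -/
theorem upVal_interp (S : Subdivision k) {W : ℝ → ℝ} (hper : ∀ x, W (x + (b - a)) = W x)
    (i : Fin M.N) : upVal S i (interp M S W) = fun j => W (cvPoint M S i j) := by
  have hlast : ∀ i, (interp M S W i : ℝ[X]).eval (M.right i) = W (M.right i) := by
    intro i
    have := interp_eval S W i (Fin.last k)
    rwa [Fin.succ_last, cvPoint_last] at this
  funext j
  simp only [upVal, LinearMap.coe_mk, AddHom.coe_mk]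
  induction j using Fin.cases with
  | zero =>
    rw [if_pos rfl, hlast, cvPoint_zero]
    have := M.left_next (M.prev i)
    rw [next_prev] at this
    rcases this with h | h
    · rw [h]
    · rw [h, ← hper (M.right (M.prev i) - (b - a))]; ring_nf
  | succ j => rw [if_neg (Fin.succ_ne_zero j), interp_eval]

/-- With exact upwind values, `svOp` returns `-β J'`, where `J` interpolates `W` at all `k + 2`
points. `J` differs from the Taylor polynomial of degree `k + 1` by `O(h^(k+2))` at the nodes, and
differentiation costs one power of `h`. The derivative of that Taylor polynomial is the Taylor
polynomial of `W'`, which is close to the interpolant of `W'`. -/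
theorem energy_consistency (S : Subdivision k) (β : ℝ) :
    ∃ C : ℝ, 0 ≤ C ∧ ∀ (M : Mesh a b) (i : Fin M.N) (K : ℝ) (W : ℝ → ℝ), SmoothBound (k + 2) K W →
      (∀ x, W (x + (b - a)) = W x) →
      M.energy i ((svOp M S β (interp M S W) + β • interp M S (deriv W) : M.V k) i) ≤
        C * (K * M.size i ^ (k + 1)) ^ 2 := by
  obtain ⟨C₁, h₁, H₁⟩ := energy_interp_sub_taylor (a := a) (b := b) S
  obtain ⟨C₂, h₂, H₂⟩ := energy_derivative_le (a := a) (b := b) S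
  refine ⟨β ^ 2 * (2 * (C₂ * (k + 2)) + 2 * C₁), by positivity, fun M i K W hW hper => ?_⟩
  have hsz := M.size_pos i
  have hK := hW.nonneg
  set J := fullInterp M S i fun j => W (cvPoint M S i j)
  have e : ((svOp M S β (interp M S W) + β • interp M S (deriv W) : M.V k) i : ℝ[X]) =
      (-β) • (derivative (J - taylorPoly W (k + 1) (M.left i)) -
        ((interp M S (deriv W) i : ℝ[X]) - taylorPoly (deriv W) k (M.left i))) := by
    rw [Pi.add_apply, Submodule.coe_add, svOp_coe, upVal_interp S hper, Pi.smul_apply,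
      Submodule.coe_smul, derivative_sub, derivative_taylorPoly]
    module
  rw [e, energy_smul, neg_sq, mul_assoc]
  refine mul_le_mul_of_nonneg_left ?_ (sq_nonneg β)
  refine (M.energy_sub_le i _ _).trans ?_
  have h1 := H₁ M i K _ hW.deriv
  have h2 := H₂ M i (J - taylorPoly W (k + 1) (M.left i))
    ((natDegree_sub_le_of_le (fullInterp_natDegree S i _) (taylorPoly_natDegree W (k + 1) _)).trans
      (max_self _).le)
  have h3 : ∑ j, (J - taylorPoly W (k + 1) (M.left i)).eval (cvPoint M S i j) ^ 2 ≤
      (k + 2) * (K * M.size i ^ (k + 2)) ^ 2 := by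
    calc _ ≤ ∑ j : Fin (k + 2), (K * M.size i ^ (k + 2)) ^ 2 := by
          refine sum_le_sum fun j _ => sq_le_sq.2 ?_
          rw [eval_sub, fullInterp_eval, abs_of_nonneg (by positivity : 0 ≤ K * M.size i ^ (k + 2))]
          refine (taylorPoly_error hW _ _).trans (mul_le_mul_of_nonneg_left ?_ hK)
          exact pow_le_pow_left₀ (abs_nonneg _) (cvPoint_sub_left S i _) _
      _ = _ := by simp
  have h4 : M.energy i (derivative (J - taylorPoly W (k + 1) (M.left i))) ≤
      C₂ * (k + 2) * (K * M.size i ^ (k + 1)) ^ 2 := by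
    have h5 := h2.trans (mul_le_mul_of_nonneg_left h3 h₂)
    have h6 : 0 < M.size i ^ 2 := by positivity
    refine le_of_mul_le_mul_left (h5.trans (le_of_eq ?_)) h6
    ring
  linarith

/-! ### Norms on `V^k` -/

theorem normSq_le_of_energy_le (v : M.V k) {A : ℝ} (h : ∀ i, M.energy i (v i) ≤ A) :
    v.normSq ≤ (b - a) * A := by
  rw [← M.sum_size, sum_mul]
  exact sum_le_sum fun i _ => mul_le_mul_of_nonneg_left (h i) (M.size_pos i).le

theorem normSq_sub_eq (v w : M.V k) :
    (v - w).normSq = ∑ i, ∫ x in (M.left i)..(M.right i), (v.val i x - w.val i x) ^ 2 := by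
  refine sum_congr rfl fun i _ => ?_
  rw [← integral_sq]
  simp [V.val]

theorem Mesh.V.val_continuous (v : M.V k) (i : Fin M.N) : Continuous (v.val i) :=
  (v i : ℝ[X]).continuous

theorem Mesh.V.l2dist_sq (v : M.V k) (f : ℝ → ℝ) :
    v.l2dist f ^ 2 = ∑ i, ∫ x in (M.left i)..(M.right i), (v.val i x - f x) ^ 2 := by
  refine Real.sq_sqrt (sum_nonneg fun i _ => ?_)
  exact intervalIntegral.integral_nonneg (by linarith [M.left_add_size i, M.size_pos i])
    fun _ _ => sq_nonneg _

theorem Mesh.left_le_right (M : Mesh a b) (i : Fin M.N) : M.left i ≤ M.right i := by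
  linarith [M.left_add_size i, M.size_pos i]

theorem integral_sq_triangle {f g e : ℝ → ℝ} (hf : Continuous f) (hg : Continuous g)
    (he : Continuous e) {x y : ℝ} (hxy : x ≤ y) :
    ∫ t in x..y, (f t - e t) ^ 2 ≤
      2 * (∫ t in x..y, (f t - g t) ^ 2) + 2 * ∫ t in x..y, (g t - e t) ^ 2 := by
  rw [← intervalIntegral.integral_const_mul, ← intervalIntegral.integral_const_mul,
    ← intervalIntegral.integral_add
      (Continuous.intervalIntegrable (by fun_prop) _ _)
      (Continuous.intervalIntegrable (by fun_prop) _ _)]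
  refine intervalIntegral.integral_mono_on hxy (Continuous.intervalIntegrable (by fun_prop) _ _)
    (Continuous.intervalIntegrable (by fun_prop) _ _) fun t _ => ?_
  nlinarith [sq_nonneg ((f t - g t) - (g t - e t))]

theorem l2dist_sq_le (v w : M.V k) {f : ℝ → ℝ} (hf : Continuous f) :
    v.l2dist f ^ 2 ≤ 2 * (v - w).normSq + 2 * w.l2dist f ^ 2 := by
  rw [V.l2dist_sq, V.l2dist_sq, normSq_sub_eq, mul_sum, mul_sum, ← sum_add_distrib]
  exact sum_le_sum fun i _ => integral_sq_triangle (v.val_continuous i) (w.val_continuous i) hf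
    (M.left_le_right i)

theorem normSq_sub_le (v w : M.V k) {f : ℝ → ℝ} (hf : Continuous f) :
    (v - w).normSq ≤ 2 * v.l2dist f ^ 2 + 2 * w.l2dist f ^ 2 := by
  rw [V.l2dist_sq, V.l2dist_sq, normSq_sub_eq, mul_sum, mul_sum, ← sum_add_distrib]
  refine sum_le_sum fun i _ => ?_
  have := integral_sq_triangle (v.val_continuous i) hf (w.val_continuous i) (M.left_le_right i)
  refine this.trans (le_of_eq ?_)
  congr 3
  funext t
  ring

theorem integral_le_of_le_const {f : ℝ → ℝ} (hf : Continuous f) {A : ℝ} (i : Fin M.N)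
    (h : ∀ x ∈ Set.Icc (M.left i) (M.right i), f x ≤ A) :
    ∫ x in (M.left i)..(M.right i), f x ≤ M.size i * A := by
  have := intervalIntegral.integral_mono_on (M.left_le_right i) (hf.intervalIntegrable _ _)
    (intervalIntegrable_const (μ := MeasureTheory.volume) (c := A)) h
  rwa [intervalIntegral.integral_const, smul_eq_mul] at this

theorem l2dist_interp_sq (hab : a < b) (S : Subdivision k) :
    ∃ C : ℝ, 0 ≤ C ∧ ∀ (M : Mesh a b) (K : ℝ) (W : ℝ → ℝ), SmoothBound (k + 1) K W →
      (interp M S W).l2dist W ^ 2 ≤ C * (K * M.h ^ (k + 1)) ^ 2 := by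
  obtain ⟨C, hC, H⟩ := interp_error (a := a) (b := b) S
  refine ⟨(b - a) * C, mul_nonneg (by linarith) hC, fun M K W hW => ?_⟩
  rw [V.l2dist_sq, ← M.sum_size, mul_assoc, sum_mul]
  refine sum_le_sum fun i _ => integral_le_of_le_const ?_ i fun x hx => (H M i K W hW x hx).trans ?_
  · have := (interp M S W).val_continuous i
    have := hW.contDiff.continuous
    fun_prop
  · have := hW.nonneg
    have := M.size_le_h i
    have := (M.size_pos i).le
    gcongr

/-! ### The oscillation-eliminating procedure -/

/-- Here `f τ = exp(-lτ) f 0`, because `exp(lt) f t` has zero derivative; then `1 - exp(-x) ≤ x`. -/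
theorem abs_sub_le_of_decay {f : ℝ → ℝ} {l τ : ℝ} (hl : 0 ≤ l) (hτ : 0 ≤ τ)
    (hf : ∀ t ∈ Set.Icc 0 τ, HasDerivWithinAt f (-(l * f t)) (Set.Icc 0 τ) t) :
    |f τ - f 0| ≤ l * τ * |f 0| := by
  have hg : ∀ t ∈ Set.Icc 0 τ,
      HasDerivWithinAt (fun t => Real.exp (l * t) * f t) 0 (Set.Icc 0 τ) t := by
    intro t ht
    have h1 : HasDerivWithinAt (fun t => Real.exp (l * t)) (Real.exp (l * t) * l)
        (Set.Icc 0 τ) t := by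
      have := ((hasDerivAt_id t).const_mul l).exp
      simpa using this.hasDerivWithinAt
    refine (h1.mul (hf t ht)).congr_deriv ?_
    ring
  have hc := (convex_Icc 0 τ).norm_image_sub_le_of_norm_hasDerivWithin_le hg (C := 0)
    (fun _ _ => by simp) (Set.left_mem_Icc.2 hτ) (Set.right_mem_Icc.2 hτ)
  simp only [zero_mul, norm_le_zero_iff, mul_zero, Real.exp_zero, one_mul, sub_eq_zero] at hc
  have h2 : f τ = Real.exp (-(l * τ)) * f 0 := by
    rw [← hc, ← mul_assoc, ← Real.exp_add]; simp
  have h3 : f τ - f 0 = (Real.exp (-(l * τ)) - 1) * f 0 := by rw [h2]; ring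
  rw [h3, abs_mul]
  refine mul_le_mul_of_nonneg_right ?_ (abs_nonneg _)
  have h4 := Real.add_one_le_exp (-(l * τ))
  have h5 : Real.exp (-(l * τ)) ≤ 1 := Real.exp_le_one_iff.2 (by nlinarith [mul_nonneg hl hτ])
  rw [abs_of_nonpos (by linarith)]
  linarith

variable {a b : ℝ} {k : ℕ} {M : Mesh a b}

theorem integral_mul_ref (i : Fin M.N) (p φ : ℝ[X]) :
    ∫ x in (M.left i)..(M.right i), p.eval x * φ.eval x =
      M.size i * polyInt 0 1 (M.ref i p * M.ref i φ) := by
  rw [← ref_mul, ← polyInt_cell, polyInt_apply]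
  simp

/-- The Legendre polynomial transported to a cell. -/
def cellLegendre (M : Mesh a b) (i : Fin M.N) (n : ℕ) : ℝ[X] :=
  (legendre n).comp (C (M.size i)⁻¹ * (X - C (M.left i)))

theorem ref_cellLegendre (i : Fin M.N) (n : ℕ) : M.ref i (cellLegendre M i n) = legendre n := by
  rw [ref_eq_comp, cellLegendre, comp_assoc]
  have h := (M.size_pos i).ne'
  have : (C (M.size i)⁻¹ * (X - C (M.left i))).comp (C (M.size i) * X + C (M.left i)) =
      (X : ℝ[X]) := by
    simp only [mul_comp, C_comp, sub_comp, X_comp, add_sub_cancel_right]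
    rw [← mul_assoc, ← C_mul, inv_mul_cancel₀ h, C_1, one_mul]
  rw [this, comp_X]

theorem cellLegendre_natDegree (i : Fin M.N) (n : ℕ) : (cellLegendre M i n).natDegree ≤ n := by
  refine natDegree_comp_le.trans ?_
  rw [natDegree_legendre]
  calc _ ≤ n * 1 := Nat.mul_le_mul_left _ (by compute_degree)
    _ = n := mul_one n

/-- Removing the projection onto degree `m` deletes the Legendre moments up to `m` and leaves the
higher ones untouched. -/
theorem integral_sub_proj (i : Fin M.N) {m n : ℕ} {p q : ℝ[X]} (h : IsL2Proj M i m p q) :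
    ∫ x in (M.left i)..(M.right i), (p.eval x - q.eval x) * (cellLegendre M i n).eval x =
      (if n ≤ m then 0 else 1) *
        ∫ x in (M.left i)..(M.right i), p.eval x * (cellLegendre M i n).eval x := by
  split_ifs with hn
  · rw [zero_mul]
    refine h.2 _ (natDegree_le_iff_degree_le.1 ((cellLegendre_natDegree i n).trans hn))
  · have hq := M.ref_natDegree_le i (natDegree_le_iff_degree_le.2 h.1)
    have e := integral_mul_ref i (p - q) (cellLegendre M i n)
    simp only [eval_sub] at e
    rw [e, one_mul, integral_mul_ref, map_sub, sub_mul, map_sub, ref_cellLegendre,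
      mul_comm (M.ref i q), legendre_orthogonal (by lia), sub_zero]

theorem Mesh.V.supDev_nonneg (v : M.V k) : 0 ≤ v.supDev :=
  Real.iSup_nonneg fun _ => Real.iSup_nonneg fun _ => abs_nonneg _

theorem two_mul_sub_one_pos (hk : 1 ≤ k) : 0 < 2 * (k : ℝ) - 1 := by
  have : (1 : ℝ) ≤ k := by exact_mod_cast hk
  linarith

theorem sigma_nonneg (hk : 1 ≤ k) (m : ℕ) (v : M.V k) (i : Fin M.N) (J : ℝ) :
    0 ≤ sigma m v i J := by
  unfold sigma
  split_ifs
  · exact le_rfl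
  · have h1 := two_mul_sub_one_pos hk
    have h2 := M.size_pos i
    have h3 := v.supDev_nonneg
    positivity

theorem delta_nonneg (hk : 1 ≤ k) (β : ℝ) (m : ℕ) (v : M.V k) (i : Fin M.N) :
    0 ≤ delta β m v i := by
  have h1 := sigma_nonneg hk m v i (v.jump m (M.prev i))
  have h2 := sigma_nonneg hk m v i (v.jump m i)
  have h3 := M.size_pos i
  unfold delta
  positivity

/-- The total damping coefficient of a cell. -/
def totalDelta (β : ℝ) (v : M.V k) (i : Fin M.N) : ℝ := ∑ m ∈ range (k + 1), delta β m v i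

theorem totalDelta_nonneg (hk : 1 ≤ k) (β : ℝ) (v : M.V k) (i : Fin M.N) :
    0 ≤ totalDelta β v i := sum_nonneg fun m _ => delta_nonneg hk β m v i

/-- The damping system decouples: each Legendre moment solves a scalar decay equation whose rate is
at most the total damping coefficient. Since moment `0` is conserved, a constant `c` may be
subtracted on the right. -/
theorem filter_moment_le (hk : 1 ≤ k) {β τ : ℝ} (hτ : 0 ≤ τ) {v z : M.V k}
    (h : IsOEFilter β τ v z) (i : Fin M.N) (c : ℝ) {n : ℕ} (hn : n ≤ k) :
    |polyInt 0 1 (legendre n * M.ref i ((z i : ℝ[X]) - v i))| ≤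
      τ * totalDelta β v i * |polyInt 0 1 (legendre n * M.ref i ((v i : ℝ[X]) - C c))| := by
  obtain ⟨y, q, rfl, rfl, hq, hy⟩ := h
  -- The decay rate of moment `n`. Truncated subtraction gives `0 - 1 = 0`, which is the convention
  -- `P^{-1} = P^0`; hence every term vanishes for `n = 0`.
  set l := ∑ m ∈ range (k + 1), delta β m (y 0) i * (if n ≤ m - 1 then 0 else 1)
  have hl0 : 0 ≤ l := sum_nonneg fun m _ => mul_nonneg (delta_nonneg hk β m _ i)
    (by split_ifs <;> norm_num)
  have hl1 : l ≤ totalDelta β (y 0) i := sum_le_sum fun m _ =>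
    mul_le_of_le_one_right (delta_nonneg hk β m _ i) (by split_ifs <;> norm_num)
  have hd := abs_sub_le_of_decay (f := fun t => ∫ x in (M.left i)..(M.right i),
    (y t).val i x * (cellLegendre M i n).eval x) hl0 hτ fun t ht => by
      refine (hy t ht i (cellLegendre M i n) (natDegree_le_iff_degree_le.1
        ((cellLegendre_natDegree i n).trans hn))).congr_deriv ?_
      rw [sum_mul]
      congr 1
      refine sum_congr rfl fun m hm => ?_
      rw [mul_assoc]
      congr 1
      exact integral_sub_proj i (hq m (Nat.lt_succ_iff.1 (mem_range.1 hm)) t ht i)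
  simp only [V.val, integral_mul_ref, ref_cellLegendre] at hd
  have hs := M.size_pos i
  rw [← mul_sub, abs_mul, abs_mul, abs_of_pos hs, mul_left_comm] at hd
  have hd' := le_of_mul_le_mul_left hd hs
  have e1 : polyInt 0 1 (legendre n * M.ref i ((y τ i : ℝ[X]) - y 0 i)) =
      polyInt 0 1 (M.ref i (y τ i) * legendre n) - polyInt 0 1 (M.ref i (y 0 i) * legendre n) := by
    rw [map_sub, mul_sub, map_sub, mul_comm, mul_comm (legendre n)]
  rw [e1]
  refine hd'.trans ?_
  rcases Nat.eq_zero_or_pos n with h0 | h0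
  · have : l = 0 := sum_eq_zero fun m _ => by simp [h0]
    rw [this, zero_mul, zero_mul]
    exact mul_nonneg (mul_nonneg hτ (totalDelta_nonneg hk β _ i)) (abs_nonneg _)
  · have e2 : polyInt 0 1 (legendre n * M.ref i ((y 0 i : ℝ[X]) - C c)) =
        polyInt 0 1 (M.ref i (y 0 i) * legendre n) := by
      rw [map_sub, mul_sub, map_sub, mul_comm (legendre n) (M.ref i (y 0 i)),
        legendre_orthogonal (φ := M.ref i (C c))
          ((M.ref_natDegree_le i (natDegree_C c).le).trans_lt h0), sub_zero]
    rw [e2, mul_comm l τ]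
    gcongr

theorem filter_energy_le (hk : 1 ≤ k) :
    ∃ C : ℝ, 0 ≤ C ∧ ∀ (M : Mesh a b) (β τ : ℝ) (v z : M.V k), 0 ≤ τ → IsOEFilter β τ v z →
      ∀ (i : Fin M.N) (c : ℝ), M.energy i ((z i : ℝ[X]) - v i) ≤
        C * (τ * totalDelta β v i) ^ 2 * M.energy i ((v i : ℝ[X]) - Polynomial.C c) := by
  obtain ⟨C, hC, H⟩ := l2_le_moments k
  choose D hD0 hD using fun n : ℕ => functional_sq_le_l2 k
    ((polyInt 0 1).comp (LinearMap.mulLeft ℝ (legendre n)))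
  have hD1 := sum_nonneg fun n (_ : n ∈ (univ : Finset (Fin (k + 1)))) => hD0 n
  refine ⟨C * ∑ n : Fin (k + 1), D n, by positivity, fun M β τ v z hτ h i c => ?_⟩
  have hdz : ((z i : ℝ[X]) - v i).natDegree ≤ k :=
    (natDegree_sub_le_of_le (z.natDegree_le i) (v.natDegree_le i)).trans (max_self k).le
  have hdv : ((v i : ℝ[X]) - Polynomial.C c).natDegree ≤ k := by
    rw [natDegree_sub_C]; exact v.natDegree_le i
  refine (H _ (M.ref_natDegree_le i hdz)).trans ?_
  rw [mul_assoc C, mul_assoc C]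
  refine mul_le_mul_of_nonneg_left ?_ hC
  rw [sum_mul, sum_mul]
  refine sum_le_sum fun n _ => ?_
  have h1 := filter_moment_le hk hτ h i c (Nat.lt_succ_iff.1 n.2)
  have h2 := hD n _ (M.ref_natDegree_le i hdv)
  simp only [LinearMap.comp_apply, LinearMap.mulLeft_apply] at h2
  calc _ ≤ (τ * totalDelta β v i *
        |polyInt 0 1 (legendre n * M.ref i ((v i : ℝ[X]) - Polynomial.C c))|) ^ 2 := by
        rw [← sq_abs]
        exact pow_le_pow_left₀ (abs_nonneg _) h1 2
    _ = (τ * totalDelta β v i) ^ 2 *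
        polyInt 0 1 (legendre n * M.ref i ((v i : ℝ[X]) - Polynomial.C c)) ^ 2 := by
        rw [mul_pow, sq_abs]
    _ ≤ (τ * totalDelta β v i) ^ 2 * (D n * M.energy i ((v i : ℝ[X]) - Polynomial.C c)) :=
        mul_le_mul_of_nonneg_left h2 (sq_nonneg _)
    _ = _ := by ring

variable {a b : ℝ} {k : ℕ} {M : Mesh a b}

/-! ### Lower bound of the deviation from the average -/

theorem Mesh.V.abs_sub_avg_le_supDev (v : M.V k) (i : Fin M.N) {x : ℝ}
    (hx : x ∈ Set.Icc (M.left i) (M.right i)) : |v.val i x - v.avg| ≤ v.supDev := by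
  have hb : BddAbove (Set.range fun x : Set.Icc (M.left i) (M.right i) => |v.val i x - v.avg|) := by
    have : Continuous fun x => |v.val i x - v.avg| := by
      have := v.val_continuous i
      fun_prop
    have h := (isCompact_Icc (a := M.left i) (b := M.right i)).bddAbove_image this.continuousOn
    refine h.mono ?_
    rintro _ ⟨x, rfl⟩
    exact ⟨x, x.2, rfl⟩
  exact (le_ciSup hb ⟨x, hx⟩).trans (le_ciSup (f := fun i =>
    ⨆ x : Set.Icc (M.left i) (M.right i), |v.val i x - v.avg|) (Set.finite_range _).bddAbove i)

/-- The constant `avg v` is one of the competitors `c`, so `A` is at most `2 ‖f - v‖² + 2 ‖v - avg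
v‖²`, and the first term takes at most half of `A`. -/
theorem supDev_sq_ge (v : M.V k) {f : ℝ → ℝ} (hf : Continuous f) {A : ℝ}
    (hA : ∀ c, A ≤ ∫ x in a..b, (f x - c) ^ 2) (hv : v.l2dist f ^ 2 ≤ A / 4) :
    A / 4 ≤ (b - a) * v.supDev ^ 2 := by
  have h1 : ∫ x in a..b, (f x - v.avg) ^ 2 ≤ 2 * v.l2dist f ^ 2 + 2 * ((b - a) * v.supDev ^ 2) := by
    rw [← M.sum_integral (by fun_prop), V.l2dist_sq, ← M.sum_size, sum_mul, mul_sum, mul_sum,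
      ← sum_add_distrib]
    refine sum_le_sum fun i _ => ?_
    have h2 := integral_sq_triangle hf (v.val_continuous i) (continuous_const (y := v.avg))
      (M.left_le_right i)
    have h3 : ∫ x in (M.left i)..(M.right i), (v.val i x - v.avg) ^ 2 ≤
        M.size i * v.supDev ^ 2 := by
      refine integral_le_of_le_const ?_ i fun x hx => ?_
      · have := v.val_continuous i
        fun_prop
      · rw [← sq_abs]
        exact pow_le_pow_left₀ (abs_nonneg _) (v.abs_sub_avg_le_supDev i hx) 2
    have h4 : ∫ x in (M.left i)..(M.right i), (f x - v.val i x) ^ 2 =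
        ∫ x in (M.left i)..(M.right i), (v.val i x - f x) ^ 2 := by
      congr 1; funext x; ring
    rw [h4] at h2
    linarith
  have := hA v.avg
  linarith

/-! ### Bounds of jumps and damping coefficients -/

theorem iteratedDeriv_periodic {W : ℝ → ℝ} {p : ℝ} (h : ∀ x, W (x + p) = W x) (m : ℕ) (x : ℝ) :
    iteratedDeriv m W (x + p) = iteratedDeriv m W x := by
  have := congrFun (iteratedDeriv_comp_add_const (n := m) (f := W) (s := p)) x
  rw [← this]
  congr 1
  funext y
  exact h y

theorem trace_error (S : Subdivision k) (m : ℕ) (hm : m ≤ k) (s : ℝ)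
    (hs : s ∈ Set.Icc (0 : ℝ) 1) :
    ∃ C : ℝ, 0 ≤ C ∧ ∀ (M : Mesh a b) (i : Fin M.N) (K : ℝ) (W : ℝ → ℝ) (v : M.V k),
      SmoothBound (k + 1) K W →
      (M.size i ^ m * (v.dval m i (M.left i + s * M.size i) -
        iteratedDeriv m W (M.left i + s * M.size i))) ^ 2 ≤
        C * ((K * M.size i ^ (k + 1)) ^ 2 + M.energy i ((v - interp M S W : M.V k) i)) := by
  obtain ⟨C₁, h₁, H₁⟩ := interp_deriv_error (a := a) (b := b) S m hm s hs
  obtain ⟨C₂, h₂, H₂⟩ := functional_sq_le_l2 k ((leval s).comp (derivative ^ m))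
  refine ⟨2 * C₁ + 2 * C₂, by positivity, fun M i K W v hW => ?_⟩
  have h3 := H₁ M i K W hW
  have h4 := H₂ _ (M.ref_natDegree_le i ((v - interp M S W : M.V k).natDegree_le i))
  simp only [LinearMap.comp_apply, Module.End.pow_apply, leval_apply] at h4
  rw [iterate_derivative_ref, eval_smul, ref_eval, smul_eq_mul, Pi.sub_apply, Submodule.coe_sub,
    iterate_derivative_sub, eval_sub] at h4
  have he := M.energy_nonneg i ((v - interp M S W : M.V k) i)
  rw [Pi.sub_apply, Submodule.coe_sub] at he ⊢
  simp only [V.dval] at *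
  unfold energy at *
  set y := M.left i + s * M.size i
  set A := (derivative^[m] (v i : ℝ[X])).eval y
  set B := (derivative^[m] (interp M S W i : ℝ[X])).eval y
  set D := iteratedDeriv m W y
  set z := M.size i ^ m
  set E := l2Form (M.ref i ((v i : ℝ[X]) - interp M S W i))
    (M.ref i ((v i : ℝ[X]) - interp M S W i))
  have e : (z * (A - D)) ^ 2 ≤ 2 * (z * (A - B)) ^ 2 + 2 * (z * (B - D)) ^ 2 := by
    nlinarith [sq_nonneg (z * (A - B) - z * (B - D))]
  have h5 : 0 ≤ C₁ * E := mul_nonneg h₁ he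
  have h6 : 0 ≤ C₂ * (K * M.size i ^ (k + 1)) ^ 2 := by positivity
  linarith

/-- The derivatives of a smooth periodic `W` match across each interface, so the jump of `v` is the
difference of two one-sided traces of `v - W`. -/
theorem jump_error (hab : a < b) (S : Subdivision k) (ρ : ℝ) (m : ℕ) (hm : m ≤ k) :
    ∃ C : ℝ, 0 ≤ C ∧ ∀ (M : Mesh a b), M.QuasiUniform ρ → ∀ (i : Fin M.N) (K : ℝ) (W : ℝ → ℝ)
      (v : M.V k), SmoothBound (k + 1) K W → (∀ x, W (x + (b - a)) = W x) →
      (M.h ^ m * v.jump m i) ^ 2 ≤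
        C * ((K * M.h ^ (k + 1)) ^ 2 + M.energy i ((v - interp M S W : M.V k) i) +
          M.energy (M.next i) ((v - interp M S W : M.V k) (M.next i))) := by
  obtain ⟨C₀, h₀, H₀⟩ := trace_error (a := a) (b := b) S m hm 0 (by simp)
  obtain ⟨C₁, h₁, H₁⟩ := trace_error (a := a) (b := b) S m hm 1 (by simp)
  refine ⟨(ρ ^ m) ^ 2 * (2 * C₀ + 2 * C₁), by positivity, fun M hM i K W v hW hper => ?_⟩
  have hρ := M.one_le_of_quasiUniform hab hM
  have hh := M.h_pos hab
  have hK := hW.nonneg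
  have h2 := H₀ M (M.next i) K W v hW
  have h3 := H₁ M i K W v hW
  rw [zero_mul, add_zero] at h2
  rw [one_mul, left_add_size] at h3
  have hp : iteratedDeriv m W (M.left (M.next i)) = iteratedDeriv m W (M.right i) := by
    rcases M.left_next i with h | h
    · rw [h]
    · rw [h, ← iteratedDeriv_periodic hper m (M.right i - (b - a))]; ring_nf
  rw [hp] at h2
  have hscale : ∀ (j : Fin M.N) (x : ℝ),
      (M.h ^ m * x) ^ 2 ≤ (ρ ^ m) ^ 2 * (M.size j ^ m * x) ^ 2 := by
    intro j x
    have : M.h ^ m ≤ ρ ^ m * M.size j ^ m := by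
      rw [← mul_pow]; exact pow_le_pow_left₀ hh.le (hM j) m
    calc _ = (M.h ^ m) ^ 2 * x ^ 2 := by ring
      _ ≤ (ρ ^ m * M.size j ^ m) ^ 2 * x ^ 2 := by gcongr
      _ = _ := by ring
  have hK2 : ∀ j : Fin M.N, (K * M.size j ^ (k + 1)) ^ 2 ≤ (K * M.h ^ (k + 1)) ^ 2 := by
    intro j
    have := M.size_le_h j
    have := (M.size_pos j).le
    gcongr
  have e1 := M.energy_nonneg i ((v - interp M S W : M.V k) i)
  have e2 := M.energy_nonneg (M.next i) ((v - interp M S W : M.V k) (M.next i))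
  set E₁ := M.energy i ((v - interp M S W : M.V k) i)
  set E₂ := M.energy (M.next i) ((v - interp M S W : M.V k) (M.next i))
  set x₂ := v.dval m (M.next i) (M.left (M.next i)) - iteratedDeriv m W (M.right i) with hx2
  set x₁ := v.dval m i (M.right i) - iteratedDeriv m W (M.right i) with hx1
  have hj : v.jump m i = x₂ - x₁ := by rw [hx2, hx1, V.jump]; ring
  have h4 := (hscale (M.next i) x₂).trans (mul_le_mul_of_nonneg_left
    (h2.trans (mul_le_mul_of_nonneg_left (add_le_add_left (hK2 _) _) h₀)) (by positivity))
  have h5 := (hscale i x₁).trans (mul_le_mul_of_nonneg_left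
    (h3.trans (mul_le_mul_of_nonneg_left (add_le_add_left (hK2 _) _) h₁)) (by positivity))
  rw [hj]
  have h6 : (M.h ^ m * (x₂ - x₁)) ^ 2 ≤ 2 * (M.h ^ m * x₂) ^ 2 + 2 * (M.h ^ m * x₁) ^ 2 := by
    nlinarith [sq_nonneg (M.h ^ m * x₂ + M.h ^ m * x₁)]
  have hr : 0 ≤ (ρ ^ m) ^ 2 := by positivity
  have h7 : 0 ≤ (ρ ^ m) ^ 2 * (C₀ * E₁) := by positivity
  have h8 : 0 ≤ (ρ ^ m) ^ 2 * (C₁ * E₂) := by positivity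
  have h9 : 0 ≤ (ρ ^ m) ^ 2 * (C₁ * (K * M.h ^ (k + 1)) ^ 2) := by positivity
  nlinarith

theorem sigma_le (hk : 1 ≤ k) {m : ℕ} (hm : m ≤ k) (v : M.V k) (i : Fin M.N) (J : ℝ) {c : ℝ}
    (hc : 0 < c) (hv : c ≤ v.supDev) : sigma m v i J ≤ (2 * k + 1) / c * (M.h ^ m * |J|) := by
  have hs := M.size_pos i
  have hh : 0 ≤ M.h := hs.le.trans (M.size_le_h i)
  have h1 := two_mul_sub_one_pos hk
  have hk' : (1 : ℝ) ≤ k := by exact_mod_cast hk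
  have hm' : (m : ℝ) ≤ k := by exact_mod_cast hm
  have hf : (1 : ℝ) ≤ m.factorial := by exact_mod_cast Nat.one_le_iff_ne_zero.2 m.factorial_ne_zero
  unfold sigma
  split_ifs
  · positivity
  · have hden : 1 ≤ 2 * (2 * (k : ℝ) - 1) * m.factorial := by
      nlinarith
    calc _ ≤ (2 * (k : ℝ) + 1) * M.h ^ m / 1 * (|J| / c) := by
          have := M.size_le_h i
          have : 0 ≤ |J| / v.supDev := div_nonneg (abs_nonneg _) v.supDev_nonneg
          gcongr
      _ = _ := by field_simp

theorem totalDelta_sq_le (hab : a < b) (hk : 1 ≤ k) (S : Subdivision k) (β ρ K c : ℝ)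
    (hc : 0 < c) :
    ∃ C : ℝ, 0 ≤ C ∧ ∀ (M : Mesh a b), M.QuasiUniform ρ → ∀ (W : ℝ → ℝ)
      (v : M.V k), SmoothBound (k + 1) K W → (∀ x, W (x + (b - a)) = W x) → c ≤ v.supDev →
      ∀ i, (M.h * totalDelta β v i) ^ 2 ≤ C * ((M.h ^ (k + 1)) ^ 2 +
          M.energy (M.prev i) ((v - interp M S W : M.V k) (M.prev i)) +
          M.energy i ((v - interp M S W : M.V k) i) +
          M.energy (M.next i) ((v - interp M S W : M.V k) (M.next i))) := by
  -- The case `m > k` is filled with the constant `0`, so that the constants form a function on all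
  -- of `ℕ`.
  have hj : ∀ m, ∃ C : ℝ, 0 ≤ C ∧ (m ≤ k → ∀ (M : Mesh a b), M.QuasiUniform ρ →
      ∀ (i : Fin M.N) (K : ℝ) (W : ℝ → ℝ)
      (v : M.V k), SmoothBound (k + 1) K W → (∀ x, W (x + (b - a)) = W x) →
      (M.h ^ m * v.jump m i) ^ 2 ≤
        C * ((K * M.h ^ (k + 1)) ^ 2 + M.energy i ((v - interp M S W : M.V k) i) +
          M.energy (M.next i) ((v - interp M S W : M.V k) (M.next i)))) := by
    intro m
    by_cases hm : m ≤ k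
    · obtain ⟨C, hC, H⟩ := jump_error hab S ρ m hm
      exact ⟨C, hC, fun _ => H⟩
    · exact ⟨0, le_rfl, fun h => absurd h hm⟩
  choose D hD0 hD using hj
  have hDs := sum_nonneg fun m (_ : m ∈ range (k + 1)) => hD0 m
  set G := |β| * ρ * ((2 * k + 1) / c)
  refine ⟨(k + 1) * (G ^ 2 * (4 * ((∑ m ∈ range (k + 1), D m) * (K ^ 2 + 1)))), by positivity,
    fun M hM W v hW hper hv i => ?_⟩
  have hρ := M.one_le_of_quasiUniform hab hM
  have hh := M.h_pos hab
  have hs := M.size_pos i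
  have hk' : (1 : ℝ) ≤ k := by exact_mod_cast hk
  have e0 := M.energy_nonneg (M.prev i) ((v - interp M S W : M.V k) (M.prev i))
  have e1 := M.energy_nonneg i ((v - interp M S W : M.V k) i)
  have e2 := M.energy_nonneg (M.next i) ((v - interp M S W : M.V k) (M.next i))
  set Y := (M.h ^ (k + 1)) ^ 2 +
          M.energy (M.prev i) ((v - interp M S W : M.V k) (M.prev i)) +
          M.energy i ((v - interp M S W : M.V k) i) +
          M.energy (M.next i) ((v - interp M S W : M.V k) (M.next i)) with hY
  have hY0 : 0 ≤ Y := by positivity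
  have hm : ∀ m ∈ range (k + 1), (M.h * delta β m v i) ^ 2 ≤
      G ^ 2 * (4 * (D m * ((K ^ 2 + 1) * Y))) := by
    intro m hm
    have hmk := Nat.lt_succ_iff.1 (mem_range.1 hm)
    have j1 := hD m hmk M hM (M.prev i) K W v hW hper
    have j2 := hD m hmk M hM i K W v hW hper
    rw [next_prev] at j1
    have s1 := sigma_le hk hmk v i (v.jump m (M.prev i)) hc hv
    have s2 := sigma_le hk hmk v i (v.jump m i) hc hv
    have d0 := delta_nonneg hk β m v i
    have hle : M.h * delta β m v i ≤
        G * (M.h ^ m * |v.jump m (M.prev i)| + M.h ^ m * |v.jump m i|) := by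
      have : M.h / M.size i ≤ ρ := (div_le_iff₀ hs).2 (hM i)
      calc M.h * delta β m v i = |β| * (M.h / M.size i) *
            (sigma m v i (v.jump m (M.prev i)) + sigma m v i (v.jump m i)) := by
            unfold delta; field_simp
        _ ≤ |β| * ρ * ((2 * k + 1) / c * (M.h ^ m * |v.jump m (M.prev i)|) +
            (2 * k + 1) / c * (M.h ^ m * |v.jump m i|)) := by
            have := sigma_nonneg hk m v i (v.jump m (M.prev i))
            have := sigma_nonneg hk m v i (v.jump m i)
            gcongr
        _ = _ := by ring
    have hsq := pow_le_pow_left₀ (mul_nonneg hh.le d0) hle 2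
    refine hsq.trans ?_
    rw [mul_pow]
    refine mul_le_mul_of_nonneg_left ?_ (sq_nonneg _)
    have hb : ∀ x : ℝ, (M.h ^ m * |x|) ^ 2 = (M.h ^ m * x) ^ 2 := fun x => by
      rw [mul_pow, sq_abs, mul_pow]
    have hYle : (K * M.h ^ (k + 1)) ^ 2 +
        M.energy (M.prev i) ((v - interp M S W : M.V k) (M.prev i)) +
        M.energy i ((v - interp M S W : M.V k) i) ≤ (K ^ 2 + 1) * Y := by
      rw [hY]
      nlinarith [mul_nonneg (sq_nonneg K) e0, mul_nonneg (sq_nonneg K) e1,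
        mul_nonneg (sq_nonneg K) e2, sq_nonneg (M.h ^ (k + 1))]
    have hYle2 : (K * M.h ^ (k + 1)) ^ 2 + M.energy i ((v - interp M S W : M.V k) i) +
        M.energy (M.next i) ((v - interp M S W : M.V k) (M.next i)) ≤ (K ^ 2 + 1) * Y := by
      rw [hY]
      nlinarith [mul_nonneg (sq_nonneg K) e0, mul_nonneg (sq_nonneg K) e1,
        mul_nonneg (sq_nonneg K) e2, sq_nonneg (M.h ^ (k + 1))]
    have j1' := j1.trans (mul_le_mul_of_nonneg_left hYle (hD0 m))
    have j2' := j2.trans (mul_le_mul_of_nonneg_left hYle2 (hD0 m))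
    rw [← hb] at j1' j2'
    nlinarith [sq_nonneg (M.h ^ m * |v.jump m (M.prev i)| - M.h ^ m * |v.jump m i|)]
  rw [totalDelta, mul_sum]
  refine sq_sum_le_card_mul_sum_sq.trans ?_
  rw [card_range, Nat.cast_add_one]
  refine (mul_le_mul_of_nonneg_left (sum_le_sum hm) (by positivity)).trans (le_of_eq ?_)
  rw [← mul_sum, ← mul_sum, ← sum_mul]
  ring

/-- The change made by the filter is bounded by `τ δ` times the distance of `v` to a constant. The
threshold `h^3` makes that distance `O(h)`, while `h δ` is bounded by `h^(k+1)` plus the error on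
the cell and its two neighbours. The powers of `h` cancel, and summing over cells gives the square
of `τ` times the error. -/
theorem filter_normSq_le (hab : a < b) (hk : 1 ≤ k) (S : Subdivision k) (β ρ K c : ℝ)
    (hc : 0 < c) :
    ∃ C : ℝ, 0 ≤ C ∧ ∀ (M : Mesh a b), M.QuasiUniform ρ → ∀ (τ : ℝ) (W : ℝ → ℝ)
      (v z : M.V k), 0 ≤ τ → SmoothBound (k + 1) K W → (∀ x, W (x + (b - a)) = W x) →
      c ≤ v.supDev → IsOEFilter β τ v z → (v - interp M S W : M.V k).normSq ≤ M.h ^ 3 →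
      (z - v : M.V k).normSq ≤
        C * τ ^ 2 * ((M.h ^ (k + 1)) ^ 2 + (v - interp M S W : M.V k).normSq) := by
  obtain ⟨C₀, h₀, H₀⟩ := filter_energy_le (a := a) (b := b) hk
  obtain ⟨C₁, h₁, H₁⟩ := totalDelta_sq_le hab hk S β ρ K c hc
  obtain ⟨C₂, h₂, H₂⟩ := form_le_radau (a := a) (b := b) S l2Form
  have hba : 0 < b - a := sub_pos.2 hab
  refine ⟨C₀ * (2 * |ρ| + 2 * (C₂ * K ^ 2)) * C₁ * ((b - a) + (1 + 2 * |ρ|)), by positivity,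
    fun M hM τ W v z hτ hW hper hv hz hsmall => ?_⟩
  have hρ := M.one_le_of_quasiUniform hab hM
  have hh := M.h_pos hab
  have hK := hW.nonneg
  rw [abs_of_nonneg (by linarith : 0 ≤ ρ)]
  set ξ : M.V k := v - interp M S W with hξ
  -- `energy` is a mean square, so dividing `h^3` by the cell size leaves `h^2`, up to `ρ`.
  have hE0 : ∀ i, M.energy i (ξ i) ≤ ρ * M.h ^ 2 := by
    intro i
    have h1 := (ξ.size_mul_energy_le i).trans hsmall
    have h2 := M.energy_nonneg i (ξ i)
    have h3 : M.h * M.energy i (ξ i) ≤ M.h * (ρ * M.h ^ 2) := by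
      calc _ ≤ (ρ * M.size i) * M.energy i (ξ i) := by
            have := hM i
            gcongr
        _ = ρ * (M.size i * M.energy i (ξ i)) := by ring
        _ ≤ ρ * M.h ^ 3 := by gcongr
        _ = _ := by ring
    exact le_of_mul_le_mul_left h3 hh
  -- The constant on the cell is the value of `W` at its left endpoint, from which the interpolant
  -- deviates by `O(K h)`.
  have hE1 : ∀ i, M.energy i ((v i : ℝ[X]) - C (W (M.left i))) ≤
      (2 * ρ + 2 * (C₂ * K ^ 2)) * M.h ^ 2 := by
    intro i
    have e : (v i : ℝ[X]) - C (W (M.left i)) =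
        (ξ i : ℝ[X]) + ((interp M S W i : ℝ[X]) - C (W (M.left i))) := by
      rw [hξ, Pi.sub_apply, Submodule.coe_sub]; ring
    rw [e]
    refine (M.energy_add_le i _ _).trans ?_
    have h1 := H₂ M i ((interp M S W i : ℝ[X]) - C (W (M.left i))) (K * M.h)
      (by rw [natDegree_sub_C]; exact (interp M S W).natDegree_le i) fun j => by
        rw [eval_sub, interp_eval, eval_C]
        have h2 := taylorPoly_error (hW.mono (show 0 + 1 ≤ k + 1 by lia)) (M.left i)
          (cvPoint M S i j.succ)
        have h3 : (taylorPoly W 0 (M.left i)).eval (cvPoint M S i j.succ) = W (M.left i) := by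
          simp [taylorPoly]
        rw [h3, zero_add, pow_one] at h2
        exact h2.trans (mul_le_mul_of_nonneg_left
          ((cvPoint_sub_left S i _).trans (M.size_le_h i)) hK)
    have h4 := hE0 i
    unfold energy at h4 ⊢
    nlinarith
  set Y : Fin M.N → ℝ := fun i => (M.h ^ (k + 1)) ^ 2 + M.energy (M.prev i) (ξ (M.prev i)) +
    M.energy i (ξ i) + M.energy (M.next i) (ξ (M.next i)) with hYdef
  have hE2 : ∀ i, M.energy i ((z - v : M.V k) i) ≤
      C₀ * (2 * ρ + 2 * (C₂ * K ^ 2)) * C₁ * τ ^ 2 * Y i := by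
    intro i
    rw [Pi.sub_apply, Submodule.coe_sub]
    refine (H₀ M β τ v z hτ hz i (W (M.left i))).trans ?_
    have h1 := H₁ M hM W v hW hper hv i
    calc _ ≤ C₀ * (τ * totalDelta β v i) ^ 2 * ((2 * ρ + 2 * (C₂ * K ^ 2)) * M.h ^ 2) :=
          mul_le_mul_of_nonneg_left (hE1 i) (by positivity)
      _ = C₀ * (2 * ρ + 2 * (C₂ * K ^ 2)) * τ ^ 2 * (M.h * totalDelta β v i) ^ 2 := by ring
      _ ≤ C₀ * (2 * ρ + 2 * (C₂ * K ^ 2)) * τ ^ 2 * (C₁ * Y i) :=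
          mul_le_mul_of_nonneg_left h1 (by positivity)
      _ = _ := by ring
  have hY : ∀ i, M.size i * Y i ≤ M.size i * (M.h ^ (k + 1)) ^ 2 +
      ρ * (M.size (M.prev i) * M.energy (M.prev i) (ξ (M.prev i))) +
      M.size i * M.energy i (ξ i) +
      ρ * (M.size (M.next i) * M.energy (M.next i) (ξ (M.next i))) := by
    intro i
    have h1 := mul_le_mul_of_nonneg_right (size_le_mul hM i (M.prev i))
      (M.energy_nonneg (M.prev i) (ξ (M.prev i)))
    have h2 := mul_le_mul_of_nonneg_right (size_le_mul hM i (M.next i))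
      (M.energy_nonneg (M.next i) (ξ (M.next i)))
    rw [hYdef]
    simp only
    linarith
  have hYs : ∑ i, M.size i * Y i ≤ (b - a) * (M.h ^ (k + 1)) ^ 2 + (1 + 2 * ρ) * ξ.normSq := by
    refine (sum_le_sum fun i _ => hY i).trans (le_of_eq ?_)
    simp only [sum_add_distrib, ← mul_sum, ← sum_mul]
    rw [M.sum_prev fun i => M.size i * M.energy i (ξ i),
      M.sum_next fun i => M.size i * M.energy i (ξ i), M.sum_size, V.normSq]
    ring
  have hξ0 := ξ.normSq_nonneg
  set Q := C₀ * (2 * ρ + 2 * (C₂ * K ^ 2)) * C₁ with hQ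
  have hQ0 : 0 ≤ Q := by positivity
  calc (z - v : M.V k).normSq ≤ ∑ i, Q * τ ^ 2 * (M.size i * Y i) := by
        refine sum_le_sum fun i _ => ?_
        calc _ ≤ M.size i * (Q * τ ^ 2 * Y i) :=
              mul_le_mul_of_nonneg_left (hE2 i) (M.size_pos i).le
          _ = _ := by ring
    _ = Q * τ ^ 2 * ∑ i, M.size i * Y i := by rw [mul_sum]
    _ ≤ Q * τ ^ 2 * ((b - a) * (M.h ^ (k + 1)) ^ 2 + (1 + 2 * ρ) * ξ.normSq) :=
        mul_le_mul_of_nonneg_left hYs (by positivity)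
    _ ≤ Q * τ ^ 2 * (((b - a) + (1 + 2 * ρ)) * ((M.h ^ (k + 1)) ^ 2 + ξ.normSq)) := by
        refine mul_le_mul_of_nonneg_left ?_ (by positivity)
        nlinarith [mul_nonneg hba.le hξ0, mul_nonneg (by linarith : 0 ≤ 1 + 2 * ρ)
          (sq_nonneg (M.h ^ (k + 1)))]
    _ = _ := by ring

/-! ### The exact solution -/

variable {a b β T : ℝ} {q : ℕ} {U : ℝ → ℝ → ℝ}

/-- Along the characteristic `s ↦ (y + βs, s)` the derivative of `U` vanishes. It is computed for `0
< s < t`, where `U` is differentiable in both variables, and the mean value theorem with continuity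
on `[0, t]` reaches the end times. -/
theorem IsExactSolution.eq_translate (h : IsExactSolution a b β T q U) (hq : 1 ≤ q)
    {t : ℝ} (ht : t ∈ Set.Icc 0 T) (x : ℝ) : U x t = U (x - β * t) 0 := by
  rcases ht.1.eq_or_lt with h0 | h0
  · rw [← h0]; simp
  set y := x - β * t with hy
  set g : ℝ → ℝ := fun s => Function.uncurry U (y + β * s, s) with hg
  have hcont : ContinuousOn g (Set.Icc 0 t) := by
    refine h.smooth.continuousOn.comp (by fun_prop) fun s hs =>
      ⟨Set.mem_univ _, hs.1, hs.2.trans ht.2⟩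
  have hd : ∀ s ∈ Set.Ioo 0 t, HasDerivAt g 0 s := by
    intro s hs
    have hsT : s ∈ Set.Ioo 0 T := ⟨hs.1, hs.2.trans_le ht.2⟩
    set z := y + β * s
    have hnhds : Set.univ ×ˢ Set.Icc 0 T ∈ nhds (z, s) :=
      prod_mem_nhds Filter.univ_mem (Icc_mem_nhds hsT.1 hsT.2)
    have hdiff : DifferentiableAt ℝ (Function.uncurry U) (z, s) :=
      (h.smooth.contDiffAt hnhds).differentiableAt (by norm_cast; lia)
    obtain ⟨ux, h1, h2⟩ := h.equation z s ⟨hsT.1, hsT.2.le⟩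
    have hF := hdiff.hasFDerivAt
    set F := fderiv ℝ (Function.uncurry U) (z, s)
    have h3 : HasDerivAt (fun y => U y s) (F (1, 0)) z := by
      exact hF.comp_hasDerivAt z ((hasDerivAt_id z).prodMk (hasDerivAt_const z s))
    have h4 : HasDerivAt (fun t' => U z t') (F (0, 1)) s := by
      exact hF.comp_hasDerivAt s ((hasDerivAt_const s z).prodMk (hasDerivAt_id s))
    have e1 := h3.unique h1
    have e2 := h4.unique (h2.hasDerivAt (Icc_mem_nhds hsT.1 hsT.2))
    have h5 : HasDerivAt g (F (β, 1)) s := by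
      have h6 : HasDerivAt (fun s => y + β * s) β s := by
        simpa using ((hasDerivAt_id s).const_mul β).const_add y
      exact HasFDerivAt.comp_hasDerivAt (f := fun s => (y + β * s, s)) s hF
        (h6.prodMk (hasDerivAt_id s))
    have e3 : F (β, 1) = β * F (1, 0) + F (0, 1) := by
      rw [← smul_eq_mul, ← map_smul, ← map_add]; simp
    rw [e3, e1, e2] at h5
    simpa using h5
  obtain ⟨s, hs, hs'⟩ := exists_deriv_eq_slope g h0 hcont
    fun s hs => (hd s hs).differentiableAt.differentiableWithinAt
  rw [(hd s hs).deriv, eq_comm, div_eq_zero_iff] at hs'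
  have h1 : g t = g 0 := by
    rcases hs' with h1 | h1
    · linarith
    · linarith
  have h2 : y + β * t = x := by rw [hy]; ring
  simpa [hg, h2] using h1

theorem IsExactSolution.contDiff_initial (h : IsExactSolution a b β T q U) (hT : 0 < T) :
    ContDiff ℝ q fun x => U x 0 := by
  rw [← contDiffOn_univ]
  exact h.smooth.comp (f := fun x : ℝ => (x, (0 : ℝ))) (by fun_prop)
    fun x _ => ⟨Set.mem_univ _, le_rfl, hT.le⟩

theorem exists_smoothBound {f : ℝ → ℝ} {p : ℝ} (hp : p ≠ 0) (hf : ContDiff ℝ q f)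
    (hper : ∀ x, f (x + p) = f x) : ∃ K, SmoothBound q K f := by
  have hb : ∀ j, ∃ K, j ≤ q → ∀ x, |iteratedDeriv j f x| ≤ K := by
    intro j
    by_cases hj : j ≤ q
    · have hc := hf.continuous_iteratedDeriv j (by exact_mod_cast hj)
      have hpj : Function.Periodic (iteratedDeriv j f) p := iteratedDeriv_periodic hper j
      obtain ⟨K, hK⟩ := (hpj.isBounded_of_continuous hp hc).exists_norm_le
      exact ⟨K, fun _ x => hK _ ⟨x, rfl⟩⟩
    · exact ⟨0, fun h => absurd h hj⟩
  choose K hK using hb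
  refine ⟨∑ j ∈ range (q + 1), |K j|, hf, fun j hj x => ?_⟩
  refine (hK j hj x).trans ((le_abs_self _).trans ?_)
  exact single_le_sum (f := fun j => |K j|) (fun j _ => abs_nonneg _) (mem_range.2 (by lia))

theorem SmoothBound.comp_add_const {n : ℕ} {K : ℝ} {W : ℝ → ℝ} (h : SmoothBound n K W) (c : ℝ) :
    SmoothBound n K fun x => W (x + c) := by
  refine ⟨h.contDiff.comp (by fun_prop), fun j hj x => ?_⟩
  rw [iteratedDeriv_comp_add_const]
  exact h.bound j hj _

theorem SmoothBound.const_smul {n : ℕ} {K : ℝ} {W : ℝ → ℝ} (h : SmoothBound n K W) (c : ℝ) :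
    SmoothBound n (|c| * K) (c • W) := by
  refine ⟨contDiff_const.smul h.contDiff, fun j hj x => ?_⟩
  have := iteratedDeriv_const_mul_field (n := j) (x := x) c W
  have e : c • W = fun y => c * W y := rfl
  rw [e, this, abs_mul]
  exact mul_le_mul_of_nonneg_left (h.bound j hj x) (abs_nonneg c)

theorem SmoothBound.sum {n : ℕ} {ι : Type*} (s : Finset ι) {K : ι → ℝ} {W : ι → ℝ → ℝ}
    (h : ∀ i ∈ s, SmoothBound n (K i) (W i)) :
    SmoothBound n (∑ i ∈ s, K i) (∑ i ∈ s, W i) := by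
  refine ⟨?_, fun j hj x => ?_⟩
  · have : (∑ i ∈ s, W i) = fun x => ∑ i ∈ s, W i x := by funext x; simp
    rw [this]
    exact ContDiff.sum fun i hi => (h i hi).contDiff
  · rw [iteratedDeriv_sum fun i hi =>
      ((h i hi).contDiff.of_le (by exact_mod_cast hj)).contDiffAt]
    exact (abs_sum_le_sum_abs _ _).trans (sum_le_sum fun i hi => (h i hi).bound j hj x)

theorem SmoothBound.weaken {n : ℕ} {K K' : ℝ} {W : ℝ → ℝ} (h : SmoothBound n K W) (hK : K ≤ K') :
    SmoothBound n K' W := ⟨h.contDiff, fun j hj x => (h.bound j hj x).trans hK⟩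

/-! ### Stage polynomials and reference stages -/

/-- The stage values of one step for `y' = y` as polynomials in the step size. -/
def RKMethod.stagePoly (R : RKMethod) : ℕ → ℝ[X]
  | 0 => 1
  | l + 1 => ∑ κ : Fin (l + 1), (C (R.c l κ) + C (R.d l κ) * X) * R.stagePoly κ
decreasing_by exact κ.2

theorem RKMethod.stagePoly_succ (R : RKMethod) (l : ℕ) :
    R.stagePoly (l + 1) =
      ∑ κ ∈ range (l + 1), (C (R.c l κ) + C (R.d l κ) * X) * R.stagePoly κ := by
  rw [stagePoly, Finset.sum_range]

theorem RKMethod.eval_stagePoly (R : RKMethod) (z : ℝ) (l : ℕ) :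
    (R.stagePoly l).eval z = R.stage z l := by
  induction l using Nat.strong_induction_on with
  | _ l ih =>
    cases l with
    | zero => simp [stagePoly, stage]
    | succ l =>
      rw [stagePoly, stage, eval_finsetSum]
      refine sum_congr rfl fun κ _ => ?_
      rw [eval_mul, ih κ κ.2]
      simp
      left; ring

theorem RKMethod.natDegree_stagePoly (R : RKMethod) (l : ℕ) : (R.stagePoly l).natDegree ≤ l := by
  induction l using Nat.strong_induction_on with
  | _ l ih =>
    cases l with
    | zero => simp [stagePoly]
    | succ l =>
      rw [stagePoly]
      refine natDegree_sum_le_of_forall_le _ _ fun κ _ => natDegree_mul_le.trans ?_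
      have h1 := ih κ κ.2
      have h2 : (C (R.c l κ) + C (R.d l κ) * X).natDegree ≤ 1 := by compute_degree
      have := κ.2
      lia

theorem RKMethod.stagePoly_coeff_zero (R : RKMethod) {l : ℕ} (hl : l ≤ R.s) :
    (R.stagePoly l).coeff 0 = 1 := by
  induction l using Nat.strong_induction_on with
  | _ l ih =>
    cases l with
    | zero => simp [stagePoly]
    | succ l =>
      rw [stagePoly_succ, finsetSum_coeff, ← R.sum_c l hl]
      refine sum_congr rfl fun κ hκ => ?_
      have := mem_range.1 hκ
      rw [mul_coeff_zero, ih κ this (by lia)]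
      simp

/-- Induction by dividing by `X`; the filter is punctured at `0` so that `z` can be cancelled. -/
theorem coeff_eq_zero_of_isBigO {p : ℝ[X]} {n : ℕ}
    (h : (fun z => p.eval z) =O[nhdsWithin 0 {0}ᶜ] fun z : ℝ => z ^ n) {m : ℕ} (hm : m < n) :
    p.coeff m = 0 := by
  induction n generalizing p m with
  | zero => lia
  | succ n ih =>
    have h0 : p.coeff 0 = 0 := by
      have h1 : Filter.Tendsto (fun z : ℝ => z ^ (n + 1)) (nhdsWithin 0 {0}ᶜ) (nhds 0) := by
        have : Continuous fun z : ℝ => z ^ (n + 1) := by fun_prop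
        have := this.tendsto 0
        simp only [ne_eq, Nat.add_eq_zero_iff, one_ne_zero, and_false, not_false_eq_true,
          zero_pow] at this
        exact this.mono_left nhdsWithin_le_nhds
      have h2 := h.trans_tendsto h1
      have h3 := (p.continuous.tendsto 0).mono_left (nhdsWithin_le_nhds (s := {(0 : ℝ)}ᶜ))
      rw [coeff_zero_eq_eval_zero]
      exact tendsto_nhds_unique h3 h2
    have hp : p = X * p.divX := by
      have := p.X_mul_divX_add
      rw [h0, C_0, add_zero] at this
      exact this.symm
    cases m with
    | zero => exact h0
    | succ m =>
      have : p.coeff (m + 1) = p.divX.coeff m := by rw [coeff_divX]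
      rw [this]
      refine ih ?_ (by lia)
      obtain ⟨c, hc⟩ := h.bound
      refine Asymptotics.IsBigO.of_bound c ?_
      filter_upwards [hc, self_mem_nhdsWithin] with z hz hz0
      have hz1 : 0 < ‖z‖ := norm_pos_iff.2 hz0
      rw [hp, eval_mul, eval_X, norm_mul, pow_succ', norm_mul] at hz
      refine le_of_mul_le_mul_left (hz.trans (le_of_eq ?_)) hz1
      ring

/-- The scalar order condition becomes a statement about coefficients, and in this form it carries
over from numbers to the operator `∂_x`. -/
theorem RKMethod.HasOrder.coeff {R : RKMethod} {r : ℕ} (hR : R.HasOrder r) {m : ℕ} (hm : m ≤ r) :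
    (R.stagePoly R.s).coeff m = 1 / m.factorial := by
  set E : ℝ[X] := ∑ i ∈ range (r + 1), C (1 / (i.factorial : ℝ)) * X ^ i with hE
  have hEc : E.coeff m = 1 / m.factorial := by
    rw [hE, finsetSum_coeff]
    simp only [coeff_C_mul, coeff_X_pow]
    simp; lia
  have h1 : (fun z => (R.stagePoly R.s - E).eval z) =O[nhds 0] fun z : ℝ => z ^ (r + 1) := by
    have h2 := Real.exp_sub_sum_range_isBigO_pow (r + 1)
    refine (Asymptotics.IsBigO.add hR h2).congr_left fun z => ?_
    rw [eval_sub, R.eval_stagePoly, hE, eval_finsetSum]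
    have : ∀ i, (C (1 / (i.factorial : ℝ)) * X ^ i).eval z = z ^ i / i.factorial := by
      intro i; simp; ring
    simp only [this]
    ring
  have := coeff_eq_zero_of_isBigO (h1.mono nhdsWithin_le_nhds) (Nat.lt_succ_of_le hm)
  rw [coeff_sub, sub_eq_zero, hEc] at this
  exact this

/-- The differential operator `P(c ∂_x)` applied to `f`, truncated at order `n`. -/
def polyOp (n : ℕ) (c : ℝ) (f : ℝ → ℝ) (P : ℝ[X]) : ℝ → ℝ :=
  ∑ m ∈ range (n + 1), (P.coeff m * c ^ m) • iteratedDeriv m f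

theorem polyOp_one (n : ℕ) (c : ℝ) (f : ℝ → ℝ) : polyOp n c f 1 = f := by
  rw [polyOp, sum_eq_single 0]
  · simp
  · intro m _ hm; simp [coeff_one, hm]
  · simp

theorem polyOp_add (n : ℕ) (c : ℝ) (f : ℝ → ℝ) (P Q : ℝ[X]) :
    polyOp n c f (P + Q) = polyOp n c f P + polyOp n c f Q := by
  simp [polyOp, add_mul, add_smul, sum_add_distrib]

theorem polyOp_C_mul (n : ℕ) (c e : ℝ) (f : ℝ → ℝ) (P : ℝ[X]) :
    polyOp n c f (C e * P) = e • polyOp n c f P := by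
  simp [polyOp, mul_assoc, smul_sum, smul_smul]

theorem polyOp_sum (n : ℕ) (c : ℝ) (f : ℝ → ℝ) {ι : Type*} (s : Finset ι) (P : ι → ℝ[X]) :
    polyOp n c f (∑ i ∈ s, P i) = ∑ i ∈ s, polyOp n c f (P i) := by
  simp only [polyOp, finsetSum_coeff, sum_mul, sum_smul]
  exact sum_comm

/-- The degree condition ensures that the truncation at order `n` discards nothing. -/
theorem polyOp_X_mul {n : ℕ} (c : ℝ) {f : ℝ → ℝ} (hf : ContDiff ℝ (n + 1) f) {P : ℝ[X]}
    (hP : P.natDegree < n) : polyOp n c f (X * P) = c • deriv (polyOp n c f P) := by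
  have hd : ∀ m ≤ n, Differentiable ℝ (iteratedDeriv m f) := fun m hm =>
    hf.differentiable_iteratedDeriv m (by norm_cast; lia)
  have h1 : deriv (polyOp n c f P) =
      ∑ m ∈ range (n + 1), (P.coeff m * c ^ m) • iteratedDeriv (m + 1) f := by
    funext x
    have : HasDerivAt (polyOp n c f P)
        (∑ m ∈ range (n + 1), (P.coeff m * c ^ m) • iteratedDeriv (m + 1) f x) x := by
      unfold polyOp
      refine HasDerivAt.sum fun m hm => HasDerivAt.const_smul _ ?_
      rw [iteratedDeriv_succ]
      exact (hd m (Nat.lt_succ_iff.1 (mem_range.1 hm)) x).hasDerivAt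
    rw [this.deriv]
    simp
  rw [h1, sum_range_succ, coeff_eq_zero_of_natDegree_lt hP, zero_mul, zero_smul, add_zero,
    polyOp, sum_range_succ', smul_sum]
  simp only [coeff_X_mul_zero, zero_mul, zero_smul, add_zero]
  refine sum_congr rfl fun m _ => ?_
  rw [coeff_X_mul, smul_smul]
  congr 1
  ring

/-- The reference stages obey the recursion of the method exactly, so the residual of a stage
consists of the spatial error alone. -/
theorem polyOp_stage {n : ℕ} (c : ℝ) {f : ℝ → ℝ} (hf : ContDiff ℝ (n + 1) f) (R : RKMethod)
    {l : ℕ} (hl : l < n) : polyOp n c f (R.stagePoly (l + 1)) =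
      ∑ κ ∈ range (l + 1), (R.c l κ • polyOp n c f (R.stagePoly κ) +
        R.d l κ • c • deriv (polyOp n c f (R.stagePoly κ))) := by
  rw [R.stagePoly_succ, polyOp_sum]
  refine sum_congr rfl fun κ hκ => ?_
  have := mem_range.1 hκ
  rw [add_mul, polyOp_add, polyOp_C_mul, mul_assoc, polyOp_C_mul,
    polyOp_X_mul c hf ((R.natDegree_stagePoly κ).trans_lt (by lia))]

theorem polyOp_smoothBound {n N : ℕ} {K c c₀ : ℝ} {f : ℝ → ℝ} (hf : SmoothBound (N + n) K f)
    (hc : |c| ≤ c₀) (P : ℝ[X]) :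
    SmoothBound N (∑ m ∈ range (n + 1), |P.coeff m| * c₀ ^ m * K) (polyOp n c f P) := by
  refine SmoothBound.sum _ fun m hm => ?_
  have hm' := Nat.lt_succ_iff.1 (mem_range.1 hm)
  have h1 : SmoothBound N K (iteratedDeriv m f) :=
    SmoothBound.iteratedDeriv (hf.mono (by lia))
  refine (h1.const_smul _).weaken ?_
  rw [abs_mul, abs_pow]
  have := hf.nonneg
  gcongr

theorem polyOp_periodic {n : ℕ} {c p : ℝ} {f : ℝ → ℝ} (hper : ∀ x, f (x + p) = f x) (P : ℝ[X])
    (x : ℝ) : polyOp n c f P (x + p) = polyOp n c f P x := by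
  simp only [polyOp, Finset.sum_apply, Pi.smul_apply, iteratedDeriv_periodic hper]

theorem polyOp_tail {n j : ℕ} {K c c₀ : ℝ} {f : ℝ → ℝ} (hf : SmoothBound n K f)
    (hc : |c| ≤ c₀) (hj : j ≤ n) (P : ℝ[X]) (x : ℝ) :
    |polyOp n c f P x - ∑ m ∈ range j, P.coeff m * c ^ m * iteratedDeriv m f x| ≤
      (∑ m ∈ range (n + 1), |P.coeff m| * c₀ ^ (m - j) * K) * |c| ^ j := by
  have hK := hf.nonneg
  have hc0 : 0 ≤ c₀ := (abs_nonneg c).trans hc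
  have e : polyOp n c f P x - ∑ m ∈ range j, P.coeff m * c ^ m * iteratedDeriv m f x =
      ∑ m ∈ Ico j (n + 1), P.coeff m * c ^ m * iteratedDeriv m f x := by
    rw [sum_Ico_eq_sub _ (by lia : j ≤ n + 1)]
    simp [polyOp]
  rw [e, sum_mul]
  refine (abs_sum_le_sum_abs _ _).trans ?_
  refine (sum_le_sum fun m hm => ?_).trans (sum_le_sum_of_subset_of_nonneg (s := Ico j (n + 1))
    (fun m hm => mem_range.2 (mem_Ico.1 hm).2) fun m _ _ => by positivity)
  obtain ⟨h1, h2⟩ := mem_Ico.1 hm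
  rw [abs_mul, abs_mul, abs_pow]
  have h3 : |c| ^ m = |c| ^ (m - j) * |c| ^ j := by rw [← pow_add]; congr 1; lia
  rw [h3]
  calc _ ≤ |P.coeff m| * (c₀ ^ (m - j) * |c| ^ j) * K := by
        have := hf.bound m (by lia) x
        gcongr
    _ = _ := by ring

/-- By the order conditions the terms of order at most `r` form the Taylor polynomial of `f` at `x`,
evaluated at `x + c`. -/
theorem polyOp_order_error {n r : ℕ} {K c c₀ : ℝ} {f : ℝ → ℝ} (hf : SmoothBound (n + r + 1) K f)
    (hc : |c| ≤ c₀) {R : RKMethod} (hR : R.HasOrder r) (x : ℝ) :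
    |polyOp (n + r + 1) c f (R.stagePoly R.s) x - f (x + c)| ≤
      (∑ m ∈ range (n + r + 1 + 1), |(R.stagePoly R.s).coeff m| * c₀ ^ (m - (r + 1)) * K + K) *
        |c| ^ (r + 1) := by
  have h1 := polyOp_tail hf hc (show r + 1 ≤ n + r + 1 by lia) (R.stagePoly R.s) x
  have h2 := taylorPoly_error (hf.mono (show r + 1 ≤ n + r + 1 by lia)) x (x + c)
  have e : (taylorPoly f r x).eval (x + c) =
      ∑ m ∈ range (r + 1), (R.stagePoly R.s).coeff m * c ^ m * iteratedDeriv m f x := by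
    rw [taylorPoly, eval_finsetSum]
    refine sum_congr rfl fun m hm => ?_
    rw [hR.coeff (Nat.lt_succ_iff.1 (mem_range.1 hm))]
    simp
    ring
  rw [e, add_sub_cancel_left, abs_sub_comm] at h2
  rw [add_mul]
  exact (abs_sub_le _ _ _).trans (add_le_add h1 h2)

theorem polyOp_sub_self {n : ℕ} {K c c₀ : ℝ} {f : ℝ → ℝ} (hf : SmoothBound (n + 1) K f)
    (hc : |c| ≤ c₀) {R : RKMethod} {l : ℕ} (hl : l ≤ R.s) (x : ℝ) :
    |polyOp (n + 1) c f (R.stagePoly l) x - f x| ≤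
      (∑ m ∈ range (n + 1 + 1), |(R.stagePoly l).coeff m| * c₀ ^ (m - 1) * K) * |c| := by
  have h1 := polyOp_tail hf hc (show 1 ≤ n + 1 by lia) (R.stagePoly l) x
  simpa [R.stagePoly_coeff_zero hl] using h1

/-! ### Perturbed Runge–Kutta steps -/

/-- A bound for one stage of the method in terms of the preceding stages. -/
def RKMethod.growth (R : RKMethod) (L : ℝ) : ℝ :=
  ∑ l ∈ range R.s, ∑ κ ∈ range (l + 1), (|R.c l κ| + |R.d l κ| * L)

theorem RKMethod.growth_nonneg (R : RKMethod) {L : ℝ} (hL : 0 ≤ L) : 0 ≤ R.growth L :=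
  sum_nonneg fun _ _ => sum_nonneg fun _ _ => by positivity

theorem RKMethod.stage_le (R : RKMethod) {L : ℝ} (hL : 0 ≤ L) {E : Type*} [AddCommGroup E]
    [Module ℝ E] (N : Seminorm ℝ E) (A : E →ₗ[ℝ] E) (hA : ∀ v, N (A v) ≤ L * N v) (u : ℕ → E)
    {l : ℕ} (hl : l < R.s) {B : ℝ} (hB : ∀ κ ≤ l, N (u κ) ≤ B) :
    N (∑ κ ∈ range (l + 1), (R.c l κ • u κ + R.d l κ • A (u κ))) ≤ R.growth L * B := by
  have hB0 : 0 ≤ B := (apply_nonneg N _).trans (hB 0 (Nat.zero_le _))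
  calc _ ≤ ∑ κ ∈ range (l + 1), N (R.c l κ • u κ + R.d l κ • A (u κ)) :=
        le_sum_of_subadditive N (map_zero N).le (map_add_le_add N) _ _
    _ ≤ ∑ κ ∈ range (l + 1), (|R.c l κ| + |R.d l κ| * L) * B := by
        refine sum_le_sum fun κ hκ => (map_add_le_add N _ _).trans ?_
        rw [map_smul_eq_mul, map_smul_eq_mul, Real.norm_eq_abs, Real.norm_eq_abs]
        have h1 := hB κ (Nat.lt_succ_iff.1 (mem_range.1 hκ))
        have h2 := (hA (u κ)).trans (mul_le_mul_of_nonneg_left h1 hL)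
        calc _ ≤ |R.c l κ| * B + |R.d l κ| * (L * B) := by gcongr
          _ = _ := by ring
    _ ≤ _ := by
        rw [← sum_mul]
        refine mul_le_mul_of_nonneg_right ?_ hB0
        exact single_le_sum (f := fun l => ∑ κ ∈ range (l + 1), (|R.c l κ| + |R.d l κ| * L))
          (fun _ _ => sum_nonneg fun _ _ => by positivity) (mem_range.2 hl)

theorem RKMethod.linear_bound (R : RKMethod) {L : ℝ} (hL : 0 ≤ L) {E : Type*} [AddCommGroup E]
    [Module ℝ E] (N : Seminorm ℝ E) (A : E →ₗ[ℝ] E) (hA : ∀ v, N (A v) ≤ L * N v) (u H : ℕ → E)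
    {δ : ℝ} (hδ : 0 ≤ δ) (hu0 : u 0 = 0)
    (hu : ∀ l < R.s, u (l + 1) =
      ∑ κ ∈ range (l + 1), (R.c l κ • u κ + R.d l κ • A (u κ)) + H l)
    (hH : ∀ l < R.s, N (H l) ≤ δ) {l : ℕ} (hl : l ≤ R.s) :
    N (u l) ≤ (R.growth L + 1) ^ l * δ := by
  have hg := R.growth_nonneg hL
  induction l using Nat.strong_induction_on with
  | _ l ih =>
    cases l with
    | zero => simp [hu0, hδ]
    | succ l =>
      have h1 := R.stage_le hL N A hA u hl (B := (R.growth L + 1) ^ l * δ) fun κ hκ =>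
        (ih κ (by lia) (by lia)).trans (mul_le_mul_of_nonneg_right
          (pow_le_pow_right₀ (by linarith) hκ) hδ)
      rw [hu l hl]
      refine (map_add_le_add N _ _).trans ((add_le_add h1 (hH l hl)).trans ?_)
      have h2 : δ ≤ (R.growth L + 1) ^ l * δ :=
        le_mul_of_one_le_left hδ (one_le_pow₀ (by linarith))
      rw [pow_succ]
      linarith

/-- The filter estimate is available only below the threshold `θ`. A first, crude induction bounds
all stages by a fixed multiple of `N (e 0) + ε`, hence by `θ`. The total perturbation of each stage
is then `O(τ)`, and the difference from the unperturbed step `ζ` solves the linear recursion with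
zero initial value. Thus `ζ` enters with factor exactly `1` and everything else carries a factor
`τ`. -/
theorem RKMethod.perturbed_step (R : RKMethod) {L T D : ℝ} (hL : 0 ≤ L) (hT : 0 ≤ T)
    (hD : 0 ≤ D) :
    ∃ K : ℝ, 0 ≤ K ∧ ∀ {E : Type} [AddCommGroup E] [Module ℝ E] (N : Seminorm ℝ E)
      (A : E →ₗ[ℝ] E) (τ ε θ : ℝ) (e e' res ζ : ℕ → E), (∀ v, N (A v) ≤ L * N v) →
      0 ≤ τ → τ ≤ T → 0 ≤ ε →
      (∀ l < R.s, e' (l + 1) =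
        ∑ κ ∈ range (l + 1), (R.c l κ • e κ + R.d l κ • A (e κ)) + res l) →
      (∀ l < R.s, N (res l) ≤ τ * ε) →
      (∀ l < R.s, N (e' (l + 1)) ≤ θ →
        N (e (l + 1) - e' (l + 1)) ≤ τ * (D * (ε + N (e' (l + 1))))) →
      ζ 0 = e 0 →
      (∀ l < R.s, ζ (l + 1) =
        ∑ κ ∈ range (l + 1), (R.c l κ • ζ κ + R.d l κ • A (ζ κ))) →
      K * (N (e 0) + ε) ≤ θ →
      N (e R.s) ≤ N (ζ R.s) + K * τ * (N (e 0) + ε) := by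
  have hg := R.growth_nonneg hL
  set G := R.growth L
  -- Growth of one stage: `G + 1 + T` for the linear part with its residual, and a further `2 T D`
  -- times this for the filter.
  set Q := (1 + 2 * (T * D)) * (G + 1 + T) with hQ
  have hTD : 0 ≤ T * D := mul_nonneg hT hD
  have hQ1 : 1 ≤ Q := by rw [hQ]; nlinarith
  have hQG : G + 1 + T ≤ Q := by rw [hQ]; nlinarith
  have hQs : 1 ≤ Q ^ R.s := one_le_pow₀ hQ1
  have hG1 : 1 ≤ (G + 1) ^ R.s := one_le_pow₀ (by linarith)
  set K₁ := D * (1 + Q ^ R.s) + 1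
  have hK₁ : 0 ≤ K₁ := by positivity
  -- The first summand guarantees that all stages stay below `θ`; the second bounds the accumulated
  -- perturbations.
  refine ⟨Q ^ R.s + (G + 1) ^ R.s * K₁, by positivity, ?_⟩
  intro E _ _ N A τ ε θ e e' res ζ hA hτ0 hτT hε hst hres hfil hζ0 hζ hsmall
  set Y := N (e 0) + ε
  have hX : 0 ≤ Y := add_nonneg (apply_nonneg N _) hε
  have hεX : ε ≤ Y := le_add_of_nonneg_left (apply_nonneg N _)
  have hθ : Q ^ R.s * Y ≤ θ := by
    refine le_trans ?_ hsmall
    have : 0 ≤ (G + 1) ^ R.s * K₁ * Y := by positivity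
    linarith
  -- The unfiltered stage `e'` is bounded first: this is what permits the filter estimate that
  -- bounds `e`.
  have hboth : ∀ l ≤ R.s, N (e l) ≤ Q ^ l * Y ∧ (∀ m, l = m + 1 → N (e' l) ≤ Q ^ l * Y) := by
    intro l
    induction l using Nat.strong_induction_on with
    | _ l ih =>
      intro hl
      cases l with
      | zero => exact ⟨by simpa [Y] using hε, fun m hm => by lia⟩
      | succ l =>
        have h1 := R.stage_le hL N A hA e hl (B := Q ^ l * Y) fun κ hκ =>
          (ih κ (by lia) (by lia)).1.trans (mul_le_mul_of_nonneg_right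
            (pow_le_pow_right₀ hQ1 hκ) hX)
        have hXl : Y ≤ Q ^ l * Y := le_mul_of_one_le_left hX (one_le_pow₀ hQ1)
        have h2 : N (e' (l + 1)) ≤ (G + 1 + T) * (Q ^ l * Y) := by
          rw [hst l hl]
          refine (map_add_le_add N _ _).trans ((add_le_add h1 (hres l hl)).trans ?_)
          have : τ * ε ≤ T * (Q ^ l * Y) := mul_le_mul hτT (hεX.trans hXl) hε hT
          nlinarith
        have hQX : 0 ≤ Q ^ l * Y := by positivity
        have h3 : N (e' (l + 1)) ≤ Q ^ (l + 1) * Y := by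
          refine h2.trans ?_
          rw [pow_succ', mul_assoc]
          exact mul_le_mul_of_nonneg_right hQG hQX
        refine ⟨?_, fun _ _ => h3⟩
        have h4 := hfil l hl ((h3.trans (mul_le_mul_of_nonneg_right
          (pow_le_pow_right₀ hQ1 hl) hX)).trans hθ)
        have h5 : τ * (D * (ε + N (e' (l + 1)))) ≤
            T * D * (Q ^ l * Y + (G + 1 + T) * (Q ^ l * Y)) := by
          rw [mul_assoc]
          have := apply_nonneg N (e' (l + 1))
          have := hεX.trans hXl
          gcongr
        have h6 : N (e (l + 1)) ≤ N (e' (l + 1)) + N (e (l + 1) - e' (l + 1)) := by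
          have := map_add_le_add N (e' (l + 1)) (e (l + 1) - e' (l + 1))
          rwa [add_sub_cancel] at this
        rw [pow_succ', mul_assoc, hQ]
        have h7 : T * D * (Q ^ l * Y) ≤ T * D * ((G + 1 + T) * (Q ^ l * Y)) := by
          refine mul_le_mul_of_nonneg_left ?_ hTD
          exact le_mul_of_one_le_left hQX (by linarith)
        nlinarith
  set H : ℕ → E := fun l => res l + (e (l + 1) - e' (l + 1))
  have hH : ∀ l < R.s, N (H l) ≤ τ * (K₁ * Y) := by
    intro l hl
    have h1 := (hboth (l + 1) hl).2 l rfl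
    have h2 : N (e' (l + 1)) ≤ Q ^ R.s * Y :=
      h1.trans (mul_le_mul_of_nonneg_right (pow_le_pow_right₀ hQ1 hl) hX)
    have h3 := hfil l hl (h2.trans hθ)
    refine (map_add_le_add N _ _).trans ((add_le_add (hres l hl) h3).trans ?_)
    rw [← mul_add]
    refine mul_le_mul_of_nonneg_left ?_ hτ0
    have : D * (ε + N (e' (l + 1))) ≤ D * (Y + Q ^ R.s * Y) := by gcongr
    linarith
  have hlin := R.linear_bound hL N A hA (fun l => e l - ζ l) H (δ := τ * (K₁ * Y))
    (by positivity) (by simp [hζ0]) (fun l hl => by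
      have h1 := hst l hl
      have h2 := hζ l hl
      have h3 : ∑ κ ∈ range (l + 1), (R.c l κ • (e κ - ζ κ) + R.d l κ • A (e κ - ζ κ)) =
          ∑ κ ∈ range (l + 1), (R.c l κ • e κ + R.d l κ • A (e κ)) -
          ∑ κ ∈ range (l + 1), (R.c l κ • ζ κ + R.d l κ • A (ζ κ)) := by
        rw [← sum_sub_distrib]
        refine sum_congr rfl fun κ _ => ?_
        rw [map_sub]; module
      rw [h3, ← h2]
      have h4 : ∑ κ ∈ range (l + 1), (R.c l κ • e κ + R.d l κ • A (e κ)) =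
          e' (l + 1) - res l := by rw [h1]; abel
      rw [h4]
      simp only [H]
      abel) hH le_rfl
  have h8 : N (e R.s) ≤ N (ζ R.s) + N (e R.s - ζ R.s) := by
    have := map_add_le_add N (ζ R.s) (e R.s - ζ R.s)
    rwa [add_sub_cancel] at this
  have h9 : 0 ≤ Q ^ R.s * (τ * Y) := by positivity
  calc N (e R.s) ≤ N (ζ R.s) + (G + 1) ^ R.s * (τ * (K₁ * Y)) := h8.trans (by linarith)
    _ ≤ _ := by nlinarith

/-- A bootstrap: the recursion may be used only while `x n ≤ Θ`, and the bound being proved implies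
this. Adding `ε` to `x n` turns the recursion into a pure multiplication by `1 + D τ`. -/
theorem discrete_gronwall {x : ℕ → ℝ} {D τ ε Θ T : ℝ} {n₀ : ℕ} (hx : 0 ≤ x 0) (hD : 0 ≤ D)
    (hτ : 0 ≤ τ) (hε : 0 ≤ ε) (hT : n₀ * τ = T)
    (hstep : ∀ n < n₀, x n ≤ Θ → x (n + 1) ≤ (1 + D * τ) * x n + D * τ * ε)
    (hΘ : Real.exp (D * T) * (x 0 + ε) ≤ Θ) {n : ℕ} (hn : n ≤ n₀) :
    x n ≤ Real.exp (D * T) * (x 0 + ε) := by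
  have hDτ : 0 ≤ D * τ := mul_nonneg hD hτ
  have hexp : ∀ m ≤ n₀, (1 + D * τ) ^ m ≤ Real.exp (D * T) := by
    intro m hm
    have h1 : 1 + D * τ ≤ Real.exp (D * τ) := by
      have := Real.add_one_le_exp (D * τ); linarith
    calc (1 + D * τ) ^ m ≤ Real.exp (D * τ) ^ m := pow_le_pow_left₀ (by linarith) h1 m
      _ = Real.exp (m * (D * τ)) := by rw [← Real.exp_nat_mul]
      _ ≤ Real.exp (D * T) := by
          refine Real.exp_le_exp.2 ?_
          have : (m : ℝ) ≤ n₀ := by exact_mod_cast hm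
          rw [← hT]
          nlinarith [mul_le_mul_of_nonneg_right this hDτ]
  have key : ∀ m ≤ n₀, x m ≤ (1 + D * τ) ^ m * (x 0 + ε) - ε := by
    intro m
    induction m with
    | zero => intro _; simp
    | succ m ih =>
      intro hm
      have h1 := ih (by lia)
      have h2 := mul_le_mul_of_nonneg_right (hexp m (by lia)) (add_nonneg hx hε)
      have h3 := hstep m hm (by linarith)
      have h4 := mul_le_mul_of_nonneg_left h1 (by linarith : 0 ≤ 1 + D * τ)
      rw [pow_succ']
      linarith
  have h1 := key n hn
  have h2 := mul_le_mul_of_nonneg_right (hexp n hn) (add_nonneg hx hε)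
  linarith

variable {a b : ℝ} {k : ℕ}

/-! ### Estimates in the energy norm -/

theorem step_le_of_cfl {h γ τ D : ℝ} (h0 : 0 < h) (h1 : h ≤ 1) (hγ : 1 ≤ γ) (hD : 0 < D)
    (hτ : τ / h ^ γ ≤ D) : τ ≤ D * h := by
  have h2 : 0 < h ^ γ := Real.rpow_pos_of_pos h0 γ
  have h3 : h ^ γ ≤ h := by
    simpa using Real.rpow_le_rpow_of_exponent_ge h0 h1 hγ
  exact ((div_le_iff₀ h2).1 hτ).trans (mul_le_mul_of_nonneg_left h3 hD.le)

/-- The CFL condition balances the inverse inequality: `svOp` costs `1/h`, and `τ ≤ D h`. -/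
theorem star_svOp_le (hab : a < b) (hk : 1 ≤ k) {S : Subdivision k} {w : Fin (k + 2) → ℝ}
    (hS : S.Admissible w) (β ρ D : ℝ) (hD : 0 < D) :
    ∃ L : ℝ, 0 ≤ L ∧ ∀ M : Mesh a b, M.QuasiUniform ρ → ∀ τ : ℝ, 0 ≤ τ → τ ≤ D * M.h →
      ∀ v, starSeminorm hk hS M ((τ • svOp M S β) v) ≤ L * starSeminorm hk hS M v := by
  obtain ⟨Q, hQ, HQ⟩ := normSq_equiv (a := a) (b := b) hk hS
  obtain ⟨C, hC, H⟩ := normSq_svOp_le hab S β ρ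
  refine ⟨Q ^ 2 * D * √C, by positivity, fun M hM τ hτ0 hτ v => ?_⟩
  have hh := M.h_pos hab
  have hN := apply_nonneg (starSeminorm hk hS M)
  rw [LinearMap.smul_apply, map_smul_eq_mul, Real.norm_eq_abs, abs_of_nonneg hτ0]
  refine le_of_abs_le (abs_le_of_sq_le_sq ?_ (by have := hN v; positivity))
  have h1 := (HQ M (svOp M S β v)).2
  have h2 := H M hM v
  have h3 := (HQ M v).1
  calc (τ * starSeminorm hk hS M (svOp M S β v)) ^ 2
      = τ ^ 2 * starSeminorm hk hS M (svOp M S β v) ^ 2 := by ring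
    _ ≤ (D * M.h) ^ 2 * (Q ^ 2 * (svOp M S β v).normSq) := by gcongr
    _ = D ^ 2 * Q ^ 2 * (M.h ^ 2 * (svOp M S β v).normSq) := by ring
    _ ≤ D ^ 2 * Q ^ 2 * (C * (Q ^ 2 * starSeminorm hk hS M v ^ 2)) := by
        refine mul_le_mul_of_nonneg_left (h2.trans ?_) (by positivity)
        exact mul_le_mul_of_nonneg_left h3 hC
    _ = (Q ^ 2 * D) ^ 2 * C * starSeminorm hk hS M v ^ 2 := by ring
    _ = _ := by rw [mul_pow _ (starSeminorm hk hS M v), mul_pow _ √C, Real.sq_sqrt hC]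

theorem star_le_of_energy_le (hab : a < b) (hk : 1 ≤ k) {S : Subdivision k}
    {w : Fin (k + 2) → ℝ} (hS : S.Admissible w) :
    ∃ Q : ℝ, 0 ≤ Q ∧ ∀ (M : Mesh a b) (v : M.V k) (C A : ℝ), 0 ≤ C → 0 ≤ A →
      (∀ i, M.energy i (v i) ≤ C * A ^ 2) → starSeminorm hk hS M v ≤ Q * √C * A := by
  obtain ⟨Q, hQ, HQ⟩ := normSq_equiv (a := a) (b := b) hk hS
  have hba : 0 < b - a := sub_pos.2 hab
  refine ⟨Q * √(b - a), by positivity, fun M v C A hC hA h => ?_⟩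
  refine le_of_abs_le (abs_le_of_sq_le_sq ?_ (by positivity))
  refine ((HQ M v).2.trans (mul_le_mul_of_nonneg_left (normSq_le_of_energy_le v h)
    (sq_nonneg Q))).trans (le_of_eq ?_)
  rw [mul_pow, mul_pow, mul_pow, Real.sq_sqrt hC, Real.sq_sqrt hba.le]
  ring

theorem star_consistency (hab : a < b) (hk : 1 ≤ k) {S : Subdivision k} {w : Fin (k + 2) → ℝ}
    (hS : S.Admissible w) (β : ℝ) :
    ∃ C : ℝ, 0 ≤ C ∧ ∀ (M : Mesh a b) (K : ℝ) (W : ℝ → ℝ), SmoothBound (k + 2) K W →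
      (∀ x, W (x + (b - a)) = W x) →
      starSeminorm hk hS M (svOp M S β (interp M S W) + β • interp M S (deriv W)) ≤
        C * (K * M.h ^ (k + 1)) := by
  obtain ⟨Q, hQ, HQ⟩ := star_le_of_energy_le hab hk hS
  obtain ⟨C, hC, H⟩ := energy_consistency (a := a) (b := b) S β
  refine ⟨Q * √C, by positivity, fun M K W hW hper => HQ M _ C _ hC ?_ fun i => ?_⟩
  · have := hW.nonneg
    have := (M.h_pos hab).le
    positivity
  · refine (H M i K W hW hper).trans (mul_le_mul_of_nonneg_left ?_ hC)
    have := hW.nonneg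
    have := M.size_le_h i
    have := (M.size_pos i).le
    gcongr

theorem star_interp_le (hab : a < b) (hk : 1 ≤ k) {S : Subdivision k} {w : Fin (k + 2) → ℝ}
    (hS : S.Admissible w) :
    ∃ C : ℝ, 0 ≤ C ∧ ∀ (M : Mesh a b) (A : ℝ) (W : ℝ → ℝ), (∀ x, |W x| ≤ A) →
      starSeminorm hk hS M (interp M S W) ≤ C * A := by
  obtain ⟨Q, hQ, HQ⟩ := star_le_of_energy_le hab hk hS
  obtain ⟨C, hC, H⟩ := energy_interp_le (a := a) (b := b) S
  exact ⟨Q * √C, by positivity, fun M A W hW => HQ M _ C A hC ((abs_nonneg _).trans (hW 0))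
    fun i => H M i A W hW⟩

theorem l2dist_sq_le_of_near (hab : a < b) (S : Subdivision k) :
    ∃ C : ℝ, 0 ≤ C ∧ ∀ (M : Mesh a b) (v : M.V k) (K B : ℝ) (W f : ℝ → ℝ),
      SmoothBound (k + 1) K W → Continuous f → (∀ x, |W x - f x| ≤ B) →
      v.l2dist f ^ 2 ≤ 2 * (v - interp M S W : M.V k).normSq +
        C * ((K * M.h ^ (k + 1)) ^ 2 + B ^ 2) := by
  obtain ⟨C, hC, H⟩ := l2dist_interp_sq hab S
  have hba : 0 < b - a := sub_pos.2 hab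
  refine ⟨4 * C + 4 * (b - a), by positivity, fun M v K B W f hW hf hB => ?_⟩
  have h1 := l2dist_sq_le v (interp M S W) hf
  have h2 : (interp M S W).l2dist f ^ 2 ≤
      2 * (interp M S W).l2dist W ^ 2 + 2 * ((b - a) * B ^ 2) := by
    rw [V.l2dist_sq, V.l2dist_sq, ← M.sum_size, sum_mul, mul_sum, mul_sum, ← sum_add_distrib]
    refine sum_le_sum fun i _ => ?_
    have hWc := hW.contDiff.continuous
    have h3 := integral_sq_triangle ((interp M S W).val_continuous i) hWc hf (M.left_le_right i)
    have h4 : ∫ x in (M.left i)..(M.right i), (W x - f x) ^ 2 ≤ M.size i * B ^ 2 := by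
      refine integral_le_of_le_const (by fun_prop) i fun x _ => ?_
      rw [← sq_abs]
      exact pow_le_pow_left₀ (abs_nonneg _) (hB x) 2
    linarith
  have h3 := H M K W hW
  have h5 : 0 ≤ C * B ^ 2 := by positivity
  have h6 : 0 ≤ (b - a) * (K * M.h ^ (k + 1)) ^ 2 := by positivity
  linarith

theorem supDev_ge (hab : a < b) (S : Subdivision k) (K B A : ℝ) (hA0 : 0 < A) :
    ∃ h₁ : ℝ, 0 < h₁ ∧ h₁ ≤ 1 ∧ ∀ (M : Mesh a b), M.h ≤ h₁ → ∀ (v : M.V k) (W f : ℝ → ℝ),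
      SmoothBound (k + 1) K W → Continuous f → (∀ x, |W x - f x| ≤ B * M.h) →
      (∀ c, A ≤ ∫ x in a..b, (f x - c) ^ 2) → (v - interp M S W : M.V k).normSq ≤ M.h ^ 3 →
      √(A / (4 * (b - a))) ≤ v.supDev := by
  obtain ⟨C, hC, H⟩ := l2dist_sq_le_of_near hab S
  have hba : 0 < b - a := sub_pos.2 hab
  -- All contributions to `‖v - f‖²` are at most `Q h` once `h ≤ 1`, so `h ≤ A / (4 Q)` gives the `A
  -- / 4` needed in `supDev_sq_ge`.
  set Q := 2 + C * (K ^ 2 + B ^ 2) with hQ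
  have hQ0 : 0 < Q := by positivity
  refine ⟨min 1 (A / (4 * Q)), lt_min one_pos (by positivity), min_le_left _ _,
    fun M hM v W f hW hf hWf hA hv => ?_⟩
  have hh := M.h_pos hab
  have hh1 : M.h ≤ 1 := hM.trans (min_le_left _ _)
  have h1 := H M v K (B * M.h) W f hW hf hWf
  have h2 : M.h ^ 3 ≤ M.h := pow_le_of_le_one hh.le hh1 (by norm_num)
  have h3 : (M.h ^ (k + 1)) ^ 2 ≤ M.h := by
    rw [← pow_mul]; exact pow_le_of_le_one hh.le hh1 (by simp)
  have h4 : M.h ^ 2 ≤ M.h := pow_le_of_le_one hh.le hh1 (by norm_num)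
  have h5 : v.l2dist f ^ 2 ≤ A / 4 := by
    calc v.l2dist f ^ 2 ≤ 2 * M.h ^ 3 + C * (K ^ 2 * (M.h ^ (k + 1)) ^ 2 + B ^ 2 * M.h ^ 2) := by
          rw [mul_pow, mul_pow] at h1
          linarith
      _ ≤ 2 * M.h + C * (K ^ 2 * M.h + B ^ 2 * M.h) := by gcongr
      _ = Q * M.h := by rw [hQ]; ring
      _ ≤ Q * (A / (4 * Q)) := mul_le_mul_of_nonneg_left (hM.trans (min_le_right _ _)) hQ0.le
      _ = A / 4 := by field_simp
  have h6 := supDev_sq_ge v hf hA h5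
  refine Real.sqrt_le_iff.2 ⟨v.supDev_nonneg, ?_⟩
  rw [div_le_iff₀ (by positivity)]
  linarith

theorem star_filter_le (hab : a < b) (hk : 1 ≤ k) {S : Subdivision k} {w : Fin (k + 2) → ℝ}
    (hS : S.Admissible w) (β ρ K B A : ℝ) (hA0 : 0 < A) :
    ∃ h₁ η D : ℝ, 0 < h₁ ∧ h₁ ≤ 1 ∧ 0 < η ∧ 0 ≤ D ∧ ∀ (M : Mesh a b), M.QuasiUniform ρ →
      M.h ≤ h₁ → ∀ (τ : ℝ) (v z : M.V k) (W f : ℝ → ℝ), 0 ≤ τ → SmoothBound (k + 1) K W →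
      (∀ x, W (x + (b - a)) = W x) → Continuous f → (∀ x, |W x - f x| ≤ B * M.h) →
      (∀ c, A ≤ ∫ x in a..b, (f x - c) ^ 2) → IsOEFilter β τ v z →
      starSeminorm hk hS M (v - interp M S W) ≤ η * √(M.h ^ 3) →
      starSeminorm hk hS M (z - v) ≤
        τ * (D * (M.h ^ (k + 1) + starSeminorm hk hS M (v - interp M S W))) := by
  have hba : 0 < b - a := sub_pos.2 hab
  obtain ⟨Q, hQ, HQ⟩ := normSq_equiv (a := a) (b := b) hk hS
  obtain ⟨h₁, h₁0, h₁1, H₁⟩ := supDev_ge hab S K B A hA0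
  obtain ⟨C, hC, H⟩ := filter_normSq_le hab hk S β ρ K (√(A / (4 * (b - a))))
    (Real.sqrt_pos.2 (by positivity))
  -- `η = Q⁻¹` translates the threshold `normSq ≤ h^3` into the energy norm.
  refine ⟨h₁, Q⁻¹, Q * √C * (1 + Q), h₁0, h₁1, by positivity, by positivity,
    fun M hM hh τ v z W f hτ hW hper hf hWf hA hz hv => ?_⟩
  have hh0 := M.h_pos hab
  set y := starSeminorm hk hS M (v - interp M S W)
  have hy : 0 ≤ y := apply_nonneg _ _
  have h1 := (HQ M (v - interp M S W)).1
  have h2 : (v - interp M S W : M.V k).normSq ≤ M.h ^ 3 := by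
    refine h1.trans ?_
    calc Q ^ 2 * y ^ 2 ≤ Q ^ 2 * (Q⁻¹ * √(M.h ^ 3)) ^ 2 := by gcongr
      _ = M.h ^ 3 := by
        rw [mul_pow, Real.sq_sqrt (by positivity)]
        field_simp
  have h3 := H M hM τ W v z hτ hW hper (H₁ M hh v W f hW hf hWf hA h2) hz h2
  have h4 := (HQ M (z - v)).2
  refine le_of_abs_le (abs_le_of_sq_le_sq ?_ (by positivity))
  calc starSeminorm hk hS M (z - v) ^ 2
      ≤ Q ^ 2 * (C * τ ^ 2 * ((M.h ^ (k + 1)) ^ 2 + Q ^ 2 * y ^ 2)) := by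
        refine h4.trans (mul_le_mul_of_nonneg_left (h3.trans ?_) (sq_nonneg Q))
        gcongr
    _ ≤ Q ^ 2 * (C * τ ^ 2 * ((1 + Q) * (M.h ^ (k + 1) + y)) ^ 2) := by
        have h5 : 0 ≤ M.h ^ (k + 1) := by positivity
        have h6 : (M.h ^ (k + 1)) ^ 2 + Q ^ 2 * y ^ 2 ≤ ((1 + Q) * (M.h ^ (k + 1) + y)) ^ 2 := by
          have h7 : M.h ^ (k + 1) + Q * y ≤ (1 + Q) * (M.h ^ (k + 1) + y) := by
            nlinarith [mul_nonneg hQ.le h5]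
          refine le_trans ?_ (pow_le_pow_left₀ (by positivity) h7 2)
          nlinarith [mul_nonneg h5 (mul_nonneg hQ.le hy)]
        gcongr
    _ = (Q * √C * ((1 + Q) * (τ * (M.h ^ (k + 1) + y)))) ^ 2 := by
        rw [mul_pow (Q * √C), mul_pow Q, Real.sq_sqrt hC]; ring
    _ = _ := by ring

variable {a b : ℝ} {k : ℕ}

/-! ### One time step -/

theorem exists_rkStages (R : RKMethod) {E : Type*} [AddCommGroup E] [Module ℝ E]
    (A : E →ₗ[ℝ] E) (x : E) : ∃ ζ : ℕ → E, ζ 0 = x ∧ ∀ l,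
      ζ (l + 1) = ∑ κ ∈ range (l + 1), (R.c l κ • ζ κ + R.d l κ • A (ζ κ)) := by
  let ζ : ℕ → E := fun n => Nat.strongRec (motive := fun _ => E)
    (fun l ih => match l, ih with
      | 0, _ => x
      | l + 1, ih => ∑ κ : Fin (l + 1), (R.c l κ • ih κ κ.2 + R.d l κ • A (ih κ κ.2))) n
  refine ⟨ζ, ?_, fun l => ?_⟩
  · simp only [ζ]; rw [Nat.strongRec]
  · rw [Finset.sum_range]
    simp only [ζ]
    rw [Nat.strongRec]

theorem RKMethod.stage_sub (R : RKMethod) {E : Type*} [AddCommGroup E] [Module ℝ E]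
    (A : E →ₗ[ℝ] E) (u v : ℕ → E) (l : ℕ) (x : E) :
    ∑ κ ∈ range (l + 1), (R.c l κ • u κ + R.d l κ • A (u κ)) - x =
      ∑ κ ∈ range (l + 1), (R.c l κ • (u κ - v κ) + R.d l κ • A (u κ - v κ)) +
        (∑ κ ∈ range (l + 1), (R.c l κ • v κ + R.d l κ • A (v κ)) - x) := by
  rw [add_sub, ← sum_add_distrib]
  congr 1
  refine sum_congr rfl fun κ _ => ?_
  rw [map_sub]
  module

/-- The stability hypothesis with zero source. It bounds squares with factor `1 + Cs τ`, which is at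
most `(1 + Cs τ)²`. -/
theorem star_stable (hk : 1 ≤ k) {S : Subdivision k} {w : Fin (k + 2) → ℝ}
    (hS : S.Admissible w) {M : Mesh a b} {R : RKMethod} {β T γ D Cs Cs' : ℝ} (hCs : 0 ≤ Cs)
    (hst : RKSVStable M S w R β T γ D Cs Cs') {τ : ℝ} (h0 : 0 < τ) (hT : τ ≤ T)
    (hcfl : τ / M.h ^ γ ≤ D) {ζ : ℕ → M.V k}
    (hζ : ∀ l < R.s, ζ (l + 1) =
      ∑ κ ∈ range (l + 1), (R.c l κ • ζ κ + R.d l κ • (τ • svOp M S β) (ζ κ))) :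
    starSeminorm hk hS M (ζ R.s) ≤ (1 + Cs * τ) * starSeminorm hk hS M (ζ 0) := by
  have h := hst τ h0 hT hcfl (fun _ _ => 0) (fun l _ => MeasureTheory.MemLp.zero) (ζ 0) (ζ R.s)
    ⟨ζ, rfl, fun l hl => (isRKStage_iff S R β τ ζ l _).2 (hζ l hl), rfl⟩
  rw [← starSeminorm_eq hk hS, ← starSeminorm_eq hk hS] at h
  have h1 : 0 ≤ Cs * τ := mul_nonneg hCs h0.le
  have h2 := apply_nonneg (starSeminorm hk hS M) (ζ 0)
  refine le_of_abs_le (abs_le_of_sq_le_sq ?_ (by positivity))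
  refine h.trans ?_
  simp only [ne_eq, OfNat.ofNat_ne_zero, not_false_eq_true, zero_pow,
    intervalIntegral.integral_zero, sum_const_zero, mul_zero, add_zero]
  rw [mul_pow]
  refine mul_le_mul_of_nonneg_right ?_ (sq_nonneg _)
  nlinarith

/-- Interpolation is linear, so the terms with `c` cancel, and each remaining term is `τ` times the
consistency error of `svOp`. -/
theorem star_residual_le (hab : a < b) (hk : 1 ≤ k) {S : Subdivision k} {w : Fin (k + 2) → ℝ}
    (hS : S.Admissible w) (β : ℝ) (R : RKMethod) :
    ∃ C : ℝ, 0 ≤ C ∧ ∀ (M : Mesh a b) (K τ : ℝ) (W : ℕ → ℝ → ℝ), 0 ≤ τ →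
      (∀ l < R.s, SmoothBound (k + 2) K (W l)) →
      (∀ l < R.s, ∀ x, W l (x + (b - a)) = W l x) → ∀ l < R.s,
      W (l + 1) = ∑ κ ∈ range (l + 1), (R.c l κ • W κ + R.d l κ • (-(β * τ)) • deriv (W κ)) →
      starSeminorm hk hS M (∑ κ ∈ range (l + 1), (R.c l κ • interp M S (W κ) +
        R.d l κ • (τ • svOp M S β) (interp M S (W κ))) - interp M S (W (l + 1))) ≤
        τ * (C * (K * M.h ^ (k + 1))) := by
  obtain ⟨C, hC, H⟩ := star_consistency hab hk hS β
  refine ⟨(∑ l ∈ range R.s, ∑ κ ∈ range (l + 1), |R.d l κ|) * C, by positivity,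
    fun M K τ W hτ hW hper l hl hst => ?_⟩
  have e : ∑ κ ∈ range (l + 1), (R.c l κ • interp M S (W κ) +
        R.d l κ • (τ • svOp M S β) (interp M S (W κ))) - interp M S (W (l + 1)) =
      ∑ κ ∈ range (l + 1), (R.d l κ * τ) •
        (svOp M S β (interp M S (W κ)) + β • interp M S (deriv (W κ))) := by
    rw [hst, map_sum, ← sum_sub_distrib]
    refine sum_congr rfl fun κ _ => ?_
    simp only [map_add, map_smul, LinearMap.smul_apply]
    module
  have hX : 0 ≤ K * M.h ^ (k + 1) := mul_nonneg (hW l hl).nonneg (by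
    have := (M.h_pos hab).le; positivity)
  rw [e]
  calc _ ≤ ∑ κ ∈ range (l + 1), starSeminorm hk hS M ((R.d l κ * τ) •
        (svOp M S β (interp M S (W κ)) + β • interp M S (deriv (W κ)))) :=
        le_sum_of_subadditive _ (map_zero _).le (map_add_le_add _) _ _
    _ ≤ ∑ κ ∈ range (l + 1), |R.d l κ| * (τ * (C * (K * M.h ^ (k + 1)))) := by
        refine sum_le_sum fun κ hκ => ?_
        have hκ' : κ < R.s := by have := mem_range.1 hκ; lia
        rw [map_smul_eq_mul, Real.norm_eq_abs, abs_mul, abs_of_nonneg hτ, mul_assoc]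
        have := H M K (W κ) (hW κ hκ') (hper κ hκ')
        gcongr
    _ = (∑ κ ∈ range (l + 1), |R.d l κ|) * (τ * (C * (K * M.h ^ (k + 1)))) := by rw [sum_mul]
    _ ≤ (∑ l ∈ range R.s, ∑ κ ∈ range (l + 1), |R.d l κ|) *
        (τ * (C * (K * M.h ^ (k + 1)))) := by
        refine mul_le_mul_of_nonneg_right ?_ (by positivity)
        exact single_le_sum (f := fun l => ∑ κ ∈ range (l + 1), |R.d l κ|)
          (fun _ _ => sum_nonneg fun _ _ => abs_nonneg _) (mem_range.2 hl)
    _ = _ := by ring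

theorem exists_reference (a b : ℝ) (k : ℕ) {R : RKMethod} {r : ℕ} (hR : R.HasOrder r)
    {β T D : ℝ} (K : ℝ) (hβ : 0 < β) (hT : 0 < T) :
    ∃ K' B Z : ℝ, 0 ≤ K' ∧ 0 ≤ Z ∧ ∀ (f : ℝ → ℝ) (τ h : ℝ), 0 < τ → τ ≤ T → τ ≤ D * h →
      SmoothBound (k + 2 + (R.s + r + 1)) K f → (∀ x, f (x + (b - a)) = f x) →
      ∃ W : ℕ → ℝ → ℝ, W 0 = f ∧ (∀ l ≤ R.s, SmoothBound (k + 2) K' (W l)) ∧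
        (∀ l x, W l (x + (b - a)) = W l x) ∧
        (∀ l < R.s, W (l + 1) =
          ∑ κ ∈ range (l + 1), (R.c l κ • W κ + R.d l κ • (-(β * τ)) • deriv (W κ))) ∧
        (∀ l ≤ R.s, ∀ x, |W l x - f x| ≤ B * h) ∧
        ∀ x, |W R.s x - f (x + -(β * τ))| ≤ Z * (β * τ) ^ (r + 1) := by
  -- The truncation order exceeds the degrees of all stage polynomials and covers the order
  -- conditions; `k + 2` further derivatives are left for spatial consistency.
  set n := R.s + r + 1 with hn
  set c₀ := β * T with hc₀
  have hc₀0 : 0 < c₀ := mul_pos hβ hT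
  -- `K ≥ 0` is known only once a function `f` is given, so the constants are built from `|K|`.
  set Kl : ℕ → ℝ := fun l => ∑ m ∈ range (n + 1), |(R.stagePoly l).coeff m| * c₀ ^ m * |K|
  have hKl0 : ∀ l, 0 ≤ Kl l := fun l => sum_nonneg fun m _ => by positivity
  set Bl : ℕ → ℝ := fun l => (∑ m ∈ range (n + 1), |(R.stagePoly l).coeff m| * c₀ ^ (m - 1) * |K|)
  have hBl0 : ∀ l, 0 ≤ Bl l := fun l => sum_nonneg fun m _ => by positivity
  refine ⟨∑ l ∈ range (R.s + 1), Kl l, (∑ l ∈ range (R.s + 1), Bl l) * (β * D),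
    (∑ m ∈ range (n + 1), |(R.stagePoly R.s).coeff m| * c₀ ^ (m - (r + 1)) * |K|) + |K|,
    sum_nonneg fun l _ => hKl0 l, by positivity, fun f τ h hτ hτT hτh hf hper => ?_⟩
  have hKpos := hf.nonneg
  have hcabs : |-(β * τ)| = β * τ := by rw [abs_neg, abs_of_pos (mul_pos hβ hτ)]
  have hcc : |-(β * τ)| ≤ c₀ := by rw [hcabs, hc₀]; gcongr
  refine ⟨fun l => polyOp n (-(β * τ)) f (R.stagePoly l), ?_, fun l hl => ?_,
    fun l x => polyOp_periodic hper _ x, fun l hl => ?_, fun l hl x => ?_, fun x => ?_⟩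
  · change polyOp n (-(β * τ)) f (R.stagePoly 0) = f
    rw [RKMethod.stagePoly, polyOp_one]
  · refine (polyOp_smoothBound hf hcc (R.stagePoly l)).weaken ?_
    rw [← abs_of_nonneg hKpos]
    exact single_le_sum (f := Kl) (fun l _ => hKl0 l) (mem_range.2 (by lia))
  · exact polyOp_stage _ (hf.contDiff.of_le (by norm_cast; lia)) R (by lia)
  · refine (polyOp_sub_self (n := R.s + r) (hf.mono (by lia)) hcc hl x).trans ?_
    rw [← abs_of_nonneg hKpos, hcabs, mul_assoc]
    have h2 : Bl l ≤ ∑ l ∈ range (R.s + 1), Bl l :=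
      single_le_sum (f := Bl) (fun l _ => hBl0 l) (mem_range.2 (by lia))
    have h3 : β * τ ≤ β * D * h := by rw [mul_assoc]; gcongr
    exact mul_le_mul h2 h3 (by positivity) ((hBl0 l).trans h2)
  · have h1 := polyOp_order_error (n := R.s) (hf.mono (by lia)) hcc hR x
    rwa [← abs_of_nonneg hKpos, hcabs] at h1

/-- Errors are measured against the interpolants of the reference stages: the residuals come from
`star_residual_le`, the filter from `star_filter_le`, and the unperturbed step from `star_stable`.
At the end the last reference stage is replaced by the translate of `f`, at cost `O(τ^(r+1))`. -/
theorem oesv_step_le (hab : a < b) (hk : 1 ≤ k) {S : Subdivision k} {w : Fin (k + 2) → ℝ}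
    (hS : S.Admissible w) {R : RKMethod} {r : ℕ} (hR : R.HasOrder r)
    {β T ρ γ D Cs Cs' K A : ℝ} (hβ : 0 < β) (hT : 0 < T) (hγ : 1 ≤ γ) (hD : 0 < D)
    (hCs : 0 ≤ Cs) (hA0 : 0 < A) :
    ∃ h₁ η C : ℝ, 0 < h₁ ∧ h₁ ≤ 1 ∧ 0 < η ∧ 0 ≤ C ∧ ∀ M : Mesh a b, M.QuasiUniform ρ →
      RKSVStable M S w R β T γ D Cs Cs' → M.h ≤ h₁ →
      ∀ (τ : ℝ) (f : ℝ → ℝ) (v z : M.V k), 0 < τ → τ ≤ T → τ / M.h ^ γ ≤ D →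
      SmoothBound (k + 2 + (R.s + r + 1)) K f → (∀ x, f (x + (b - a)) = f x) →
      (∀ c, A ≤ ∫ x in a..b, (f x - c) ^ 2) → IsOESVStep S R β τ v z →
      C * (starSeminorm hk hS M (v - interp M S f) + M.h ^ (k + 1)) ≤ η * √(M.h ^ 3) →
      starSeminorm hk hS M (z - interp M S fun x => f (x + -(β * τ))) ≤
        (1 + C * τ) * starSeminorm hk hS M (v - interp M S f) +
          C * τ * (M.h ^ (k + 1) + τ ^ r) := by
  obtain ⟨K', B, Z, hK'0, hZ0, HW⟩ := exists_reference (D := D) a b k hR K hβ hT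
  obtain ⟨L, hL, HL⟩ := star_svOp_le hab hk hS β ρ D hD
  obtain ⟨C₁, h₁0, H₁⟩ := star_residual_le hab hk hS β R
  obtain ⟨h₁, η, D₂, hh₁0, hh₁1, hη, hD₂, H₂⟩ := star_filter_le hab hk hS β ρ K' B A hA0
  obtain ⟨C₃, h₃, H₃⟩ := star_interp_le hab hk hS (w := w)
  -- One quantity `ε = G h^(k+1)` has to dominate both the residual constant and the plain `h^(k+1)`
  -- of the filter estimate.
  set G := 1 + C₁ * K' with hG
  have hG1 : 1 ≤ G := by rw [hG]; have := mul_nonneg h₁0 hK'0; linarith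
  obtain ⟨P, hP, HP⟩ := R.perturbed_step hL hT.le hD₂
  clear_value G
  -- The three summands account for the perturbations, the stability of the linear step and the time
  -- truncation.
  refine ⟨h₁, η, P * G + Cs + C₃ * (Z * β ^ (r + 1)), hh₁0, hh₁1, hη, by positivity, ?_⟩
  intro M hM hst hh τ f v z hτ hτT hcfl hf hper hA hstep hsmall
  obtain ⟨u, u', hu0, hu, hus⟩ := hstep
  have hh0 := M.h_pos hab
  have hτh := step_le_of_cfl hh0 (hh.trans hh₁1) hγ hD hcfl
  obtain ⟨W, hW0, hWs, hWper, hWst, hWf, hWend⟩ := HW f τ M.h hτ hτT hτh hf hper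
  obtain ⟨ζ, hζ0, hζ⟩ := exists_rkStages R (τ • svOp M S β) (v - interp M S f)
  set Y := starSeminorm hk hS M (v - interp M S f) with hY
  have hY0 : 0 ≤ Y := apply_nonneg _ _
  have hH0 : 0 ≤ M.h ^ (k + 1) := by positivity
  have hGH : M.h ^ (k + 1) ≤ G * M.h ^ (k + 1) := le_mul_of_one_le_left hH0 hG1
  have hPG : P * (Y + G * M.h ^ (k + 1)) ≤ P * G * (Y + M.h ^ (k + 1)) := by
    rw [mul_assoc]
    refine mul_le_mul_of_nonneg_left ?_ hP
    nlinarith [le_mul_of_one_le_left hY0 hG1]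
  have hX0 : 0 ≤ C₃ * (Z * β ^ (r + 1)) := by positivity
  have hsm : P * (Y + G * M.h ^ (k + 1)) ≤ η * √(M.h ^ 3) := by
    refine hPG.trans (le_trans ?_ hsmall)
    refine mul_le_mul_of_nonneg_right ?_ (add_nonneg hY0 hH0)
    linarith
  obtain ⟨e, he⟩ : ∃ e : ℕ → M.V k, ∀ l, e l = u l - interp M S (W l) := ⟨_, fun _ => rfl⟩
  obtain ⟨e', he'⟩ : ∃ e : ℕ → M.V k, ∀ l, e l = u' l - interp M S (W l) := ⟨_, fun _ => rfl⟩
  obtain ⟨res, hres⟩ : ∃ res : ℕ → M.V k, ∀ l, res l =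
      ∑ κ ∈ range (l + 1), (R.c l κ • interp M S (W κ) +
        R.d l κ • (τ • svOp M S β) (interp M S (W κ))) - interp M S (W (l + 1)) :=
    ⟨_, fun _ => rfl⟩
  have he0 : e 0 = v - interp M S f := by rw [he, hu0, hW0]
  have hstage : ∀ l < R.s, e' (l + 1) = ∑ κ ∈ range (l + 1),
      (R.c l κ • e κ + R.d l κ • (τ • svOp M S β) (e κ)) + res l := fun l hl => by
    have h1 : u' (l + 1) = ∑ κ ∈ range (l + 1),
        (R.c l κ • u κ + R.d l κ • (τ • svOp M S β) (u κ)) :=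
      (isRKStage_iff S R β τ u l (u' (l + 1))).1 (hu l hl).1
    rw [he', h1, hres]
    simp only [he]
    exact R.stage_sub (τ • svOp M S β) u (fun κ => interp M S (W κ)) l _
  have hresN : ∀ l < R.s, starSeminorm hk hS M (res l) ≤ τ * (G * M.h ^ (k + 1)) := fun l hl => by
    rw [hres]
    refine (H₁ M K' τ W hτ.le (fun l hl => hWs l hl.le) (fun l _ => hWper l) l hl
      (hWst l hl)).trans (mul_le_mul_of_nonneg_left ?_ hτ.le)
    rw [hG, add_mul, one_mul, mul_assoc]
    exact le_add_of_nonneg_left hH0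
  have hfilt : ∀ l < R.s, starSeminorm hk hS M (e' (l + 1)) ≤ η * √(M.h ^ 3) →
      starSeminorm hk hS M (e (l + 1) - e' (l + 1)) ≤
        τ * (D₂ * (G * M.h ^ (k + 1) + starSeminorm hk hS M (e' (l + 1)))) := fun l hl hθ => by
    rw [he'] at hθ
    have hs : SmoothBound (k + 1) K' (W (l + 1)) := (hWs (l + 1) hl).mono (by lia)
    have h1 := H₂ M hM hh τ (u' (l + 1)) (u (l + 1)) (W (l + 1)) f hτ.le hs (hWper _)
      hf.contDiff.continuous (hWf (l + 1) hl) hA (hu l hl).2 hθ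
    rw [← he'] at h1
    have h2 : e (l + 1) - e' (l + 1) = u (l + 1) - u' (l + 1) := by
      rw [he, he', sub_sub_sub_cancel_right]
    rw [h2]
    refine h1.trans (mul_le_mul_of_nonneg_left ?_ hτ.le)
    exact mul_le_mul_of_nonneg_left (add_le_add_left hGH _) hD₂
  have key := HP (starSeminorm hk hS M) (τ • svOp M S β) τ (G * M.h ^ (k + 1))
    (η * √(M.h ^ 3)) e e' res ζ
    (HL M hM τ hτ.le hτh) hτ.le hτT (by positivity) hstage hresN hfilt (by rw [hζ0, he0])
    (fun l _ => hζ l) (by rw [he0]; exact hsm)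
  rw [he0, he, hus] at key
  have hstab := star_stable hk hS hCs hst hτ hτT hcfl fun l _ => hζ l
  rw [hζ0] at hstab
  have hfin : starSeminorm hk hS M (interp M S (W R.s - fun x => f (x + -(β * τ)))) ≤
      C₃ * (Z * (β * τ) ^ (r + 1)) := H₃ M _ _ fun x => hWend x
  have e : z - interp M S (fun x => f (x + -(β * τ))) =
      (z - interp M S (W R.s)) + interp M S (W R.s - fun x => f (x + -(β * τ))) := by
    rw [map_sub]; abel
  rw [e]
  refine (map_add_le_add (starSeminorm hk hS M) _ _).trans
    ((add_le_add (key.trans (add_le_add_left hstab _)) hfin).trans ?_)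
  rw [mul_pow]
  have h5 : P * τ * (Y + G * M.h ^ (k + 1)) ≤ τ * (P * G * (Y + M.h ^ (k + 1))) := by
    rw [mul_comm P, mul_assoc]; exact mul_le_mul_of_nonneg_left hPG hτ.le
  have h6 : C₃ * (Z * (β ^ (r + 1) * τ ^ (r + 1))) = C₃ * (Z * β ^ (r + 1)) * τ * τ ^ r := by
    rw [pow_succ τ]; ring
  rw [h6]
  have e1 : 0 ≤ C₃ * (Z * β ^ (r + 1)) * τ * (Y + M.h ^ (k + 1)) := by positivity
  have e2 : 0 ≤ (P * G + Cs) * τ * τ ^ r := by positivity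
  have e3 : 0 ≤ Cs * τ * M.h ^ (k + 1) := by positivity
  change (1 + Cs * τ) * Y + P * τ * (Y + G * M.h ^ (k + 1)) + _ ≤ _
  linarith

variable {a b : ℝ} {k : ℕ}

/-! ### Constant states -/

theorem svOp_of_const {M : Mesh a b} (S : Subdivision k) (β : ℝ) {v : M.V k} {c : ℝ}
    (hv : ∀ i, (v i : ℝ[X]) = C c) : svOp M S β v = 0 := by
  funext i
  apply Subtype.ext
  have h1 : upVal S i v = fun _ => c := by
    funext j
    by_cases h : j = 0 <;> simp [upVal, hv, h]
  have h2 : C c = fullInterp M S i fun _ => c := by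
    refine Lagrange.eq_interpolate_of_eval_eq _ (cvPoint_injective M S i).injOn ?_ fun j _ => eval_C
    refine degree_C_le.trans_lt ?_
    rw [card_univ, Fintype.card_fin]
    exact_mod_cast Nat.succ_pos _
  rw [svOp_coe, h1, ← h2, derivative_C, smul_zero, neg_zero]
  rfl

/-- For a constant the damping coefficients are zero by convention, and with zero damping
`filter_energy_le` leaves no change. -/
theorem filter_of_const (hab : a < b) (hk : 1 ≤ k) {M : Mesh a b} {β τ : ℝ} (hτ : 0 ≤ τ)
    {v z : M.V k} {c : ℝ} (hv : ∀ i, (v i : ℝ[X]) = C c) (h : IsOEFilter β τ v z) : z = v := by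
  have hval : ∀ i x, v.val i x = c := fun i x => by simp [V.val, hv]
  have havg : v.avg = c := by
    have hba : b - a ≠ 0 := (sub_pos.2 hab).ne'
    have : ∀ i, M.right i - M.left i = M.size i := fun _ => rfl
    simp only [V.avg, hval, intervalIntegral.integral_const, smul_eq_mul, this]
    rw [← sum_mul, M.sum_size, mul_div_cancel_left₀ _ hba]
  have hδ : ∀ i, totalDelta β v i = 0 := fun i => sum_eq_zero fun m _ => by
    have hσ : ∀ J, sigma m v i J = 0 := fun J => if_pos fun i' x _ => by rw [hval, havg]
    simp [delta, hσ]
  obtain ⟨Q, -, H⟩ := filter_energy_le (a := a) (b := b) hk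
  funext i
  have h1 := H M β τ v z hτ h i c
  rw [hδ, mul_zero, zero_pow two_ne_zero, mul_zero, zero_mul] at h1
  by_contra hne
  have h2 : (z i : ℝ[X]) - v i ≠ 0 := fun h0 => hne (Subtype.ext (sub_eq_zero.1 h0))
  have h3 := polyInt_sq_pos (x := M.left i) (y := M.right i)
    (by linarith [M.left_add_size i, M.size_pos i]) h2
  rw [polyInt_cell, ref_mul] at h3
  exact absurd h3 (not_lt.2 (mul_nonpos_of_nonneg_of_nonpos (M.size_pos i).le h1))

theorem oesv_step_const (hab : a < b) (hk : 1 ≤ k) {M : Mesh a b} {S : Subdivision k}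
    {R : RKMethod} {β τ : ℝ} (hτ : 0 ≤ τ) {v z : M.V k} {c : ℝ}
    (hv : ∀ i, (v i : ℝ[X]) = C c) (h : IsOESVStep S R β τ v z) : ∀ i, (z i : ℝ[X]) = C c := by
  obtain ⟨u, u', rfl, hu, rfl⟩ := h
  have key : ∀ l ≤ R.s, ∀ i, (u l i : ℝ[X]) = C c := by
    intro l
    induction l using Nat.strong_induction_on with
    | _ l ih =>
      intro hl
      cases l with
      | zero => exact hv
      | succ l =>
        have h1 := (isRKStage_iff S R β τ u l (u' (l + 1))).1 (hu l hl).1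
        have h2 : ∀ i, (u' (l + 1) i : ℝ[X]) = C c := fun i => by
          have h3 : ∀ κ ∈ range (l + 1), R.c l κ • u κ + R.d l κ • τ • svOp M S β (u κ) =
              R.c l κ • u 0 := fun κ hκ => by
            have h4 := ih κ (mem_range.1 hκ) (by have := mem_range.1 hκ; lia)
            have h5 : u κ = u 0 := funext fun i => Subtype.ext ((h4 i).trans (hv i).symm)
            rw [svOp_of_const S β h4, h5, smul_zero, smul_zero, add_zero]
          rw [h1, sum_congr rfl h3, ← sum_smul, R.sum_c l hl, one_smul, hv]
        rwa [filter_of_const hab hk hτ h2 (hu l hl).2]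
  exact key R.s le_rfl

theorem l2dist_of_const {M : Mesh a b} {v : M.V k} {c : ℝ} (hv : ∀ i, (v i : ℝ[X]) = C c)
    {f : ℝ → ℝ} (hf : ∀ x, f x = c) : v.l2dist f = 0 := by
  simp [V.l2dist, V.val, hv, hf]

/-! ### Variance of a periodic function -/

/-- The integral is smallest when `c` is the mean, and periodicity makes it invariant under
translation. One `A` thus serves the exact solution at all times. -/
theorem exists_variance_pos (hab : a < b) {f : ℝ → ℝ} (hf : Continuous f)
    (hper : ∀ x, f (x + (b - a)) = f x) (hne : ¬∀ x y, f x = f y) :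
    ∃ A : ℝ, 0 < A ∧ ∀ t c, A ≤ ∫ x in a..b, (f (x + t) - c) ^ 2 := by
  have hba : 0 < b - a := sub_pos.2 hab
  set m := (∫ x in a..b, f x) / (b - a) with hm
  have hexp : ∀ c, ∫ x in a..b, (f x - c) ^ 2 =
      (∫ x in a..b, f x ^ 2) - 2 * c * (∫ x in a..b, f x) + (b - a) * c ^ 2 := fun c => by
    have e : ∀ x, (f x - c) ^ 2 = f x ^ 2 - 2 * c * f x + c ^ 2 := fun x => by ring
    simp only [e]
    rw [intervalIntegral.integral_add (Continuous.intervalIntegrable (by fun_prop) _ _)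
      (Continuous.intervalIntegrable (by fun_prop) _ _), intervalIntegral.integral_sub
      (Continuous.intervalIntegrable (by fun_prop) _ _)
      (Continuous.intervalIntegrable (by fun_prop) _ _), intervalIntegral.integral_const_mul,
      intervalIntegral.integral_const, smul_eq_mul]
  refine ⟨∫ x in a..b, (f x - m) ^ 2, ?_, fun t c => ?_⟩
  · refine intervalIntegral.integral_pos hab (by fun_prop) (fun _ _ => sq_nonneg _) ?_
    by_contra! h
    have h1 : ∀ x ∈ Set.Icc a b, f x = m := fun x hx =>
      sub_eq_zero.1 (pow_eq_zero_iff two_ne_zero |>.1 (le_antisymm (h x hx) (sq_nonneg _)))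
    have h2 : ∀ x, f x = m := fun x => by
      obtain ⟨y, hy, hxy⟩ := Function.Periodic.exists_mem_Ico (f := f) hper hba x a
      rw [hxy]
      exact h1 y ⟨hy.1, by linarith [hy.2]⟩
    exact hne fun x y => (h2 x).trans (h2 y).symm
  · have hs : ∫ x in a..b, (f (x + t) - c) ^ 2 = ∫ x in a..b, (f x - c) ^ 2 := by
      rw [intervalIntegral.integral_comp_add_right (fun x => (f x - c) ^ 2)]
      have hp : Function.Periodic (fun x => (f x - c) ^ 2) (b - a) := fun x => by
        simp only [hper]
      have := hp.intervalIntegral_add_eq (a + t) a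
      rwa [show a + t + (b - a) = b + t by ring, add_sub_cancel] at this
    have hI : ∫ x in a..b, f x = (b - a) * m := by rw [hm]; field_simp
    rw [hs, hexp, hexp, hI]
    nlinarith [mul_nonneg hba.le (sq_nonneg (m - c))]

/-! ### Error estimates -/

theorem star_le_of_l2dist_le (hab : a < b) (hk : 1 ≤ k) {S : Subdivision k}
    {w : Fin (k + 2) → ℝ} (hS : S.Admissible w) (K C₀ : ℝ) :
    ∃ E : ℝ, 0 ≤ E ∧ ∀ (M : Mesh a b) (f : ℝ → ℝ) (v : M.V k), SmoothBound (k + 1) K f →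
      v.l2dist f ≤ C₀ * M.h ^ (k + 1) →
      starSeminorm hk hS M (v - interp M S f) ≤ E * M.h ^ (k + 1) := by
  obtain ⟨Q, hQ, HQ⟩ := normSq_equiv (a := a) (b := b) hk hS
  obtain ⟨C, hC, H⟩ := l2dist_interp_sq (k := k) hab S
  refine ⟨Q * √(2 * C₀ ^ 2 + 2 * (C * K ^ 2)), by positivity, fun M f v hf hv => ?_⟩
  have hh := M.h_pos hab
  refine le_of_abs_le (abs_le_of_sq_le_sq ?_ (by positivity))
  have h1 := pow_le_pow_left₀ (Real.sqrt_nonneg _) hv 2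
  have h2 := normSq_sub_le v (interp M S f) hf.contDiff.continuous
  have h3 := H M K f hf
  calc _ ≤ Q ^ 2 * (v - interp M S f : M.V k).normSq := (HQ M _).2
    _ ≤ Q ^ 2 * (2 * (C₀ * M.h ^ (k + 1)) ^ 2 + 2 * (C * (K * M.h ^ (k + 1)) ^ 2)) := by
        refine mul_le_mul_of_nonneg_left (h2.trans ?_) (sq_nonneg Q)
        exact add_le_add (mul_le_mul_of_nonneg_left h1 zero_le_two)
          (mul_le_mul_of_nonneg_left h3 zero_le_two)
    _ = _ := by
        rw [mul_pow (Q * _), mul_pow Q, Real.sq_sqrt (by positivity)]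
        ring

theorem l2dist_le_of_star_le (hab : a < b) (hk : 1 ≤ k) {S : Subdivision k}
    {w : Fin (k + 2) → ℝ} (hS : S.Admissible w) (K : ℝ) :
    ∃ F : ℝ, 0 ≤ F ∧ ∀ (M : Mesh a b) (f : ℝ → ℝ) (v : M.V k), SmoothBound (k + 1) K f →
      v.l2dist f ≤ F * (starSeminorm hk hS M (v - interp M S f) + M.h ^ (k + 1)) := by
  obtain ⟨Q, hQ, HQ⟩ := normSq_equiv (a := a) (b := b) hk hS
  obtain ⟨C, hC, H⟩ := l2dist_interp_sq (k := k) hab S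
  refine ⟨√(2 * Q ^ 2 + 2 * (C * K ^ 2)), by positivity, fun M f v hf => ?_⟩
  have hh : 0 ≤ M.h ^ (k + 1) := pow_nonneg (M.h_pos hab).le _
  have hN := apply_nonneg (starSeminorm hk hS M) (v - interp M S f)
  refine le_of_abs_le (abs_le_of_sq_le_sq ?_ (by positivity))
  have h1 := (HQ M (v - interp M S f)).1
  have h2 := l2dist_sq_le v (interp M S f) hf.contDiff.continuous
  have h3 := H M K f hf
  set y := starSeminorm hk hS M (v - interp M S f)
  set h := M.h ^ (k + 1)
  calc _ ≤ 2 * (Q ^ 2 * y ^ 2) + 2 * (C * (K * h) ^ 2) := by linarith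
    _ = 2 * Q ^ 2 * y ^ 2 + 2 * (C * K ^ 2) * h ^ 2 := by ring
    _ ≤ (2 * Q ^ 2 + 2 * (C * K ^ 2)) * (y ^ 2 + h ^ 2) := by
        have e1 : 0 ≤ 2 * (C * K ^ 2) * y ^ 2 := by positivity
        have e2 : 0 ≤ 2 * Q ^ 2 * h ^ 2 := by positivity
        linarith
    _ ≤ (2 * Q ^ 2 + 2 * (C * K ^ 2)) * (y + h) ^ 2 := by
        refine mul_le_mul_of_nonneg_left ?_ (by positivity)
        nlinarith [mul_nonneg hN hh]
    _ = _ := by rw [mul_pow, Real.sq_sqrt (by positivity)]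

/-- The target error is `O(h^2)`, which lies below the filter threshold of order `h^(3/2)` for small
`h`. -/
theorem error_scale_le {h τ T D : ℝ} {r : ℕ} (hk : 1 ≤ k) (hr : 2 ≤ r) (h0 : 0 < h) (h1 : h ≤ 1)
    (hτ : 0 ≤ τ) (hτT : τ ≤ T) (hD : τ ≤ D * h) :
    h ^ (k + 1) + τ ^ r ≤ (1 + T ^ (r - 2) * D ^ 2) * h ^ 2 := by
  have e1 : h ^ (k + 1) ≤ h ^ 2 := pow_le_pow_of_le_one h0.le h1 (by lia)
  have e2 : τ ^ r ≤ T ^ (r - 2) * (D * h) ^ 2 := by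
    calc τ ^ r = τ ^ (r - 2) * τ ^ 2 := by rw [← pow_add]; congr 1; lia
      _ ≤ _ := mul_le_mul (pow_le_pow_left₀ hτ hτT _) (pow_le_pow_left₀ hτ hD 2)
        (sq_nonneg τ) (pow_nonneg (hτ.trans hτT) _)
  rw [mul_pow] at e2
  linarith

theorem error_le_of_variance_pos (hab : a < b) (hk : 1 ≤ k) {S : Subdivision k}
    {w : Fin (k + 2) → ℝ} (hS : S.Admissible w) {R : RKMethod} {r : ℕ} (hR : R.HasOrder r)
    (hr : 2 ≤ r) {β T ρ γ D Cs Cs' K A : ℝ} (hβ : 0 < β) (hT : 0 < T) (hγ : 1 ≤ γ) (hD : 0 < D)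
    (hCs : 0 ≤ Cs) (hA0 : 0 < A) {f : ℝ → ℝ} (hf : SmoothBound (k + 2 + (R.s + r + 1)) K f)
    (hper : ∀ x, f (x + (b - a)) = f x)
    (hA : ∀ t c, A ≤ ∫ x in a..b, (f (x + t) - c) ^ 2) (C₀ : ℝ) :
    ∃ C h₀ : ℝ, 0 < C ∧ 0 < h₀ ∧ ∀ M : Mesh a b, M.QuasiUniform ρ →
      RKSVStable M S w R β T γ D Cs Cs' → M.h ≤ h₀ → ∀ (τ : ℝ) (nT : ℕ), 0 < τ →
      nT * τ = T → τ / M.h ^ γ ≤ D → ∀ uh : ℕ → M.V k,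
      (uh 0).l2dist f ≤ C₀ * M.h ^ (k + 1) →
      (∀ n < nT, IsOESVStep S R β τ (uh n) (uh (n + 1))) → ∀ n ≤ nT,
      (uh n).l2dist (fun x => f (x + -(β * (n * τ)))) ≤ C * (M.h ^ (k + 1) + τ ^ r) := by
  obtain ⟨h₁, η, P, hh₁0, hh₁1, hη, hP, HS⟩ :=
    oesv_step_le (K := K) (ρ := ρ) (Cs' := Cs') hab hk hS hR hβ hT hγ hD hCs hA0
  obtain ⟨E, hE, HE⟩ := star_le_of_l2dist_le hab hk hS K C₀
  obtain ⟨F, hF, HF⟩ := l2dist_le_of_star_le hab hk hS K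
  set X := Real.exp (P * T) * (E + 1) with hX
  have hX0 : 0 ≤ X := by positivity
  -- The left side of the smallness condition is at most `G h^2`; it lies below `η h^(3/2)` as soon
  -- as `G² h ≤ η²`, which explains the choice of `h₀`.
  set G := P * ((X + 1) * (1 + T ^ (r - 2) * D ^ 2)) with hG
  have hG0 : 0 ≤ G := by positivity
  refine ⟨F * (X + 1) + 1, min h₁ (η ^ 2 / (G ^ 2 + 1)), by positivity,
    lt_min hh₁0 (by positivity), fun M hM hst hh τ nT hτ hnT hcfl uh hu0 hstep n hn => ?_⟩
  have hh0 := M.h_pos hab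
  have hhle : M.h ≤ h₁ := hh.trans (min_le_left _ _)
  have hhη : (G ^ 2 + 1) * M.h ≤ η ^ 2 := by
    rw [mul_comm]
    exact (le_div_iff₀ (by positivity)).1 (hh.trans (min_le_right _ _))
  have hτT : τ ≤ T := by
    have h1 : (1 : ℝ) ≤ nT := by
      rcases Nat.eq_zero_or_pos nT with h | h
      · rw [h] at hnT; simp at hnT; linarith
      · exact_mod_cast h
    rw [← hnT]
    exact le_mul_of_one_le_left hτ.le h1
  have hτh := step_le_of_cfl hh0 (hhle.trans hh₁1) hγ hD hcfl
  have hscale := error_scale_le (r := r) hk hr hh0 (hhle.trans hh₁1) hτ.le hτT hτh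
  have hH0 : 0 ≤ M.h ^ (k + 1) := by positivity
  have hτr : 0 ≤ τ ^ r := by positivity
  set ε := M.h ^ (k + 1) + τ ^ r with hε
  have hε0 : 0 ≤ ε := add_nonneg hH0 hτr
  obtain ⟨g, hg⟩ : ∃ g : ℕ → ℝ → ℝ, ∀ n, g n = fun x => f (x + -(β * (n * τ))) :=
    ⟨_, fun _ => rfl⟩
  have hg0 : g 0 = f := by rw [hg]; simp
  have hgs : ∀ n, g (n + 1) = fun x => g n (x + -(β * τ)) := fun n => by
    rw [hg, hg]
    funext x
    congr 1
    push_cast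
    ring
  have hgb : ∀ n, SmoothBound (k + 2 + (R.s + r + 1)) K (g n) := fun n => by
    rw [hg]; exact hf.comp_add_const _
  have hgper : ∀ n x, g n (x + (b - a)) = g n x := fun n x => by
    rw [hg]; simp only; rw [add_right_comm, hper]
  obtain ⟨x, hx⟩ : ∃ x : ℕ → ℝ, ∀ n, x n = starSeminorm hk hS M (uh n - interp M S (g n)) :=
    ⟨_, fun _ => rfl⟩
  have hx0 : 0 ≤ x 0 := by rw [hx]; exact apply_nonneg _ _
  have hinit : x 0 + ε ≤ (E + 1) * ε := by
    have h1 := HE M f (uh 0) (hf.mono (by lia)) hu0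
    rw [← hg0, ← hx] at h1
    have h2 : E * M.h ^ (k + 1) ≤ E * ε :=
      mul_le_mul_of_nonneg_left (le_add_of_nonneg_right hτr) hE
    linarith
  have hΘ : Real.exp (P * T) * (x 0 + ε) ≤ X * ε := by
    rw [hX, mul_assoc]
    exact mul_le_mul_of_nonneg_left hinit (Real.exp_nonneg _)
  have hsmall : P * (X * ε + M.h ^ (k + 1)) ≤ η * √(M.h ^ 3) := by
    calc P * (X * ε + M.h ^ (k + 1)) ≤ P * ((X + 1) * ε) := by
          refine mul_le_mul_of_nonneg_left ?_ hP
          linarith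
      _ ≤ P * ((X + 1) * ((1 + T ^ (r - 2) * D ^ 2) * M.h ^ 2)) := by gcongr
      _ = G * M.h ^ 2 := by rw [hG]; ring
      _ ≤ _ := by
          refine le_of_abs_le (abs_le_of_sq_le_sq ?_ (by positivity))
          rw [mul_pow η, Real.sq_sqrt (by positivity)]
          calc (G * M.h ^ 2) ^ 2 = G ^ 2 * M.h * M.h ^ 3 := by ring
            _ ≤ η ^ 2 * M.h ^ 3 := by
                refine mul_le_mul_of_nonneg_right ?_ (by positivity)
                linarith
  have hgron : ∀ n < nT, x n ≤ X * ε → x (n + 1) ≤ (1 + P * τ) * x n + P * τ * ε := by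
    intro n hn hxn
    have h1 := HS M hM hst hhle τ (g n) (uh n) (uh (n + 1)) hτ hτT hcfl (hgb n) (hgper n)
      (fun c => by rw [hg]; exact hA _ c) (hstep n hn) (by
        rw [← hx]
        exact (mul_le_mul_of_nonneg_left (add_le_add_left hxn _) hP).trans hsmall)
    rwa [← hgs, ← hx, ← hx] at h1
  have hfin := discrete_gronwall hx0 hP hτ.le hε0 hnT hgron hΘ hn
  have h1 := HF M (g n) (uh n) ((hgb n).mono (by lia))
  rw [← hx, hg] at h1
  calc _ ≤ F * (x n + M.h ^ (k + 1)) := h1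
    _ ≤ F * (X * ε + ε) := by
        refine mul_le_mul_of_nonneg_left (add_le_add (hfin.trans hΘ) ?_) hF
        exact le_add_of_nonneg_right hτr
    _ ≤ _ := by linarith

end OESV

end

/-! ### The main theorem -/

theorem mainTheorem1 (k r : ℕ) (hk : 1 ≤ k) (hr : 2 ≤ r)
    (R : OESV.RKMethod) (hR : R.HasOrder r) :
    ∃ q : ℕ, ∀ (a b β T : ℝ), a < b → 0 < β → 0 < T →
    ∀ (S : OESV.Subdivision k) (w : Fin (k + 2) → ℝ), S.Admissible w →
    -- a quasi-uniform family of meshes on which the RKSV scheme is uniformly stable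
    ∀ (𝓣 : Set (OESV.Mesh a b)) (ρ γ CCFL Cs Cs' : ℝ), 1 ≤ γ → 0 < CCFL → 0 ≤ Cs → 0 ≤ Cs' →
    (∀ M ∈ 𝓣, M.QuasiUniform ρ) →
    (∀ M ∈ 𝓣, OESV.RKSVStable M S w R β T γ CCFL Cs Cs') →
    ∀ (U : ℝ → ℝ → ℝ), OESV.IsExactSolution a b β T q U →
    ∀ C₀ : ℝ,
    ∃ C h₀ : ℝ, 0 < C ∧ 0 < h₀ ∧
      ∀ M ∈ 𝓣, M.h ≤ h₀ →
      ∀ (τ : ℝ) (nT : ℕ), 0 < τ → nT * τ = T → τ / M.h ^ γ ≤ CCFL →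
      ∀ uh : ℕ → M.V k,
        (uh 0).l2dist (fun x => U x 0) ≤ C₀ * M.h ^ (k + 1) →
        -- if the initial datum is constant, it is taken over exactly
        ((∀ x y, U x 0 = U y 0) → ∀ i x, (uh 0).val i x = U x 0) →
        (∀ n < nT, OESV.IsOESVStep S R β τ (uh n) (uh (n + 1))) →
        ∀ n ≤ nT, (uh n).l2dist (fun x => U x (n * τ)) ≤ C * (M.h ^ (k + 1) + τ ^ r) := by
  -- `k + 2` derivatives for spatial consistency and `s + r + 1` for the reference stages.
  refine ⟨k + 2 + (R.s + r + 1), fun a b β T hab hβ hT S w hS 𝓣 ρ γ D Cs Cs' hγ hD hCs _ hqu hst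
    U hU C₀ => ?_⟩
  have hba : b - a ≠ 0 := (sub_pos.2 hab).ne'
  have hcont := hU.contDiff_initial hT
  have hper : ∀ x, U (x + (b - a)) 0 = U x 0 := fun x => hU.periodic x 0 ⟨le_rfl, hT.le⟩
  have htr : ∀ {τ : ℝ} {nT n : ℕ}, 0 < τ → nT * τ = T → n ≤ nT →
      ∀ x, U x (n * τ) = U (x + -(β * (n * τ))) 0 := fun {τ nT n} hτ hnT hn x => by
    have hn' : (n : ℝ) ≤ nT := by exact_mod_cast hn
    have ht : (n * τ : ℝ) ∈ Set.Icc 0 T :=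
      ⟨by positivity, hnT ▸ mul_le_mul_of_nonneg_right hn' hτ.le⟩
    rw [hU.eq_translate (by lia) ht, sub_eq_add_neg]
  -- For constant data there is no lower bound on the denominator of the damping coefficients, but
  -- the scheme reproduces the constant and the error is zero.
  by_cases hconst : ∀ x y, U x 0 = U y 0
  · refine ⟨1, 1, one_pos, one_pos, fun M _ _ τ nT hτ hnT _ uh _ hu0 hstep n hn => ?_⟩
    have hu : ∀ n ≤ nT, ∀ i, (uh n i : ℝ[X]) = Polynomial.C (U 0 0) := by
      intro n
      induction n with
      | zero =>
        refine fun _ i => Polynomial.funext fun x => ?_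
        rw [Polynomial.eval_C]
        exact (hu0 hconst i x).trans (hconst x 0)
      | succ n ih => exact fun hn => OESV.oesv_step_const hab hk hτ.le (ih (by lia)) (hstep n hn)
    rw [OESV.l2dist_of_const (hu n hn) fun x => (htr hτ hnT hn x).trans (hconst _ _)]
    have := M.h_pos hab
    positivity
  · obtain ⟨A, hA0, hA⟩ := OESV.exists_variance_pos hab hcont.continuous hper hconst
    obtain ⟨K, hK⟩ := OESV.exists_smoothBound hba hcont hper
    obtain ⟨C, h₀, hC, hh₀, H⟩ := OESV.error_le_of_variance_pos (ρ := ρ) (Cs' := Cs') hab hk hS hR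
      hr hβ hT hγ hD hCs hA0 hK hper hA C₀
    refine ⟨C, h₀, hC, hh₀, fun M hM hh τ nT hτ hnT hcfl uh hu0 _ hstep n hn => ?_⟩
    simp only [htr hτ hnT hn]
    exact H M (hqu M hM) (hst M hM) hh τ nT hτ hnT hcfl uh hu0 hstep n hn
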